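/- An input graph is a finite non-empty simple undirected graph $G=(V,E)$ without isolated vertices; write $n=|V|$, $m=|E|$ and $d=2m/n$ (the average degree). Each vertex is identified by a distinct id, an arbitrary natural number, so ids reveal nothing about $n$. A randomized (adaptive) query algorithm gets no information on $G$ (in particular not $n$) except through an oracle. In the *advanced model* the queries are: $\mathrm{RandVert}()$, a uniformly random vertex; $\mathrm{RandNbr}(x)$, a uniformly random neighbour of $x$; $\mathrm{Degree}(x)$; $\mathrm{Pair}(x,y)$, whether $\{x,y\}\in E$; each at cost $1$; and $\mathrm{Additive}(S)$ for a set $S\subseteq V$, the number of edges with both endpoints in $S$, at cost $|S|$. (A query that mentions a non-vertex is answered "invalid".) In the stronger *full adjacency model* there is in addition the query that returns the whole set of neighbours of a vertex $x$, at cost $1$. The number of queries is the total cost. **Theorem.** (a) There are constants $C$ and $j$ such that for every $\varepsilon\in(0,1)$ there is an algorithm in the advanced model which, on every input graph, with probability $>0.99$ outputs a number $\hat n$ with $|\hat n-n|\le\varepsilon n$ while making at most $C\,\varepsilon^{-2}\sqrt{n/d}\,(\log n)^{j}$ queries; that is, $n$ is $(1\pm\varepsilon)$-approximated in $\widetilde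 O(\varepsilon^{-2}\sqrt{n/d})$ queries. (b) For every constant $c\ge1$ there is $\kappa>0$ such that the following holds for every algorithm in the full adjacency model which, on every input graph, with probability $>2/3$ outputs a number $\hat n$ with $n/c\le\hat n\le cn$. For all integers $n\ge2$ and $m$ with $n/2\le m\le\binom n2$, there is an input graph with exactly $n$ vertices and $m$ edges on which the algorithm makes at least $\kappa\sqrt{n/d}$ queries with probability at least $1/4$, where $d=2m/n$. That is, any constant-factor approximation of $n$ requires $\Omega(\sqrt{n/d})$ queries, for every density. -/

import Mathlib

open scoped ENNReal

/-- An input graph: a finite non-empty simple undirected graph without isolated vertices. Vertices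
are identified with their ids, which are arbitrary distinct natural numbers; as the vertex set is an
arbitrary finite subset of `ℕ`, an id carries no information on the number of vertices. -/
structure InputGraph where
  /-- the vertex set -/
  V : Finset ℕ
  /-- the adjacency relation -/
  graph : SimpleGraph ℕ
  nonempty : V.Nonempty
  mem_of_adj : ∀ x y, graph.Adj x y → x ∈ V
  no_isolated : ∀ x ∈ V, ∃ y, graph.Adj x y

namespace InputGraph

variable (G : InputGraph)

open Classical in
/-- The set of neighbours of `x`. -/
noncomputable def nbrs (x : ℕ) : Finset ℕ := {y ∈ G.V | G.graph.Adj x y}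

theorem nbrs_nonempty {x : ℕ} (hx : x ∈ G.V) : (G.nbrs x).Nonempty := by
  obtain ⟨y, hy⟩ := G.no_isolated x hx
  refine ⟨y, ?_⟩
  simp only [nbrs, Finset.mem_filter]
  exact ⟨G.mem_of_adj y x hy.symm, hy⟩

open Classical in
/-- The set of edges with both endpoints in `S`. -/
noncomputable def edgesIn (S : Finset ℕ) : Finset (Sym2 ℕ) := {e ∈ S.sym2 | e ∈ G.graph.edgeSet}

/-- The number of vertices. -/
def n : ℕ := G.V.card

/-- The number of edges. -/
noncomputable def m : ℕ := (G.edgesIn G.V).card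

/-- The average degree `2m/n`. -/
noncomputable def avgDeg : ℝ := 2 * G.m / G.n

end InputGraph

/-- The oracle queries. -/
inductive Query where
  /-- a uniformly random vertex -/
  | randVert
  /-- a uniformly random neighbour of `x` -/
  | randNbr (x : ℕ)
  /-- the degree of `x` -/
  | degree (x : ℕ)
  /-- whether `x` and `y` are adjacent -/
  | pair (x y : ℕ)
  /-- the number of edges with both endpoints in `S` -/
  | additive (S : Finset ℕ)
  /-- the full adjacency list of `x` -/
  | fullNbrHood (x : ℕ)

/-- An additive query on `S` costs `|S|`; every other query has unit cost. -/
def Query.cost : Query → ℕ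
  | .additive S => S.card
  | _ => 1

/-- The queries of the advanced model: everything except the full adjacency list. -/
def Query.IsAdvanced : Query → Prop
  | .fullNbrHood _ => False
  | _ => True

/-- The possible replies of the oracle. -/
inductive Reply where
  | vertex (x : ℕ)
  | number (k : ℕ)
  | adjacent (b : Bool)
  | vertices (S : Finset ℕ)
  /-- the reply to a query that mentions something that is not a vertex -/
  | invalid

open Classical in
/-- The (random) reply of the oracle for `G`; different replies are independent. -/
noncomputable def InputGraph.reply (G : InputGraph) : Query → PMF Reply
  | .randVert => (PMF.uniformOfFinset G.V G.nonempty).map Reply.vertex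
  | .randNbr x =>
      if hx : x ∈ G.V then (PMF.uniformOfFinset (G.nbrs x) (G.nbrs_nonempty hx)).map Reply.vertex
      else PMF.pure .invalid
  | .degree x => PMF.pure (if x ∈ G.V then .number (G.nbrs x).card else .invalid)
  | .pair x y =>
      PMF.pure (if x ∈ G.V ∧ y ∈ G.V then .adjacent (decide (G.graph.Adj x y)) else .invalid)
  | .additive S => PMF.pure (if S ⊆ G.V then .number (G.edgesIn S).card else .invalid)
  | .fullNbrHood x => PMF.pure (if x ∈ G.V then .vertices (G.nbrs x) else .invalid)

/-- A randomized adaptive query algorithm that knows nothing about the input graph, in particular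
not the number of its vertices. In each step it tosses coins, depending on its internal state (its
memory), and either halts with a real number as output or asks a query; in the latter case the reply
determines the next state. It need not halt. -/
structure Algorithm where
  State : Type
  start : State
  step : State → PMF (ℝ ⊕ (Query × (Reply → State)))

namespace Algorithm

/-- The algorithm runs in the advanced model, that is, it never asks for a full adjacency list.
Without this restriction it runs in the full adjacency model. -/
def IsAdvanced (A : Algorithm) : Prop :=
  ∀ s q f, Sum.inr (q, f) ∈ (A.step s).support → q.IsAdvanced

/-- A configuration of a run: the current state, or the output if the algorithm has halted, and the
total cost of the queries made so far. -/
abbrev Config (A : Algorithm) : Type := (A.State ⊕ ℝ) × ℕ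

/-- One step of a run on `G`. -/
noncomputable def next (A : Algorithm) (G : InputGraph) : A.Config → PMF A.Config
  | (.inr v, k) => PMF.pure (.inr v, k)
  | (.inl s, k) => (A.step s).bind fun a =>
      match a with
      | .inl v => PMF.pure (.inr v, k)
      | .inr (q, f) => (G.reply q).map fun r => (.inl (f r), k + q.cost)

/-- The distribution of the configuration after `t` steps of the run on `G`. -/
noncomputable def config (A : Algorithm) (G : InputGraph) : ℕ → PMF A.Config
  | 0 => PMF.pure (.inl A.start, 0)
  | t + 1 => (config A G t).bind (A.next G)

/-- The probability that the algorithm, run on `G`, halts with an output `v` and a total query cost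
`k` that satisfy `P v k` (as `t` grows, the probability to have done so within `t` steps increases
to it). -/
noncomputable def probHalt (A : Algorithm) (G : InputGraph) (P : ℝ → ℕ → Prop) : ℝ≥0∞ :=
  ⨆ t, (A.config G t).toOuterMeasure {c | ∃ v k, c = (Sum.inr v, k) ∧ P v k}

/-- The probability that the total cost of the queries that the algorithm makes on `G` is at least
`q`, whether or not it halts. -/
noncomputable def probCostGe (A : Algorithm) (G : InputGraph) (q : ℝ) : ℝ≥0∞ :=
  ⨆ t, (A.config G t).toOuterMeasure {c | q ≤ (c.2 : ℝ)}

end Algorithm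

/-! Upper bound. Write `S = √(2m)`, so that `√(n/d) = n/S`. For a guess `k` of `n/S`, draw `k`
samples, each a random vertex with a random neighbour, and let `w` be a vertex of largest degree `Δ`
seen. There are two ways to estimate `n`. The number of fresh random vertices adjacent to `w` has
mean proportional to `Δ/n`, which suffices once `kΔ ≥ 2n`. Otherwise let `a` be the number of
ordered adjacent pairs of vertices of degree at most `Δ`, divided by `n`. Weighting a sampled light
pair by the degree of its first vertex gives a variable of mean `a`, and the number of light
adjacent pairs between two lists of `k` random vertices, found by additive queries, has mean
`k²a/n`; the ratio reveals `n`. The cap `Δ` controls the variances. A statistic is used only if it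
exceeds a threshold, so by Chebyshev a `k` that is too small yields no answer rather than a wrong
one (`expect_wrong_stage_le`). If `k` is a large multiple of `n/S`, then with high probability `Δ ≥
S` or half of the edges are light (`prob_not_adequate_le`), and in either case an answer is likely
(`expect_missing_stage_le`). Hence `k` can be doubled until an answer appears. The number of
repetitions grows with the level so that the error probabilities are summable, and the costs form a
geometric series up to logarithms; `searchAlgorithm.one_le_successProb` collects all the failures.

Lower bound. Hide a core of about `S` vertices, which carries the excess edges, among isolated edges
with random labels from a huge range. A random vertex lies in the core with probability about `S/n`,
and guessed labels are almost never vertices. With fewer than a small multiple of `n/S` queries one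
therefore sees only fresh random isolated edges, whatever the number of vertices. `avgOn_value_le`
makes this precise by comparing the core with a single edge hidden among so many pairs that the
graph has more than `c² n` vertices: no output is a good approximation for both families. -/

/-! ### Expectations of extended nonnegative functions -/

namespace PMF

variable {α β : Type*}

/-- The expectation of an extended nonnegative function. -/
noncomputable def expect (p : PMF α) (f : α → ℝ≥0∞) : ℝ≥0∞ := ∑' a, p a * f a

theorem expect_pure (a : α) (f : α → ℝ≥0∞) : (PMF.pure a).expect f = f a := by
  rw [expect, tsum_eq_single a]
  · simp
  · intro b hb
    simp [PMF.pure_apply_of_ne _ _ hb]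

theorem expect_bind (p : PMF α) (q : α → PMF β) (f : β → ℝ≥0∞) :
    (p.bind q).expect f = p.expect fun a => (q a).expect f := by
  simp only [expect, PMF.bind_apply, ← ENNReal.tsum_mul_left, ← ENNReal.tsum_mul_right]
  rw [ENNReal.tsum_comm]
  simp only [mul_assoc]

theorem expect_map (p : PMF α) (g : α → β) (f : β → ℝ≥0∞) :
    (p.map g).expect f = p.expect fun a => f (g a) := by
  rw [← PMF.bind_pure_comp, expect_bind]
  simp [expect_pure]

theorem expect_mono_support {p : PMF α} {f g : α → ℝ≥0∞} (h : ∀ a ∈ p.support, f a ≤ g a) :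
    p.expect f ≤ p.expect g := by
  refine ENNReal.tsum_le_tsum fun a => ?_
  by_cases ha : a ∈ p.support
  · gcongr
    exact h a ha
  · simp [(PMF.apply_eq_zero_iff p a).2 ha]

theorem expect_mono {p : PMF α} {f g : α → ℝ≥0∞} (h : ∀ a, f a ≤ g a) : p.expect f ≤ p.expect g :=
  expect_mono_support fun a _ => h a

theorem expect_congr_support {p : PMF α} {f g : α → ℝ≥0∞} (h : ∀ a ∈ p.support, f a = g a) :
    p.expect f = p.expect g :=
  le_antisymm (expect_mono_support fun a ha => (h a ha).le)
    (expect_mono_support fun a ha => (h a ha).ge)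

theorem expect_add (p : PMF α) (f g : α → ℝ≥0∞) :
    (p.expect fun a => f a + g a) = p.expect f + p.expect g := by
  simp only [expect, mul_add, ENNReal.tsum_add]

theorem expect_mul_left (p : PMF α) (c : ℝ≥0∞) (f : α → ℝ≥0∞) :
    (p.expect fun a => c * f a) = c * p.expect f := by
  simp only [expect, ← ENNReal.tsum_mul_left]
  exact tsum_congr fun a => mul_left_comm _ _ _

theorem expect_mul_right (p : PMF α) (c : ℝ≥0∞) (f : α → ℝ≥0∞) :
    (p.expect fun a => f a * c) = p.expect f * c := by
  simp only [mul_comm _ c, expect_mul_left]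

theorem expect_const (p : PMF α) (c : ℝ≥0∞) : (p.expect fun _ => c) = c := by
  rw [expect, ENNReal.tsum_mul_right, p.tsum_coe, one_mul]

theorem expect_sum {ι : Type*} (p : PMF α) (s : Finset ι) (f : ι → α → ℝ≥0∞) :
    (p.expect fun a => ∑ i ∈ s, f i a) = ∑ i ∈ s, p.expect (f i) := by
  classical
  induction s using Finset.induction_on with
  | empty => simp [expect_const]
  | insert i s hi ih => simp only [Finset.sum_insert hi, expect_add, ih]

theorem expect_le_of_le {p : PMF α} {f : α → ℝ≥0∞} {c : ℝ≥0∞} (h : ∀ a, f a ≤ c) :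
    p.expect f ≤ c :=
  (expect_mono h).trans_eq (expect_const p c)

theorem expect_comm (p : PMF α) (q : PMF β) (f : α → β → ℝ≥0∞) :
    (p.expect fun a => q.expect fun b => f a b) = q.expect fun b => p.expect fun a => f a b := by
  simp only [expect, ← ENNReal.tsum_mul_left]
  rw [ENNReal.tsum_comm]
  exact tsum_congr fun b => tsum_congr fun a => mul_left_comm _ _ _

/-- Monotone convergence, with the sum read as an integral against the counting measure. -/
theorem expect_iSup (p : PMF α) {f : ℕ → α → ℝ≥0∞} (hf : Monotone f) :
    (p.expect fun a => ⨆ t, f t a) = ⨆ t, p.expect (f t) := by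
  let _ : MeasurableSpace α := ⊤
  simp only [expect, ENNReal.mul_iSup]
  simp only [← MeasureTheory.lintegral_count]
  rw [MeasureTheory.lintegral_iSup (fun _ => measurable_from_top)]
  intro s t hst a
  exact mul_le_mul_right (hf hst a) _

theorem expect_uniformOfFinset (s : Finset α) (hs : s.Nonempty) (f : α → ℝ≥0∞) :
    (PMF.uniformOfFinset s hs).expect f = (s.card : ℝ≥0∞)⁻¹ * ∑ a ∈ s, f a := by
  rw [expect, tsum_eq_sum (s := s), Finset.mul_sum]
  · exact Finset.sum_congr rfl fun a ha => by rw [PMF.uniformOfFinset_apply_of_mem hs ha]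
  · intro a ha
    simp [PMF.uniformOfFinset_apply_of_notMem hs ha]

open Classical in
theorem toOuterMeasure_eq_expect (p : PMF α) (E : Set α) :
    p.toOuterMeasure E = p.expect fun a => if a ∈ E then 1 else 0 := by
  rw [PMF.toOuterMeasure_apply, expect]
  exact tsum_congr fun a => by simp [Set.indicator_apply]

end PMF

/-! ### Runs evaluated backwards in time -/

namespace Algorithm

variable (A : Algorithm) (G : InputGraph)

/-- The expectation of `φ` after `t` steps of the run that starts in the given configuration. -/
noncomputable def value (φ : A.Config → ℝ≥0∞) : ℕ → A.Config → ℝ≥0∞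
  | 0 => φ
  | t + 1 => fun c => (A.next G c).expect (value φ t)

/-- `config` adds steps at the end of a run and `value` at its beginning; both iterate the same
kernel. The extra `s` makes the induction work. -/
theorem expect_config_value (φ : A.Config → ℝ≥0∞) (t s : ℕ) :
    (A.config G t).expect (A.value G φ s) = A.value G φ (s + t) (.inl A.start, 0) := by
  induction t generalizing s with
  | zero => simp [config, PMF.expect_pure]
  | succ t ih =>
    have h := ih (s + 1)
    rw [config, PMF.expect_bind, show s + (t + 1) = s + 1 + t by ring, ← h]
    rfl

theorem expect_config (φ : A.Config → ℝ≥0∞) (t : ℕ) :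
    (A.config G t).expect φ = A.value G φ t (.inl A.start, 0) :=
  A.expect_config_value G φ t 0 |>.trans (by rw [Nat.zero_add])

theorem value_inr (φ : A.Config → ℝ≥0∞) (t : ℕ) (v : ℝ) (k : ℕ) :
    A.value G φ t (.inr v, k) = φ (.inr v, k) := by
  induction t with
  | zero => rfl
  | succ t ih => simp [value, next, PMF.expect_pure, ih]

theorem value_succ_inl (φ : A.Config → ℝ≥0∞) (t : ℕ) (s : A.State) (k : ℕ) :
    A.value G φ (t + 1) (.inl s, k) = (A.step s).expect fun a =>
      match a with
      | .inl v => A.value G φ t (.inr v, k)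
      | .inr (q, f) => (G.reply q).expect fun r => A.value G φ t (.inl (f r), k + q.cost) := by
  change (A.next G (.inl s, k)).expect (A.value G φ t) = _
  rw [next.eq_def, PMF.expect_bind]
  congr 1
  funext a
  rcases a with v | ⟨q, f⟩
  · simp [PMF.expect_pure]
  · simp [PMF.expect_map]

theorem value_mono {φ ψ : A.Config → ℝ≥0∞} (h : ∀ c, φ c ≤ ψ c) (t : ℕ) (c : A.Config) :
    A.value G φ t c ≤ A.value G ψ t c := by
  induction t generalizing c with
  | zero => exact h c
  | succ t ih => exact PMF.expect_mono ih

/-- If `φ` can only grow along a run in expectation, then so does its value. -/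
theorem value_monotone {φ : A.Config → ℝ≥0∞} (h : ∀ c, φ c ≤ (A.next G c).expect φ) :
    Monotone (A.value G φ) := by
  refine monotone_nat_of_le_succ fun t => ?_
  induction t with
  | zero => exact h
  | succ t ih => exact fun c => PMF.expect_mono fun c' => ih c'

open Classical in
/-- The indicator function of the event that the algorithm has halted with `P`. -/
noncomputable def haltedInd (P : ℝ → ℕ → Prop) : A.Config → ℝ≥0∞
  | (.inl _, _) => 0
  | (.inr v, k) => if P v k then 1 else 0

theorem haltedInd_le_expect (P : ℝ → ℕ → Prop) (c : A.Config) :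
    A.haltedInd P c ≤ (A.next G c).expect (A.haltedInd P) := by
  rcases c with ⟨s | v, k⟩
  · simp [haltedInd]
  · simp [next, PMF.expect_pure]

theorem toOuterMeasure_config_halted (P : ℝ → ℕ → Prop) (t : ℕ) :
    (A.config G t).toOuterMeasure {c | ∃ v k, c = (Sum.inr v, k) ∧ P v k} =
      A.value G (A.haltedInd P) t (.inl A.start, 0) := by
  rw [PMF.toOuterMeasure_eq_expect, ← expect_config]
  congr 1
  funext c
  rcases c with ⟨s | v, k⟩
  · simp [haltedInd]
  · have : (∃ v' k', ((Sum.inr v, k) : A.Config) = (Sum.inr v', k') ∧ P v' k') ↔ P v k := by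
      constructor
      · rintro ⟨v', k', h, hP⟩
        cases h
        exact hP
      · exact fun h => ⟨v, k, rfl, h⟩
    by_cases h : P v k
    · refine (if_pos (this.2 h)).trans ?_
      simp [haltedInd, h]
    · refine (if_neg fun h' => h (this.1 h')).trans ?_
      simp [haltedInd, h]

theorem probHalt_eq (P : ℝ → ℕ → Prop) :
    A.probHalt G P = ⨆ t, A.value G (A.haltedInd P) t (.inl A.start, 0) := by
  simp only [probHalt, toOuterMeasure_config_halted]

end Algorithm

/-! ### Query programs and doubling search -/

/-- A deterministic query program that halts with a value in `α`. -/
inductive Prog (α : Type) where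
  | ret (a : α)
  | query (q : Query) (f : Reply → Prog α)

namespace Prog

variable {α β : Type} (G : InputGraph)

/-- Sequential composition. -/
def bind : Prog α → (α → Prog β) → Prog β
  | ret a, g => g a
  | query q f, g => query q fun r => (f r).bind g

/-- Every query of the program satisfies `P`. -/
def AllQueries (P : Query → Prop) : Prog α → Prop
  | ret _ => True
  | query q f => P q ∧ ∀ r, (f r).AllQueries P

theorem AllQueries.bind {P : Query → Prop} {p : Prog α} {g : α → Prog β} (hp : p.AllQueries P)
    (hg : ∀ a, (g a).AllQueries P) : (p.bind g).AllQueries P := by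
  induction p with
  | ret a => exact hg a
  | query q f ih => exact ⟨hp.1, fun r => ih r (hp.2 r)⟩

/-- The joint distribution of the result and the total cost. -/
noncomputable def run : Prog α → PMF (α × ℕ)
  | ret a => PMF.pure (a, 0)
  | query q f => (G.reply q).bind fun r => ((f r).run).map fun x => (x.1, x.2 + q.cost)

/-- The distribution of the result. -/
noncomputable def law (p : Prog α) : PMF α := (p.run G).map Prod.fst

/-- The expected total cost. -/
noncomputable def meanCost (p : Prog α) : ℝ≥0∞ := (p.run G).expect fun x => x.2

theorem run_bind (p : Prog α) (g : α → Prog β) :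
    (p.bind g).run G = (p.run G).bind fun x => ((g x.1).run G).map fun y => (y.1, y.2 + x.2) := by
  induction p with
  | ret a =>
    simp only [bind, run, PMF.pure_bind, add_zero, Prod.mk.eta]
    exact (PMF.map_id _).symm
  | query q f ih =>
    simp only [bind, run, ih, PMF.bind_bind, PMF.map_bind, PMF.bind_map, PMF.map_comp,
      Function.comp_def, add_assoc]

@[simp]
theorem law_ret (a : α) : (ret a).law G = PMF.pure a := by
  simp [law, run, PMF.pure_map]

@[simp]
theorem meanCost_ret (a : α) : (ret a).meanCost G = 0 := by
  simp [meanCost, run, PMF.expect_pure]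

theorem law_bind (p : Prog α) (g : α → Prog β) :
    (p.bind g).law G = (p.law G).bind fun a => (g a).law G := by
  simp only [law, run_bind, PMF.map_bind, PMF.map_comp, PMF.bind_map, Function.comp_def]

theorem meanCost_bind (p : Prog α) (g : α → Prog β) :
    (p.bind g).meanCost G = p.meanCost G + (p.law G).expect fun a => (g a).meanCost G := by
  simp only [meanCost, law, run_bind, PMF.expect_bind, PMF.expect_map, Nat.cast_add,
    PMF.expect_add, PMF.expect_const]
  exact add_comm _ _

theorem law_query (q : Query) (f : Reply → Prog α) :
    (query q f).law G = (G.reply q).bind fun r => (f r).law G := by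
  simp only [law, run, PMF.map_bind, PMF.map_comp, Function.comp_def]

theorem meanCost_query (q : Query) (f : Reply → Prog α) :
    (query q f).meanCost G = q.cost + (G.reply q).expect fun r => (f r).meanCost G := by
  simp only [meanCost, run, PMF.expect_bind, PMF.expect_map, Nat.cast_add,
    PMF.expect_add, PMF.expect_const]
  exact add_comm _ _

theorem expect_run_fst (p : Prog α) (f : α → ℝ≥0∞) :
    ((p.run G).expect fun x => f x.1) = (p.law G).expect f := by
  rw [law, PMF.expect_map]

/-- Run a program `N` times. -/
def replicate (p : Prog α) : ℕ → Prog (List α)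
  | 0 => ret []
  | N + 1 => p.bind fun a => (p.replicate N).bind fun l => ret (a :: l)

/-- Run the programs of a list and add up their results. -/
def sum : List (Prog ℕ) → Prog ℕ
  | [] => ret 0
  | p :: l => p.bind fun a => (sum l).bind fun b => ret (a + b)

theorem AllQueries.replicate {P : Query → Prop} {p : Prog α} (hp : p.AllQueries P) (N : ℕ) :
    (p.replicate N).AllQueries P := by
  induction N with
  | zero => trivial
  | succ N ih => exact hp.bind fun _ => ih.bind fun _ => trivial

theorem AllQueries.sum {P : Query → Prop} {l : List (Prog ℕ)} (hl : ∀ p ∈ l, p.AllQueries P) :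
    (Prog.sum l).AllQueries P := by
  induction l with
  | nil => trivial
  | cons p l ih =>
    exact (hl p (by simp)).bind fun _ =>
      (ih fun p' hp' => hl p' (by simp [hp'])).bind fun _ => trivial

/-- On `G` the program returns `a` at cost `c`. -/
def Returns (p : Prog α) (a : α) (c : ℕ) : Prop := p.run G = PMF.pure (a, c)

variable {G}

theorem Returns.law {p : Prog α} {a : α} {c : ℕ} (h : p.Returns G a c) :
    p.law G = PMF.pure a := by
  rw [Prog.law, show p.run G = _ from h, PMF.pure_map]

theorem Returns.meanCost {p : Prog α} {a : α} {c : ℕ} (h : p.Returns G a c) :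
    p.meanCost G = c := by
  rw [Prog.meanCost, show p.run G = _ from h, PMF.expect_pure]

theorem Returns.bind {p : Prog α} {g : α → Prog β} {a : α} {b : β} {c d : ℕ}
    (h : p.Returns G a c) (h' : (g a).Returns G b d) : (p.bind g).Returns G b (c + d) := by
  rw [Returns, run_bind, show p.run G = _ from h, PMF.pure_bind, show (g a).run G = _ from h',
    PMF.pure_map, add_comm]

theorem Returns.ret (a : α) : (ret a).Returns G a 0 := rfl

theorem Returns.query {q : Query} {f : Reply → Prog α} {r : Reply} {a : α} {c : ℕ}
    (h : G.reply q = PMF.pure r) (h' : (f r).Returns G a c) :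
    (query q f).Returns G a (q.cost + c) := by
  rw [Returns, run, h, PMF.pure_bind, show (f r).run G = _ from h', PMF.pure_map, add_comm]

theorem Returns.sum_map {ι : Type} {l : List ι} {p : ι → Prog ℕ} {val cost : ι → ℕ}
    (h : ∀ i ∈ l, (p i).Returns G (val i) (cost i)) :
    (Prog.sum (l.map p)).Returns G (l.map val).sum (l.map cost).sum := by
  induction l with
  | nil => exact Returns.ret 0
  | cons i l ih =>
    have := (h i (by simp)).bind (g := fun a => (Prog.sum (l.map p)).bind fun b => .ret (a + b))
      ((ih fun p' hp' => h p' (by simp [hp'])).bind (Returns.ret _))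
    simpa [Prog.sum] using this

variable (G)

theorem meanCost_replicate (p : Prog α) (N : ℕ) :
    (p.replicate N).meanCost G = N * p.meanCost G := by
  induction N with
  | zero => simp [replicate]
  | succ N ih =>
    simp only [replicate, meanCost_bind, ih, meanCost_ret, PMF.expect_const, Nat.cast_succ]
    ring

end Prog

/-! ### Eventual halting and the search algorithm -/

namespace Algorithm

variable (A : Algorithm) (G : InputGraph)

/-- The probability to halt with `P` eventually when the run starts in the given configuration. -/
noncomputable def eventually (P : ℝ → ℕ → Prop) (c : A.Config) : ℝ≥0∞ :=
  ⨆ t, A.value G (A.haltedInd P) t c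

open Classical in
theorem eventually_inr (P : ℝ → ℕ → Prop) (v : ℝ) (k : ℕ) :
    A.eventually G P (.inr v, k) = if P v k then 1 else 0 := by
  simp [eventually, value_inr, haltedInd]

/-- The supremum over `t` does not change under a shift of time, and monotone convergence moves it
inside both expectations. -/
theorem eventually_inl (P : ℝ → ℕ → Prop) (s : A.State) (k : ℕ) :
    A.eventually G P (.inl s, k) = (A.step s).expect fun a =>
      match a with
      | .inl v => A.eventually G P (.inr v, k)
      | .inr (q, f) => (G.reply q).expect fun r => A.eventually G P (.inl (f r), k + q.cost) := by
  have hm := A.value_monotone G (A.haltedInd_le_expect G P)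
  have h1 : A.eventually G P (.inl s, k) =
      ⨆ t, A.value G (A.haltedInd P) (t + 1) (.inl s, k) :=
    (Monotone.iSup_nat_add (fun _ _ h => hm h _) 1).symm
  rw [h1]
  simp only [value_succ_inl]
  rw [← PMF.expect_iSup]
  · congr 1
    funext a
    rcases a with v | ⟨q, f⟩
    · rfl
    · simp only [eventually]
      rw [PMF.expect_iSup]
      exact fun _ _ h _ => hm h _
  · intro t t' h a
    rcases a with v | ⟨q, f⟩
    · exact hm h _
    · exact PMF.expect_mono fun r => hm h _

end Algorithm

/-- The algorithm that runs the given programs one after the other until one of them returns a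
number. A dummy query separates consecutive programs. -/
noncomputable def searchAlgorithm (lev : ℕ → {p : Prog (Option ℝ) // p.AllQueries Query.IsAdvanced}) :
    Algorithm where
  State := ℕ × {p : Prog (Option ℝ) // p.AllQueries Query.IsAdvanced}
  start := (0, lev 0)
  step
    | (_, ⟨.ret (some v), _⟩) => PMF.pure (.inl v)
    | (i, ⟨.ret none, _⟩) => PMF.pure (.inr (.randVert, fun _ => (i + 1, lev (i + 1))))
    | (i, ⟨.query q f, h⟩) => PMF.pure (.inr (q, fun r => (i, ⟨f r, h.2 r⟩)))

namespace searchAlgorithm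

variable (lev : ℕ → {p : Prog (Option ℝ) // p.AllQueries Query.IsAdvanced}) (G : InputGraph)

theorem isAdvanced : (searchAlgorithm lev).IsAdvanced := by
  rintro ⟨i, ⟨(_ | v) | ⟨q, f⟩, h⟩⟩ q' f' hq
  · have hq := (PMF.mem_support_pure_iff _ _).1 hq
    cases hq
    trivial
  · have hq := (PMF.mem_support_pure_iff _ _).1 hq
    cases hq
  · have hq := (PMF.mem_support_pure_iff _ _).1 hq
    cases hq
    exact h.1

/-- The probability that the search succeeds once the program `p` is run as the `i`-th one, at
total cost `k` so far. -/
noncomputable def successProb (P : ℝ → ℕ → Prop) (i k : ℕ)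
    (p : {p : Prog (Option ℝ) // p.AllQueries Query.IsAdvanced}) : ℝ≥0∞ :=
  (searchAlgorithm lev).eventually G P
    (.inl (show (searchAlgorithm lev).State from (i, p)), k)

theorem probHalt_eq (P : ℝ → ℕ → Prop) :
    (searchAlgorithm lev).probHalt G P = successProb lev G P 0 0 (lev 0) :=
  Algorithm.probHalt_eq _ _ _

-- The search tosses no coins of its own, so unfolding it query by query with `eventually_inl`
-- reproduces the joint law of result and cost. The extra `1` after `none` pays for the dummy query
-- that separates two programs.
open Classical in
theorem successProb_eq (P : ℝ → ℕ → Prop) (i k : ℕ)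
    (p : Prog (Option ℝ)) (h : p.AllQueries Query.IsAdvanced) :
    successProb lev G P i k ⟨p, h⟩ =
      (p.run G).expect fun x =>
        match x.1 with
        | some v => if P v (k + x.2) then 1 else 0
        | none => successProb lev G P (i + 1) (k + x.2 + 1) (lev (i + 1)) := by
  induction p generalizing k with
  | ret a =>
    refine (Algorithm.eventually_inl _ _ _ _ _).trans ?_
    rcases a with _ | v
    · rw [Prog.run, PMF.expect_pure]
      exact (PMF.expect_pure _ _).trans (PMF.expect_const _ _)
    · rw [Prog.run, PMF.expect_pure]
      exact (PMF.expect_pure _ _).trans (Algorithm.eventually_inr _ _ _ _ _)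
  | query q f ih =>
    refine (Algorithm.eventually_inl _ _ _ _ _).trans ((PMF.expect_pure _ _).trans ?_)
    rw [Prog.run, PMF.expect_bind]
    simp only [PMF.expect_map]
    congr 1
    funext r
    refine (ih r _ (h.2 r)).trans ?_
    congr 1
    funext x
    rcases x with ⟨_ | v, c⟩ <;> simp only [add_assoc, add_comm c]

open Classical in
/-- The indicator function of a wrong answer. -/
noncomputable def wrong (good : ℝ → Prop) : Option ℝ → ℝ≥0∞
  | some v => if good v then 0 else 1
  | none => 0

/-- The indicator function of a missing answer. -/
noncomputable def missing : Option ℝ → ℝ≥0∞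
  | some _ => 0
  | none => 1

/-- If the first `N + 1` programs rarely return a bad number, are cheap in expectation, and the last
of them rarely returns none, then the search succeeds within the budget `B`. -/
theorem one_le_successProb (good : ℝ → Prop) (B : ℝ≥0∞) (hB : B ≠ 0) (hB' : B ≠ ⊤)
    (N i k : ℕ) :
    1 ≤ successProb lev G (fun v c => good v ∧ (c : ℝ≥0∞) ≤ B) i k (lev i) + k / B +
      ∑ j ∈ Finset.range (N + 1), (((lev (i + j)).1.law G).expect (wrong good) +
        ((lev (i + j)).1.meanCost G + 1) / B) +
      ((lev (i + N)).1.law G).expect missing := by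
  classical
  obtain ⟨P, hP⟩ : ∃ P : ℝ → ℕ → Prop, P = fun v (c : ℕ) => good v ∧ (c : ℝ≥0∞) ≤ B := ⟨_, rfl⟩
  rw [← hP]
  -- Markov's inequality before taking expectations: an excessive cost is paid for by `c / B`.
  have markov : ∀ c : ℕ, (1 : ℝ≥0∞) ≤ (if (c : ℝ≥0∞) ≤ B then 1 else 0) + c / B := by
    intro c
    split_ifs with h
    · exact le_self_add
    · rw [zero_add, ENNReal.le_div_iff_mul_le (.inl hB) (.inl hB'), one_mul]
      exact (not_le.1 h).le
  have key : ∀ (c : ℕ) (v : ℝ), (1 : ℝ≥0∞) ≤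
      (if P v c then 1 else 0) + (if good v then 0 else 1) + c / B := by
    intro c v
    by_cases hv : good v
    · simpa [hP, hv] using markov c
    · simp only [hP, hv, false_and, if_false, zero_add]
      exact le_self_add
  -- The effect of one program. An answer is charged to its error or to the cost so far; `none` is
  -- passed on through `h`. Later `z` is `missing` for the last program and a constant for the
  -- others, so that `none` is charged only at the end.
  have step (R : ℝ≥0∞) (z : Option ℝ → ℝ≥0∞) (i k : ℕ) (W : Option ℝ × ℕ → ℝ≥0∞)
      (h : ∀ c, 1 ≤ W (none, c) + ((k + c + 1 : ℕ) : ℝ≥0∞) / B + R + z none)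
      (hW : ∀ v c, W (some v, c) = if P v (k + c) then 1 else 0) :
      1 ≤ ((lev i).1.run G).expect W + k / B + (((lev i).1.law G).expect (wrong good) +
        ((lev i).1.meanCost G + 1) / B) + R + ((lev i).1.law G).expect z := by
    calc (1 : ℝ≥0∞) = ((lev i).1.run G).expect fun _ => 1 := (PMF.expect_const _ _).symm
      _ ≤ ((lev i).1.run G).expect fun x =>
          W x + k / B + (wrong good x.1 + (x.2 * B⁻¹ + 1 / B)) + R + z x.1 := by
        refine PMF.expect_mono fun ⟨o, c⟩ => ?_
        rcases o with _ | v
        · refine (h c).trans_eq ?_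
          simp only [Nat.cast_add, ENNReal.add_div, ← div_eq_mul_inv, Nat.cast_one, wrong]
          ring
        · refine (key (k + c) v).trans ?_
          rw [hW]
          simp only [wrong, Nat.cast_add, ENNReal.add_div, ← div_eq_mul_inv]
          calc _ = (if P v (k + c) then (1 : ℝ≥0∞) else 0) + k / B +
                ((if good v then 0 else 1) + c / B) := by ring
            _ ≤ (if P v (k + c) then (1 : ℝ≥0∞) else 0) + k / B +
                ((if good v then 0 else 1) + c / B) + (1 / B + R + z (some v)) := le_self_add
            _ = _ := by ring
      _ = _ := by
        simp only [PMF.expect_add, PMF.expect_const, PMF.expect_mul_right]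
        rw [Prog.expect_run_fst, Prog.expect_run_fst, ← Prog.meanCost, ENNReal.add_div,
          div_eq_mul_inv (Prog.meanCost _ _)]
  induction N generalizing i k with
  | zero =>
    rw [Finset.sum_range_one, add_zero]
    have := step 0 missing i k (fun x => match x.1 with
        | some v => if P v (k + x.2) then 1 else 0
        | none => successProb lev G P (i + 1) (k + x.2 + 1)
            (lev (i + 1)))
      (fun c => le_add_self) (fun v c => rfl)
    rw [← successProb_eq lev G P i k _ (lev i).2] at this
    simpa only [add_zero] using this
  | succ N ih =>
    rw [Finset.sum_range_succ', add_zero]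
    set R : ℝ≥0∞ := ∑ j ∈ Finset.range (N + 1), (((lev (i + (j + 1))).1.law G).expect
        (wrong good) + ((lev (i + (j + 1))).1.meanCost G + 1) / B) with hR
    set Z : ℝ≥0∞ := ((lev (i + (N + 1))).1.law G).expect missing with hZ
    have ih' := fun k => ih (i + 1) k
    simp only [show ∀ j, i + 1 + j = i + (j + 1) by intro j; ring] at ih'
    rw [← hR, ← hZ] at ih'
    have := step R (fun _ => Z) i k (fun x => match x.1 with
        | some v => if P v (k + x.2) then 1 else 0
        | none => successProb lev G P (i + 1) (k + x.2 + 1)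
            (lev (i + 1)))
      (fun (c : ℕ) => ih' (k + c + 1)) (fun v c => rfl)
    rw [← successProb_eq lev G P i k _ (lev i).2,
      PMF.expect_const] at this
    refine this.trans_eq ?_
    ring

end searchAlgorithm

/-! ### Moments of sums of independent samples, and Chebyshev bounds -/

namespace PMF

variable {α β : Type*}

open Classical in
/-- The probability of an event. -/
noncomputable def prob (p : PMF α) (E : α → Prop) : ℝ≥0∞ := p.expect fun a => if E a then 1 else 0

theorem prob_mono_support {p : PMF α} {E F : α → Prop} (h : ∀ a ∈ p.support, E a → F a) :
    p.prob E ≤ p.prob F := by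
  refine expect_mono_support fun a ha => ?_
  by_cases hE : E a
  · simp [hE, h a ha hE]
  · simp [hE]

theorem prob_mono {p : PMF α} {E F : α → Prop} (h : ∀ a, E a → F a) : p.prob E ≤ p.prob F :=
  prob_mono_support fun a _ => h a

theorem prob_le_one (p : PMF α) (E : α → Prop) : p.prob E ≤ 1 :=
  expect_le_of_le fun a => by split_ifs <;> simp

/-- If the values of `f` off an event are at most `c`, and all are at most `1`, then the expectation
is at most the probability of the event plus `c`. -/
theorem expect_le_prob_add {p : PMF α} {f : α → ℝ≥0∞} {E : α → Prop} {c : ℝ≥0∞}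
    (h1 : ∀ a ∈ p.support, f a ≤ 1) (h2 : ∀ a ∈ p.support, ¬ E a → f a ≤ c) :
    p.expect f ≤ p.prob E + c := by
  classical
  rw [prob, ← expect_const p c, ← expect_add]
  refine expect_mono_support fun a ha => ?_
  by_cases hE : E a
  · simpa [hE] using (h1 a ha).trans le_self_add
  · simpa [hE] using h2 a ha hE

/-- **Chebyshev's inequality** -/
theorem prob_le_of_second_moment (p : PMF α) (X : α → ℕ) {μ σ D c : ℝ} (hμ : 0 ≤ μ) (hσ : 0 ≤ σ)
    (h1 : (p.expect fun a => X a) = ENNReal.ofReal μ)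
    (h2 : (p.expect fun a => (X a : ℝ≥0∞) ^ 2) ≤ ENNReal.ofReal (μ ^ 2 + σ)) (hD : 0 < D)
    (hc : σ ≤ c * D) {E : α → Prop} (hE : ∀ a, E a → D ≤ ((X a : ℝ) - μ) ^ 2) :
    p.prob E ≤ ENNReal.ofReal c := by
  classical
  have hX (a : α) : (X a : ℝ≥0∞) = ENNReal.ofReal (X a) := by simp
  -- The expectation of the pointwise inequality `D·1_E + 2μX ≤ X² + μ²`, arranged without
  -- subtraction, which truncates in `ℝ≥0∞`.
  have key : p.prob E * ENNReal.ofReal D + 2 * ENNReal.ofReal μ * ENNReal.ofReal μ ≤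
      ENNReal.ofReal (μ ^ 2 + σ) + ENNReal.ofReal (μ ^ 2) := by
    refine le_trans ?_ (add_le_add_left h2 _)
    rw [prob, ← expect_mul_right, ← h1, ← expect_mul_left, ← expect_add, h1,
      ← expect_const p (ENNReal.ofReal (μ ^ 2)), ← expect_add]
    refine expect_mono fun a => ?_
    have h2' : (2 : ℝ≥0∞) = ENNReal.ofReal 2 := by simp
    rw [hX a, h2', ← ENNReal.ofReal_mul (by norm_num), ← ENNReal.ofReal_mul (by positivity),
      ← ENNReal.ofReal_pow (by positivity), ← ENNReal.ofReal_add (by positivity) (by positivity)]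
    split_ifs with h
    · rw [one_mul, ← ENNReal.ofReal_add hD.le (by positivity)]
      exact ENNReal.ofReal_le_ofReal (by nlinarith [hE a h])
    · rw [zero_mul, zero_add]
      exact ENNReal.ofReal_le_ofReal (by nlinarith [sq_nonneg ((X a : ℝ) - μ)])
  have h2' : (2 : ℝ≥0∞) = ENNReal.ofReal 2 := by simp
  rw [h2', ← ENNReal.ofReal_mul (by norm_num), ← ENNReal.ofReal_mul (by positivity),
    ← ENNReal.ofReal_add (by positivity) (by positivity),
    show μ ^ 2 + σ + μ ^ 2 = σ + 2 * μ * μ by ring,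
    ENNReal.ofReal_add hσ (by positivity)] at key
  have key := (ENNReal.add_le_add_iff_right ENNReal.ofReal_ne_top).1 key
  have hc0 : 0 ≤ c := by
    by_contra! h
    nlinarith
  rw [← ENNReal.le_div_iff_mul_le (by simp [hD]) (by simp)] at key
  refine key.trans ?_
  rw [← ENNReal.ofReal_div_of_pos hD]
  exact ENNReal.ofReal_le_ofReal ((div_le_iff₀ hD).2 hc)

/-- A variable that exceeds the threshold `τ` is likely to be close to its mean. -/
theorem prob_false_accept (p : PMF α) (X : α → ℕ) {μ σ τ η K T : ℝ} (hμ : 0 ≤ μ) (hσ : 0 ≤ σ)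
    (h1 : (p.expect fun a => X a) = ENNReal.ofReal μ)
    (h2 : (p.expect fun a => (X a : ℝ≥0∞) ^ 2) ≤ ENNReal.ofReal (μ ^ 2 + σ)) (hτ : 0 < τ)
    (hη : 0 < η) (hη' : η ≤ 1) (hT : 0 < T) (hσ' : σ ≤ K / T * max τ μ ^ 2) :
    (p.prob fun a => τ ≤ X a ∧ ¬ |(X a : ℝ) - μ| ≤ η * X a) ≤
      ENNReal.ofReal (4 * K / (η ^ 2 * T)) := by
  have hM : 0 < max τ μ := lt_max_of_lt_left hτ
  refine p.prob_le_of_second_moment X hμ hσ h1 h2 (D := η ^ 2 / 4 * max τ μ ^ 2) (by positivity)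
    ?_ ?_
  · refine hσ'.trans_eq ?_
    field_simp
  · rintro a ⟨ha, hb⟩
    rw [← sq_abs ((X a : ℝ) - μ), show η ^ 2 / 4 * max τ μ ^ 2 = (η / 2 * max τ μ) ^ 2 by ring]
    refine pow_le_pow_left₀ (by positivity) ?_ 2
    push Not at hb
    -- If `μ ≤ 2X`, then `τ` and `μ` are both at most `2X`, so an error above `ηX` exceeds `η/2`
    -- times their maximum. If `μ > 2X`, the maximum is `μ` and the error is at least `μ/2`.
    rcases le_or_gt μ (2 * X a) with h | h
    · have : max τ μ ≤ 2 * X a := max_le (by linarith) h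
      nlinarith
    · have h3 : max τ μ ≤ μ := max_le (by linarith) le_rfl
      have h4 : μ / 2 ≤ |(X a : ℝ) - μ| := by
        rw [abs_sub_comm]
        exact le_trans (by linarith) (le_abs_self _)
      nlinarith

/-- A variable whose mean is well above the threshold `τ` is unlikely to be below it. -/
theorem prob_false_reject (p : PMF α) (X : α → ℕ) {μ σ τ K T : ℝ} (hσ : 0 ≤ σ)
    (h1 : (p.expect fun a => X a) = ENNReal.ofReal μ)
    (h2 : (p.expect fun a => (X a : ℝ≥0∞) ^ 2) ≤ ENNReal.ofReal (μ ^ 2 + σ)) (hτ : 2 * τ ≤ μ)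
    (hμ : 0 < μ) (hσ' : σ ≤ K / T * μ ^ 2) :
    (p.prob fun a => (X a : ℝ) < τ) ≤ ENNReal.ofReal (4 * K / T) := by
  refine p.prob_le_of_second_moment X hμ.le hσ h1 h2 (D := μ ^ 2 / 4) (by positivity) ?_ ?_
  · refine hσ'.trans_eq ?_
    ring
  · intro a ha
    nlinarith

end PMF

/-! ### Moments of repeated independent runs of a program -/

namespace Prog

variable {α β : Type} (G : InputGraph)

theorem expect_replicate_zero (p : Prog α) (F : List α → ℝ≥0∞) :
    ((p.replicate 0).law G).expect F = F [] := by
  rw [replicate, law_ret, PMF.expect_pure]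

theorem expect_replicate_succ (p : Prog α) (N : ℕ) (F : List α → ℝ≥0∞) :
    ((p.replicate (N + 1)).law G).expect F =
      (p.law G).expect fun a => ((p.replicate N).law G).expect fun l => F (a :: l) := by
  simp only [replicate, law_bind, law_ret, PMF.expect_bind, PMF.expect_pure]

theorem forall_mem_of_mem_support_replicate (p : Prog α) (P : α → Prop)
    (h : ∀ a ∈ (p.law G).support, P a) (N : ℕ) :
    ∀ l ∈ ((p.replicate N).law G).support, l.length = N ∧ ∀ a ∈ l, P a := by
  induction N with
  | zero => simp [replicate]
  | succ N ih =>
    intro l hl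
    simp only [replicate, law_bind, law_ret, PMF.mem_support_bind_iff, PMF.mem_support_pure_iff]
      at hl
    obtain ⟨a, ha, l', hl', rfl⟩ := hl
    obtain ⟨h1, h2⟩ := ih l' hl'
    refine ⟨by simp [h1], ?_⟩
    simp only [List.mem_cons, forall_eq_or_imp]
    exact ⟨h a ha, h2⟩

theorem expect_sum_replicate (p : Prog α) (N : ℕ) (f : α → ℝ≥0∞) :
    (((p.replicate N).law G).expect fun l => (l.map f).sum) = N * (p.law G).expect f := by
  induction N with
  | zero => simp [expect_replicate_zero]
  | succ N ih =>
    simp only [expect_replicate_succ, List.map_cons, List.sum_cons, PMF.expect_add,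
      PMF.expect_const, ih, Nat.cast_succ]
    ring

/-- The variance of one sample is bounded by its second moment. Dropping the squared mean avoids
subtraction and costs only a constant later. -/
theorem expect_sum_sq_replicate_le (p : Prog α) (N : ℕ) (f : α → ℝ≥0∞) :
    (((p.replicate N).law G).expect fun l => (l.map f).sum ^ 2) ≤
      N * ((p.law G).expect fun a => f a ^ 2) + (N * (p.law G).expect f) ^ 2 := by
  induction N with
  | zero => simp [expect_replicate_zero]
  | succ N ih =>
    simp only [expect_replicate_succ, List.map_cons, List.sum_cons, add_sq, PMF.expect_add,
      PMF.expect_const, PMF.expect_mul_left, PMF.expect_mul_right, expect_sum_replicate]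
    refine (add_le_add_right ih _).trans ?_
    calc _ = ((N : ℝ≥0∞) + 1) * ((p.law G).expect fun a => f a ^ 2) +
          (N ^ 2 + 2 * N) * (p.law G).expect f ^ 2 := by ring
      _ ≤ ((N : ℝ≥0∞) + 1) * ((p.law G).expect fun a => f a ^ 2) +
          (N ^ 2 + 2 * N) * (p.law G).expect f ^ 2 + (p.law G).expect f ^ 2 := le_self_add
      _ = _ := by push_cast; ring

/-- The probability that none of `N` independent samples satisfies `P`. -/
theorem prob_forall_not_replicate (p : Prog α) (P : α → Prop) (N : ℕ) :
    ((p.replicate N).law G).prob (fun l => ∀ a ∈ l, ¬ P a) =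
      ((p.law G).prob fun a => ¬ P a) ^ N := by
  classical
  induction N with
  | zero => simp [PMF.prob, expect_replicate_zero]
  | succ N ih =>
    rw [PMF.prob, expect_replicate_succ, pow_succ', ← ih, PMF.prob, PMF.prob, ← PMF.expect_mul_right]
    congr 1
    funext a
    rw [← PMF.expect_mul_left]
    congr 1
    funext l
    by_cases ha : P a <;> simp [ha]

/-- The number of pairs from two independent samples. -/
theorem expect_double_sum (p : Prog α) (k : ℕ) (h : α → α → ℝ≥0∞) :
    (((p.replicate k).law G).expect fun l => ((p.replicate k).law G).expect fun l' =>
      (l.map fun a => (l'.map fun b => h a b).sum).sum) =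
      k ^ 2 * (p.law G).expect fun a => (p.law G).expect fun b => h a b := by
  rw [PMF.expect_comm]
  simp only [expect_sum_replicate, PMF.expect_mul_left]
  rw [PMF.expect_comm]
  simp only [expect_sum_replicate, PMF.expect_mul_left]
  ring

theorem sum_map_sum_comm (l : List α) (l' : List β) (h : α → β → ℝ≥0∞) :
    (l.map fun a => (l'.map fun b => h a b).sum).sum =
      (l'.map fun b => (l.map fun a => h a b).sum).sum := by
  induction l with
  | nil => simp
  | cons a l ih => simp only [List.map_cons, List.sum_cons, ih, List.sum_map_add]

/-- In the expanded square, equal pairs of positions contribute at most `k²μ`, pairs that share one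
position `2k³rμ`, and disjoint pairs `k⁴μ²`. The proof fixes one list, applies
`expect_sum_sq_replicate_le` to the other, and then averages. -/
theorem expect_double_sum_sq_le (p : Prog α) (k : ℕ) (h : α → α → ℝ≥0∞)
    (hs : ∀ a b, h a b = h b a) (hh : ∀ a b, h a b ^ 2 = h a b) (r : ℝ≥0∞)
    (hr : ∀ a, (p.law G).expect (h a) ≤ r) :
    (((p.replicate k).law G).expect fun l => ((p.replicate k).law G).expect fun l' =>
      (l.map fun a => (l'.map fun b => h a b).sum).sum ^ 2) ≤
      (k ^ 2 + 2 * k ^ 3 * r) * ((p.law G).expect fun a => (p.law G).expect fun b => h a b) +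
      (k ^ 2 * (p.law G).expect fun a => (p.law G).expect fun b => h a b) ^ 2 := by
  set μ := (p.law G).expect fun a => (p.law G).expect fun b => h a b with hμ
  have hsq : ((p.law G).expect fun a => (p.law G).expect (h a) ^ 2) ≤ r * μ := by
    rw [hμ, ← PMF.expect_mul_left]
    refine PMF.expect_mono fun a => ?_
    rw [sq]
    gcongr
    exact hr a
  have inner (b : α) : (((p.replicate k).law G).expect fun l => (l.map fun a => h a b).sum ^ 2) ≤
      k * (p.law G).expect (h b) + k ^ 2 * (p.law G).expect (h b) ^ 2 := by
    refine (expect_sum_sq_replicate_le G p k fun a => h a b).trans_eq ?_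
    simp only [hh, fun a => hs a b, mul_pow]
  have outer : (((p.replicate k).law G).expect fun l =>
      (l.map fun a => (p.law G).expect (h a)).sum ^ 2) ≤ k * (r * μ) + (k * μ) ^ 2 := by
    refine (expect_sum_sq_replicate_le G p k fun a => (p.law G).expect (h a)).trans ?_
    gcongr
  have pull (l : List α) : ((p.law G).expect fun b => (l.map fun a => h a b).sum) =
      (l.map fun a => (p.law G).expect (h a)).sum := by
    induction l with
    | nil => simp [PMF.expect_const]
    | cons a l ih =>
      simp only [List.map_cons, List.sum_cons, PMF.expect_add, ih]
  calc _ ≤ ((p.replicate k).law G).expect fun l =>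
        k * ((p.law G).expect fun b => (l.map fun a => h a b).sum ^ 2) +
        k ^ 2 * (l.map fun a => (p.law G).expect (h a)).sum ^ 2 := by
        refine PMF.expect_mono fun l => ?_
        simp only [sum_map_sum_comm l]
        refine (expect_sum_sq_replicate_le G p k fun b => (l.map fun a => h a b).sum).trans_eq ?_
        rw [pull, mul_pow]
    _ = k * ((p.law G).expect fun b =>
          ((p.replicate k).law G).expect fun l => (l.map fun a => h a b).sum ^ 2) +
        k ^ 2 * ((p.replicate k).law G).expect fun l =>
          (l.map fun a => (p.law G).expect (h a)).sum ^ 2 := by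
        rw [PMF.expect_add, PMF.expect_mul_left, PMF.expect_mul_left, PMF.expect_comm]
    _ ≤ k * (k * μ + k ^ 2 * (r * μ)) + k ^ 2 * (k * (r * μ) + (k * μ) ^ 2) := by
        gcongr
        calc _ ≤ (p.law G).expect fun b =>
              k * (p.law G).expect (h b) + k ^ 2 * (p.law G).expect (h b) ^ 2 :=
              PMF.expect_mono inner
          _ ≤ _ := by
              rw [PMF.expect_add, PMF.expect_mul_left, PMF.expect_mul_left]
              gcongr
    _ = _ := by ring

end Prog

/-! ### Counting adjacent pairs with additive queries -/

namespace InputGraph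

variable (G : InputGraph)

open Classical in
/-- The indicator function of adjacency. -/
noncomputable def adjInd (x y : ℕ) : ℕ := if G.graph.Adj x y then 1 else 0

theorem adjInd_comm (x y : ℕ) : G.adjInd x y = G.adjInd y x := by
  by_cases h : G.graph.Adj x y
  · simp [adjInd, h, h.symm]
  · simp [adjInd, h, mt SimpleGraph.Adj.symm h]

/-- The number of adjacent pairs in `S ×ˢ T`. -/
noncomputable def crossCount (S T : Finset ℕ) : ℕ := ∑ x ∈ S, ∑ y ∈ T, G.adjInd x y

/-- Double counting: the fibre of `(x, y) ↦ s(x, y)` over an edge has two elements, as there are no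
loops. -/
theorem two_mul_card_edgesIn (S : Finset ℕ) : 2 * (G.edgesIn S).card = G.crossCount S S := by
  classical
  have h1 : G.crossCount S S = ((S ×ˢ S).filter fun p => G.graph.Adj p.1 p.2).card := by
    rw [Finset.card_filter, Finset.sum_product]
    simp only [crossCount, adjInd]
  have h2 : Set.MapsTo (fun p : ℕ × ℕ => s(p.1, p.2))
      ((S ×ˢ S).filter fun p => G.graph.Adj p.1 p.2 : Finset (ℕ × ℕ)) (G.edgesIn S) := by
    rintro ⟨x, y⟩ hp
    rw [Finset.mem_coe] at hp ⊢
    simp only [Finset.mem_filter, Finset.mem_product] at hp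
    simp only [edgesIn, Finset.mem_filter, Finset.mk_mem_sym2_iff, SimpleGraph.mem_edgeSet]
    exact hp
  rw [h1, Finset.card_eq_sum_card_fiberwise h2, mul_comm,
    ← smul_eq_mul, ← Finset.sum_const]
  refine Finset.sum_congr rfl fun e he => ?_
  induction e using Sym2.ind with
  | h x y =>
    simp only [edgesIn, Finset.mem_filter, Finset.mk_mem_sym2_iff, SimpleGraph.mem_edgeSet] at he
    rw [show ({p ∈ (S ×ˢ S).filter fun p => G.graph.Adj p.1 p.2 | s(p.1, p.2) = s(x, y)} :
      Finset (ℕ × ℕ)) = {(x, y), (y, x)} by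
        ext ⟨a, b⟩
        simp only [Finset.mem_filter, Finset.mem_product, Sym2.eq_iff, Finset.mem_insert,
          Finset.mem_singleton, Prod.mk.injEq]
        constructor
        · exact fun h => h.2
        · rintro (⟨rfl, rfl⟩ | ⟨rfl, rfl⟩)
          · exact ⟨⟨he.1, he.2⟩, .inl ⟨rfl, rfl⟩⟩
          · exact ⟨⟨he.1.symm, he.2.symm⟩, .inr ⟨rfl, rfl⟩⟩]
    rw [Finset.card_pair]
    intro h
    exact he.2.ne (Prod.mk.inj h).1

/-- With the disjoint parts `A = S \ T`, `B = S ∩ T`, `C = T \ S`, the ordered pairs in `S ×ˢ T`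
consist of those in `A × B`, `A × C`, `B × C` and `B × B`, and the last kind counts each edge inside
`B` twice. Hence four additive queries determine the count. -/
theorem crossCount_eq (S T : Finset ℕ) :
    G.crossCount S T + (G.edgesIn (S \ T)).card + (G.edgesIn (T \ S)).card =
      (G.edgesIn (S ∪ T)).card + (G.edgesIn (S ∩ T)).card := by
  have hS (f : ℕ → ℕ) : ∑ x ∈ S, f x = ∑ x ∈ S \ T, f x + ∑ x ∈ S ∩ T, f x := by
    rw [add_comm, Finset.sum_inter_add_sum_sdiff]
  have hT (f : ℕ → ℕ) : ∑ x ∈ T, f x = ∑ x ∈ T \ S, f x + ∑ x ∈ S ∩ T, f x := by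
    rw [Finset.inter_comm, add_comm, Finset.sum_inter_add_sum_sdiff]
  have hU (f : ℕ → ℕ) : ∑ x ∈ S ∪ T, f x =
      ∑ x ∈ S \ T, f x + ∑ x ∈ S ∩ T, f x + ∑ x ∈ T \ S, f x := by
    rw [← hS, ← Finset.union_sdiff_self_eq_union, Finset.sum_union Finset.disjoint_sdiff]
  have hc (A B : Finset ℕ) : G.crossCount A B = G.crossCount B A := by
    simp only [crossCount]
    rw [Finset.sum_comm]
    simp only [G.adjInd_comm]
  have h1 := G.two_mul_card_edgesIn (S \ T)
  have h2 := G.two_mul_card_edgesIn (T \ S)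
  have h3 := G.two_mul_card_edgesIn (S ∪ T)
  have h4 := G.two_mul_card_edgesIn (S ∩ T)
  have e1 := hc (S \ T) (S ∩ T)
  have e2 := hc (S \ T) (T \ S)
  have e3 := hc (T \ S) (S ∩ T)
  have h5 : G.crossCount S T = G.crossCount (S \ T) (T \ S) + G.crossCount (S \ T) (S ∩ T) +
      (G.crossCount (S ∩ T) (T \ S) + G.crossCount (S ∩ T) (S ∩ T)) := by
    simp only [crossCount, hS, hT, Finset.sum_add_distrib]
  have h6 : G.crossCount (S ∪ T) (S ∪ T) =
      (G.crossCount (S \ T) (S \ T) + G.crossCount (S \ T) (S ∩ T) + G.crossCount (S \ T) (T \ S)) +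
      (G.crossCount (S ∩ T) (S \ T) + G.crossCount (S ∩ T) (S ∩ T) + G.crossCount (S ∩ T) (T \ S)) +
      (G.crossCount (T \ S) (S \ T) + G.crossCount (T \ S) (S ∩ T) +
        G.crossCount (T \ S) (T \ S)) := by
    simp only [crossCount, hU, Finset.sum_add_distrib]
  lia

end InputGraph

/-! ### Query programs that count adjacent pairs -/

namespace Prog

/-- Ask a query whose reply is a vertex. -/
def askVertex (q : Query) : Prog ℕ :=
  .query q fun
    | .vertex x => .ret x
    | _ => .ret 0

/-- Ask a query whose reply is a number. -/
def askNumber (q : Query) : Prog ℕ :=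
  .query q fun
    | .number k => .ret k
    | _ => .ret 0

/-- Ask whether two vertices are adjacent, with reply `1` or `0`. -/
def askPair (x y : ℕ) : Prog ℕ :=
  .query (.pair x y) fun
    | .adjacent true => .ret 1
    | _ => .ret 0

/-- The number of adjacent pairs in `S ×ˢ T`, found by additive queries. -/
def cross (S T : Finset ℕ) : Prog ℕ :=
  (askNumber (.additive (S ∪ T))).bind fun a => (askNumber (.additive (S ∩ T))).bind fun b =>
    (askNumber (.additive (S \ T))).bind fun c => (askNumber (.additive (T \ S))).bind fun d =>
      .ret (a + b - c - d)

/-- The entries of a list that occur again later on. -/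
def repeats : List ℕ → List ℕ
  | [] => []
  | x :: l => if x ∈ l then x :: repeats l else repeats l

/-- A partition of the entries of a list into sets. -/
def blocks (l : List ℕ) : List (Finset ℕ) := l.toFinset :: (repeats l).map fun x => {x}

/-- Additive queries take sets, but samples may repeat. Every repeated occurrence becomes a
singleton block, so that a count with multiplicity is a sum of counts over sets. -/
theorem sum_blocks (l : List ℕ) (f : ℕ → ℕ) :
    ((blocks l).map fun S => ∑ x ∈ S, f x).sum = (l.map f).sum := by
  have h : ((repeats l).map f).sum + ∑ x ∈ l.toFinset, f x = (l.map f).sum := by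
    induction l with
    | nil => simp [repeats]
    | cons x l ih =>
      rw [repeats, List.toFinset_cons]
      split_ifs with hx
      · rw [Finset.insert_eq_of_mem (by simpa using hx)]
        simp only [List.map_cons, List.sum_cons, ← ih, add_assoc]
      · rw [Finset.sum_insert (by simpa using hx)]
        simp only [List.map_cons, List.sum_cons, ← ih]
        ring
  simp only [blocks, List.map_cons, List.sum_cons, List.map_map, Function.comp_def,
    Finset.sum_singleton]
  rw [← h, add_comm]

theorem subset_of_mem_blocks {l : List ℕ} {S : Finset ℕ} (hS : S ∈ blocks l) :
    ∀ x ∈ S, x ∈ l := by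
  have hr (l : List ℕ) : ∀ x ∈ repeats l, x ∈ l := by
    induction l with
    | nil => simp [repeats]
    | cons y l ih =>
      intro x hx
      rw [repeats] at hx
      split_ifs at hx with hy
      · rcases List.mem_cons.1 hx with rfl | hx
        · simp
        · simp [ih x hx]
      · simp [ih x hx]
  intro x hx
  rcases List.mem_cons.1 hS with rfl | hS
  · simpa using hx
  · obtain ⟨y, hy, rfl⟩ := List.mem_map.1 hS
    rw [Finset.mem_singleton.1 hx]
    exact hr l y hy

/-- The number of adjacent pairs with entries from two lists, counted with multiplicity. -/
def crossLists (l l' : List ℕ) : Prog ℕ :=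
  Prog.sum (((blocks l).product (blocks l')).map fun p => cross p.1 p.2)

/-- The number of entries of the list that are adjacent to `w`. -/
def countAdj (w : ℕ) (l : List ℕ) : Prog ℕ := Prog.sum (l.map fun x => askPair w x)

theorem allQueries_askNumber {q : Query} (hq : q.IsAdvanced) :
    (askNumber q).AllQueries Query.IsAdvanced :=
  ⟨hq, fun r => by cases r <;> trivial⟩

theorem allQueries_askVertex {q : Query} (hq : q.IsAdvanced) :
    (askVertex q).AllQueries Query.IsAdvanced :=
  ⟨hq, fun r => by cases r <;> trivial⟩

theorem allQueries_crossLists (l l' : List ℕ) :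
    (crossLists l l').AllQueries Query.IsAdvanced := by
  refine AllQueries.sum fun p hp => ?_
  obtain ⟨⟨S, T⟩, -, rfl⟩ := List.mem_map.1 hp
  have h (S : Finset ℕ) := allQueries_askNumber (q := .additive S) trivial
  exact (h _).bind fun _ => (h _).bind fun _ => (h _).bind fun _ => (h _).bind fun _ => trivial

theorem allQueries_countAdj (w : ℕ) (l : List ℕ) :
    (countAdj w l).AllQueries Query.IsAdvanced := by
  refine AllQueries.sum fun p hp => ?_
  obtain ⟨x, -, rfl⟩ := List.mem_map.1 hp
  refine ⟨trivial, fun r => ?_⟩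
  rcases r with _ | _ | (_ | _) | _ | _ <;> trivial

variable {G : InputGraph}

theorem returns_additive {S : Finset ℕ} (hS : S ⊆ G.V) :
    (askNumber (.additive S)).Returns G (G.edgesIn S).card S.card := by
  have h : G.reply (.additive S) = PMF.pure (.number (G.edgesIn S).card) := by
    simp [InputGraph.reply, hS]
  exact Returns.query (c := 0) h rfl

theorem returns_degree {x : ℕ} (hx : x ∈ G.V) :
    (askNumber (.degree x)).Returns G (G.nbrs x).card 1 := by
  have h : G.reply (.degree x) = PMF.pure (.number (G.nbrs x).card) := by
    simp [InputGraph.reply, hx]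
  exact Returns.query (c := 0) h rfl

theorem returns_askPair {x y : ℕ} (hx : x ∈ G.V) (hy : y ∈ G.V) :
    (askPair x y).Returns G (G.adjInd x y) 1 := by
  classical
  by_cases hxy : G.graph.Adj x y
  · have h : G.reply (.pair x y) = PMF.pure (.adjacent true) := by
      simp [InputGraph.reply, hx, hy, hxy]
    rw [InputGraph.adjInd, if_pos hxy]
    exact Returns.query (c := 0) h rfl
  · have h : G.reply (.pair x y) = PMF.pure (.adjacent false) := by
      simp [InputGraph.reply, hx, hy, hxy]
    rw [InputGraph.adjInd, if_neg hxy]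
    exact Returns.query (c := 0) h rfl

theorem returns_cross {S T : Finset ℕ} (hS : S ⊆ G.V) (hT : T ⊆ G.V) :
    (cross S T).Returns G (G.crossCount S T) (2 * (S ∪ T).card) := by
  have h := (returns_additive (Finset.union_subset hS hT)).bind
    (g := fun a => (askNumber (.additive (S ∩ T))).bind fun b =>
    (askNumber (.additive (S \ T))).bind fun c => (askNumber (.additive (T \ S))).bind fun d =>
      .ret (a + b - c - d))
    ((returns_additive (S := S ∩ T) (Finset.inter_subset_left.trans hS)).bind
      ((returns_additive (S := S \ T) (Finset.sdiff_subset.trans hS)).bind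
        ((returns_additive (S := T \ S) (Finset.sdiff_subset.trans hT)).bind (Returns.ret _))))
  have h1 := G.crossCount_eq S T
  have h2 : (S ∪ T).card = (S ∩ T).card + (S \ T).card + (T \ S).card := by
    rw [Finset.card_inter_add_card_sdiff, ← Finset.union_sdiff_self_eq_union,
      Finset.card_union_of_disjoint Finset.disjoint_sdiff]
  have e1 : (G.edgesIn (S ∪ T)).card + (G.edgesIn (S ∩ T)).card - (G.edgesIn (S \ T)).card -
      (G.edgesIn (T \ S)).card = G.crossCount S T := by lia
  have e2 : (S ∪ T).card + ((S ∩ T).card + ((S \ T).card + ((T \ S).card + 0))) =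
      2 * (S ∪ T).card := by lia
  rw [e1, e2] at h
  exact h

theorem sum_map_product {α β : Type*} (l : List α) (l' : List β) (f : α → β → ℕ) :
    ((l.product l').map fun p => f p.1 p.2).sum =
      (l.map fun a => (l'.map fun b => f a b).sum).sum := by
  induction l with
  | nil => simp [List.product]
  | cons a l ih =>
    simp only [List.product, List.flatMap_cons, List.map_append, List.sum_append, List.map_map,
      Function.comp_def, List.map_cons, List.sum_cons] at ih ⊢
    rw [ih]

theorem sum_map_finset_sum {α β : Type*} (l : List α) (S : Finset β) (f : β → α → ℕ) :
    (l.map fun a => ∑ x ∈ S, f x a).sum = ∑ x ∈ S, (l.map (f x)).sum := by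
  induction l with
  | nil => simp
  | cons a l ih => simp only [List.map_cons, List.sum_cons, ih, Finset.sum_add_distrib]

theorem sum_map_card_union_le (L L' : List (Finset ℕ)) :
    (L.map fun S => (L'.map fun T => 2 * (S ∪ T).card).sum).sum ≤
      2 * (L'.length * (L.map Finset.card).sum + L.length * (L'.map Finset.card).sum) := by
  induction L with
  | nil => simp
  | cons S L ih =>
    have h : (L'.map fun T => 2 * (S ∪ T).card).sum ≤
        2 * (L'.length * S.card + (L'.map Finset.card).sum) := by
      clear ih
      induction L' with
      | nil => simp
      | cons T L' ih' =>
        have := Finset.card_union_le S T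
        simp only [List.map_cons, List.sum_cons, List.length_cons]
        linarith
    simp only [List.map_cons, List.sum_cons, List.length_cons]
    linarith

/-- One `cross` for each pair of blocks costs `2|S ∪ T| ≤ 2|S| + 2|T|`, and the sizes of the blocks
of a list add up to its length. With few repetitions the cost is linear in the lengths, although the
number of pairs counted is their product. -/
theorem exists_returns_crossLists {l l' : List ℕ} (hl : ∀ x ∈ l, x ∈ G.V)
    (hl' : ∀ x ∈ l', x ∈ G.V) :
    ∃ c, (crossLists l l').Returns G (l.map fun x => (l'.map fun y => G.adjInd x y).sum).sum c ∧
      c ≤ 2 * ((1 + (repeats l').length) * l.length + (1 + (repeats l).length) * l'.length) := by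
  have h := Returns.sum_map (G := G) (l := (blocks l).product (blocks l'))
    (p := fun p => cross p.1 p.2) (val := fun p => G.crossCount p.1 p.2)
    (cost := fun p => 2 * (p.1 ∪ p.2).card) (by
      rintro ⟨S, T⟩ hp
      rw [List.pair_mem_product] at hp
      exact returns_cross (fun x hx => hl x (subset_of_mem_blocks hp.1 x hx))
        (fun x hx => hl' x (subset_of_mem_blocks hp.2 x hx)))
  rw [sum_map_product (blocks l) (blocks l') fun S T => G.crossCount S T,
    sum_map_product (blocks l) (blocks l') fun S T => 2 * (S ∪ T).card] at h
  have hcard (l : List ℕ) : ((blocks l).map Finset.card).sum = l.length := by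
    simpa using sum_blocks l fun _ => 1
  have hlen (l : List ℕ) : (blocks l).length = 1 + (repeats l).length := by
    simp [blocks, add_comm]
  refine ⟨_, ?_, (sum_map_card_union_le (blocks l) (blocks l')).trans_eq ?_⟩
  · simp only [InputGraph.crossCount, sum_map_finset_sum, sum_blocks] at h
    exact h
  · rw [hcard, hcard, hlen, hlen]

theorem returns_countAdj {w : ℕ} {l : List ℕ} (hw : w ∈ G.V) (hl : ∀ x ∈ l, x ∈ G.V) :
    (countAdj w l).Returns G (l.map (G.adjInd w)).sum l.length := by
  have h := Returns.sum_map (G := G) (l := l) (p := fun x => askPair w x)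
    (val := G.adjInd w) (cost := fun _ => 1) fun x hx => returns_askPair hw (hl x hx)
  simpa [countAdj] using h

end Prog

/-! ### The doubling search for the number of vertices -/

/-- A random vertex `v`, a random neighbour `w` of it, and their degrees. -/
structure Sample where
  v : ℕ
  w : ℕ
  dv : ℕ
  dw : ℕ

namespace InputGraph

variable (G : InputGraph)

/-- The degree of a vertex. -/
noncomputable def deg (x : ℕ) : ℕ := (G.nbrs x).card

theorem mem_nbrs {x y : ℕ} : y ∈ G.nbrs x ↔ G.graph.Adj x y := by
  simp only [nbrs, Finset.mem_filter, and_iff_right_iff_imp]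
  exact fun h => G.mem_of_adj y x h.symm

theorem deg_pos {x : ℕ} (hx : x ∈ G.V) : 0 < G.deg x := Finset.card_pos.2 (G.nbrs_nonempty hx)

theorem n_pos : 0 < G.n := Finset.card_pos.2 G.nonempty

theorem sum_adjInd_mul (x : ℕ) (f : ℕ → ℝ≥0∞) :
    ∑ y ∈ G.V, G.adjInd x y * f y = ∑ y ∈ G.nbrs x, f y := by
  classical
  rw [nbrs, Finset.sum_filter]
  refine Finset.sum_congr rfl fun y _ => ?_
  by_cases h : G.graph.Adj x y <;> simp [adjInd, h]

theorem sum_adjInd (x : ℕ) : ∑ y ∈ G.V, G.adjInd x y = G.deg x := by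
  classical
  rw [deg, nbrs, Finset.card_filter]
  exact Finset.sum_congr rfl fun y _ => by rw [adjInd]

/-- The indicator function of the adjacent pairs of vertices of degree at most `Δ`. -/
noncomputable def lightInd (Δ x y : ℕ) : ℕ :=
  if G.deg x ≤ Δ ∧ G.deg y ≤ Δ then G.adjInd x y else 0

/-- The number of adjacent pairs of vertices of degree at most `Δ`. -/
noncomputable def lightPairs (Δ : ℕ) : ℕ := ∑ x ∈ G.V, ∑ y ∈ G.V, G.lightInd Δ x y

theorem lightInd_comm (Δ x y : ℕ) : G.lightInd Δ x y = G.lightInd Δ y x := by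
  rw [lightInd, lightInd, adjInd_comm]
  simp only [and_comm]

theorem lightInd_sq (Δ x y : ℕ) : G.lightInd Δ x y ^ 2 = G.lightInd Δ x y := by
  rw [lightInd, adjInd]
  split_ifs <;> simp

theorem sum_lightInd_le (Δ x : ℕ) : ∑ y ∈ G.V, G.lightInd Δ x y ≤ Δ := by
  by_cases hx : G.deg x ≤ Δ
  · refine le_trans ?_ hx
    rw [← sum_adjInd]
    refine Finset.sum_le_sum fun y _ => ?_
    rw [lightInd]
    split_ifs <;> simp
  · simp [lightInd, hx]

/-- The data of the sample agree with `G`. -/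
def Valid (r : Sample) : Prop :=
  r.v ∈ G.V ∧ r.w ∈ G.V ∧ r.dv = G.deg r.v ∧ r.dw = G.deg r.w

end InputGraph

namespace Sample

/-- The degree of `v`, set to `0` unless both degrees are at most `Δ`. -/
def weight (Δ : ℕ) (r : Sample) : ℕ := if r.dv ≤ Δ ∧ r.dw ≤ Δ then r.dv else 0

/-- The vertices `v` of degree at most `Δ` among the samples. -/
def lights (Δ : ℕ) (l : List Sample) : List ℕ := (l.filter fun r => r.dv ≤ Δ).map Sample.v

/-- A vertex of largest degree among the samples, and its degree. -/
def best : List Sample → ℕ × ℕ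
  | [] => (0, 0)
  | r :: l =>
    if (best l).2 < max r.dv r.dw then if r.dw ≤ r.dv then (r.v, r.dv) else (r.w, r.dw)
    else best l

theorem le_best {l : List Sample} : ∀ r ∈ l, r.dv ≤ (best l).2 ∧ r.dw ≤ (best l).2 := by
  induction l with
  | nil => simp
  | cons s l ih =>
    intro r hr
    rw [best]
    rcases List.mem_cons.1 hr with rfl | hr
    · split_ifs <;> constructor <;> lia
    · have := ih r hr
      split_ifs <;> constructor <;> lia

/-- The default `(0, 0)` does not survive a sample, because sampled degrees are positive. -/
theorem best_valid {G : InputGraph} {l : List Sample} (hl : ∀ r ∈ l, G.Valid r) (h : l ≠ []) :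
    (best l).1 ∈ G.V ∧ (best l).2 = G.deg (best l).1 := by
  have key : (best l).2 = 0 ∨ (best l).1 ∈ G.V ∧ (best l).2 = G.deg (best l).1 := by
    clear h
    induction l with
    | nil => simp [best]
    | cons s l ih =>
      rw [best]
      have hs := hl s (by simp)
      split_ifs
      · exact .inr ⟨hs.1, hs.2.2.1⟩
      · exact .inr ⟨hs.2.1, hs.2.2.2⟩
      · exact ih fun r hr => hl r (by simp [hr])
  refine key.resolve_left fun h0 => ?_
  obtain ⟨r, hr⟩ := List.exists_mem_of_ne_nil l h
  have h1 := (le_best r hr).1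
  have h2 := G.deg_pos (hl r hr).1
  rw [← (hl r hr).2.2.1] at h2
  lia

end Sample

namespace Prog

open Sample

/-- Draw a sample. -/
def draw : Prog Sample :=
  (askVertex .randVert).bind fun v => (askVertex (.randNbr v)).bind fun w =>
    (askNumber (.degree v)).bind fun dv => (askNumber (.degree w)).bind fun dw =>
      .ret ⟨v, w, dv, dw⟩

/-- The number of adjacent pairs between the light vertices of two lists of `k` samples. -/
def batch (k Δ : ℕ) : Prog ℕ :=
  (draw.replicate k).bind fun l => (draw.replicate k).bind fun l' =>
    crossLists (lights Δ l) (lights Δ l')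

/-- The answer to the statistics `Y`, `A`, `B`, if they are large enough. -/
noncomputable def answer (k q Δ Y A B : ℕ) : Option ℝ :=
  if q ≤ Y then some (q * k * Δ / Y)
  else if q * Δ ≤ A ∧ q ≤ B then some (k * A / B) else none

/-- The statistics for a given vertex `w` of degree `Δ`. -/
noncomputable def stage (k q w Δ : ℕ) : Prog (Option ℝ) :=
  (draw.replicate (q * k)).bind fun l => (countAdj w (l.map Sample.v)).bind fun Y =>
    ((batch k Δ).replicate q).bind fun b =>
      .ret (answer k q Δ Y (l.map (weight Δ)).sum b.sum)

/-- One level of the search. -/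
noncomputable def level (k q : ℕ) : Prog (Option ℝ) :=
  (draw.replicate k).bind fun l => stage k q (best l).1 (best l).2

theorem allQueries_draw : draw.AllQueries Query.IsAdvanced :=
  (allQueries_askVertex (q := .randVert) trivial).bind fun v =>
    (allQueries_askVertex (q := .randNbr v) trivial).bind fun w =>
      (allQueries_askNumber (q := .degree v) trivial).bind fun _ =>
        (allQueries_askNumber (q := .degree w) trivial).bind fun _ => trivial

theorem allQueries_level (k q : ℕ) : (level k q).AllQueries Query.IsAdvanced :=
  (allQueries_draw.replicate k).bind fun _ => (allQueries_draw.replicate _).bind fun _ =>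
    (allQueries_countAdj _ _).bind fun _ =>
      (((allQueries_draw.replicate k).bind fun _ => (allQueries_draw.replicate k).bind fun _ =>
        allQueries_crossLists _ _).replicate q).bind fun _ => trivial

variable (G : InputGraph)

theorem law_randVert :
    (askVertex .randVert).law G = PMF.uniformOfFinset G.V G.nonempty := by
  rw [askVertex, law_query, InputGraph.reply, PMF.bind_map]
  simp only [Function.comp_def, law_ret]
  exact PMF.bind_pure _

theorem law_randNbr {x : ℕ} (hx : x ∈ G.V) :
    (askVertex (.randNbr x)).law G = PMF.uniformOfFinset (G.nbrs x) (G.nbrs_nonempty hx) := by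
  rw [askVertex, law_query, InputGraph.reply, dif_pos hx, PMF.bind_map]
  simp only [Function.comp_def, law_ret]
  exact PMF.bind_pure _

theorem returns_degrees {v w : ℕ} (hv : v ∈ G.V) (hw : w ∈ G.V) :
    ((askNumber (.degree v)).bind fun dv => (askNumber (.degree w)).bind fun dw =>
      .ret (⟨v, w, dv, dw⟩ : Sample)).Returns G ⟨v, w, G.deg v, G.deg w⟩ 2 :=
  Returns.bind (c := 1) (d := 1) (returns_degree hv)
    (Returns.bind (c := 1) (d := 0) (returns_degree hw) (Returns.ret _))

theorem expect_draw (F : Sample → ℝ≥0∞) :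
    (draw.law G).expect F = (G.n : ℝ≥0∞)⁻¹ * ∑ v ∈ G.V, (G.deg v : ℝ≥0∞)⁻¹ *
      ∑ w ∈ G.nbrs v, F ⟨v, w, G.deg v, G.deg w⟩ := by
  rw [draw, law_bind, law_randVert, PMF.expect_bind, PMF.expect_uniformOfFinset]
  congr 1
  refine Finset.sum_congr rfl fun v hv => ?_
  rw [law_bind, law_randNbr G hv, PMF.expect_bind, PMF.expect_uniformOfFinset]
  congr 1
  refine Finset.sum_congr rfl fun w hw => ?_
  have hw : w ∈ G.V := G.mem_of_adj w v (G.mem_nbrs.1 hw).symm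
  rw [(returns_degrees G hv hw).law, PMF.expect_pure]

theorem expect_draw_vertex (F : ℕ → ℝ≥0∞) :
    ((draw.law G).expect fun r => F r.v) = (G.n : ℝ≥0∞)⁻¹ * ∑ v ∈ G.V, F v := by
  rw [expect_draw]
  congr 1
  refine Finset.sum_congr rfl fun v hv => ?_
  dsimp only
  rw [Finset.sum_const, nsmul_eq_mul, ← mul_assoc, InputGraph.deg, ENNReal.inv_mul_cancel, one_mul]
  · exact_mod_cast (G.deg_pos hv).ne'
  · simp

theorem valid_of_mem_support_draw : ∀ r ∈ (draw.law G).support, G.Valid r := by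
  intro r hr
  rw [draw, law_bind, law_randVert, PMF.mem_support_bind_iff] at hr
  obtain ⟨v, hv, hr⟩ := hr
  rw [PMF.mem_support_uniformOfFinset_iff] at hv
  rw [law_bind, law_randNbr G hv, PMF.mem_support_bind_iff] at hr
  obtain ⟨w, hw, hr⟩ := hr
  rw [PMF.mem_support_uniformOfFinset_iff] at hw
  have hw : w ∈ G.V := G.mem_of_adj w v (G.mem_nbrs.1 hw).symm
  rw [(returns_degrees G hv hw).law,
    PMF.mem_support_pure_iff] at hr
  subst hr
  exact ⟨hv, hw, rfl, rfl⟩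

theorem valid_of_mem_support_replicate_draw (N : ℕ) :
    ∀ l ∈ ((draw.replicate N).law G).support, l.length = N ∧ ∀ r ∈ l, G.Valid r :=
  forall_mem_of_mem_support_replicate G draw _ (valid_of_mem_support_draw G) N

theorem meanCost_draw : draw.meanCost G = 4 := by
  have hv : (askVertex .randVert).meanCost G = 1 := by
    rw [askVertex, meanCost_query, InputGraph.reply, PMF.expect_map]
    simp [meanCost_ret, PMF.expect_const, Query.cost]
  rw [draw, meanCost_bind, hv, law_randVert]
  have h (v) (hvV : v ∈ G.V) : ((askVertex (.randNbr v)).bind fun w =>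
      (askNumber (.degree v)).bind fun dv => (askNumber (.degree w)).bind fun dw =>
      .ret (⟨v, w, dv, dw⟩ : Sample)).meanCost G = 3 := by
    have hw : (askVertex (.randNbr v)).meanCost G = 1 := by
      rw [askVertex, meanCost_query, InputGraph.reply, dif_pos hvV, PMF.expect_map]
      simp [meanCost_ret, PMF.expect_const, Query.cost]
    rw [meanCost_bind, hw, law_randNbr G hvV]
    rw [PMF.expect_congr_support (g := fun _ => 2), PMF.expect_const]
    · norm_num
    intro w hw
    rw [PMF.mem_support_uniformOfFinset_iff] at hw
    have hw : w ∈ G.V := G.mem_of_adj w v (G.mem_nbrs.1 hw).symm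
    rw [(returns_degrees G hvV hw).meanCost]
    norm_num
  rw [PMF.expect_congr_support (g := fun _ => 3), PMF.expect_const]
  · norm_num
  intro v hv
  rw [PMF.mem_support_uniformOfFinset_iff] at hv
  exact h v hv

/-- The weight `deg v` cancels the probability `1 / deg v` of each neighbour, so every light
adjacent pair counts equally. -/
theorem expect_weight (Δ : ℕ) :
    ((draw.law G).expect fun r => (r.weight Δ : ℝ≥0∞)) = (G.n : ℝ≥0∞)⁻¹ * G.lightPairs Δ := by
  rw [expect_draw, InputGraph.lightPairs, Nat.cast_sum]
  congr 1
  refine Finset.sum_congr rfl fun v hv => ?_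
  have hd : (G.deg v : ℝ≥0∞) ≠ 0 := by exact_mod_cast (G.deg_pos hv).ne'
  rw [Nat.cast_sum, ← G.sum_adjInd_mul, Finset.mul_sum]
  refine Finset.sum_congr rfl fun w _ => ?_
  rw [weight, InputGraph.lightInd]
  split_ifs
  · rw [mul_comm, mul_assoc, ENNReal.mul_inv_cancel hd (by simp), mul_one]
  · simp

theorem expect_weight_sq_le (Δ : ℕ) :
    ((draw.law G).expect fun r => (r.weight Δ : ℝ≥0∞) ^ 2) ≤
      Δ * ((G.n : ℝ≥0∞)⁻¹ * G.lightPairs Δ) := by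
  rw [← expect_weight, ← PMF.expect_mul_left]
  refine PMF.expect_mono fun r => ?_
  rw [sq]
  gcongr
  rw [weight]
  split_ifs with h
  · exact h.1
  · simp

theorem expect_adjInd (w : ℕ) :
    ((draw.law G).expect fun r => (G.adjInd w r.v : ℝ≥0∞)) = (G.n : ℝ≥0∞)⁻¹ * G.deg w := by
  rw [expect_draw_vertex G fun x => (G.adjInd w x : ℝ≥0∞), ← G.sum_adjInd, Nat.cast_sum]

theorem expect_lightInd_le (Δ x : ℕ) :
    ((draw.law G).expect fun r => (G.lightInd Δ x r.v : ℝ≥0∞)) ≤ (G.n : ℝ≥0∞)⁻¹ * Δ := by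
  rw [expect_draw_vertex G fun y => (G.lightInd Δ x y : ℝ≥0∞), ← Nat.cast_sum]
  gcongr
  exact G.sum_lightInd_le Δ x

theorem expect_expect_lightInd (Δ : ℕ) :
    ((draw.law G).expect fun r => (draw.law G).expect fun s => (G.lightInd Δ r.v s.v : ℝ≥0∞)) =
      (G.n : ℝ≥0∞)⁻¹ * ((G.n : ℝ≥0∞)⁻¹ * G.lightPairs Δ) := by
  simp only [fun x => expect_draw_vertex G fun y => (G.lightInd Δ x y : ℝ≥0∞)]
  rw [PMF.expect_mul_left, expect_draw_vertex G fun x => ∑ y ∈ G.V, (G.lightInd Δ x y : ℝ≥0∞),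
    InputGraph.lightPairs]
  push_cast
  rfl

theorem sum_lights {l l' : List Sample} (hl : ∀ r ∈ l, G.Valid r) (hl' : ∀ r ∈ l', G.Valid r)
    (Δ : ℕ) : ((lights Δ l).map fun x => ((lights Δ l').map fun y => G.adjInd x y).sum).sum =
      (l.map fun r => (l'.map fun s => G.lightInd Δ r.v s.v).sum).sum := by
  have inner (r : Sample) (hr : G.deg r.v ≤ Δ) :
      ((lights Δ l').map fun y => G.adjInd r.v y).sum =
        (l'.map fun s => G.lightInd Δ r.v s.v).sum := by
    induction l' with
    | nil => simp [lights]
    | cons s l' ih =>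
      have hs := (hl' s (by simp)).2.2.1
      have ih := ih fun t ht => hl' t (by simp [ht])
      rw [List.map_cons, List.sum_cons, ← ih, InputGraph.lightInd]
      by_cases h : s.dv ≤ Δ
      · simp [lights, h, hr, ← hs]
      · simp [lights, h, ← hs]
  have zero (r : Sample) (hr : ¬ G.deg r.v ≤ Δ) :
      (l'.map fun s => G.lightInd Δ r.v s.v).sum = 0 := by
    simp [InputGraph.lightInd, hr]
  induction l with
  | nil => simp [lights]
  | cons r l ih =>
    have hr := (hl r (by simp)).2.2.1
    have ih := ih fun t ht => hl t (by simp [ht])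
    rw [List.map_cons, List.sum_cons, ← ih]
    by_cases h : r.dv ≤ Δ
    · rw [← inner r (hr ▸ h)]
      simp [lights, h]
    · rw [zero r (hr ▸ h)]
      simp [lights, h]

theorem mem_of_mem_lights {l : List Sample} (hl : ∀ r ∈ l, G.Valid r) (Δ : ℕ) :
    ∀ x ∈ lights Δ l, x ∈ G.V := by
  intro x hx
  obtain ⟨r, hr, rfl⟩ := List.mem_map.1 hx
  exact (hl r (List.mem_filter.1 hr).1).1

theorem expect_batch (k Δ : ℕ) (F : ℕ → ℝ≥0∞) :
    ((batch k Δ).law G).expect F = ((draw.replicate k).law G).expect fun l =>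
      ((draw.replicate k).law G).expect fun l' =>
        F (l.map fun r => (l'.map fun s => G.lightInd Δ r.v s.v).sum).sum := by
  rw [batch, law_bind, PMF.expect_bind]
  refine PMF.expect_congr_support fun l hl => ?_
  rw [law_bind, PMF.expect_bind]
  refine PMF.expect_congr_support fun l' hl' => ?_
  have hl := (valid_of_mem_support_replicate_draw G k l hl).2
  have hl' := (valid_of_mem_support_replicate_draw G k l' hl').2
  obtain ⟨c, hc, -⟩ := exists_returns_crossLists (mem_of_mem_lights G hl Δ)
    (mem_of_mem_lights G hl' Δ)
  rw [hc.law, PMF.expect_pure, sum_lights G hl hl']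

theorem cast_double_sum (l l' : List Sample) (Δ : ℕ) :
    (((l.map fun r => (l'.map fun s => G.lightInd Δ r.v s.v).sum).sum : ℕ) : ℝ≥0∞) =
      (l.map fun r => (l'.map fun s => (G.lightInd Δ r.v s.v : ℝ≥0∞)).sum).sum := by
  rw [Nat.cast_list_sum, List.map_map]
  congr 2
  funext r
  simp only [Function.comp_apply, Nat.cast_list_sum, List.map_map, Function.comp_def]

theorem expect_batch_cast (k Δ : ℕ) :
    (((batch k Δ).law G).expect fun b => (b : ℝ≥0∞)) =
      k ^ 2 * ((G.n : ℝ≥0∞)⁻¹ * ((G.n : ℝ≥0∞)⁻¹ * G.lightPairs Δ)) := by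
  rw [expect_batch]
  simp only [cast_double_sum]
  rw [expect_double_sum G draw k fun r s => (G.lightInd Δ r.v s.v : ℝ≥0∞),
    expect_expect_lightInd]

theorem expect_batch_sq_le (k Δ : ℕ) :
    (((batch k Δ).law G).expect fun b => (b : ℝ≥0∞) ^ 2) ≤
      (k ^ 2 + 2 * k ^ 3 * ((G.n : ℝ≥0∞)⁻¹ * Δ)) *
        ((G.n : ℝ≥0∞)⁻¹ * ((G.n : ℝ≥0∞)⁻¹ * G.lightPairs Δ)) +
      (k ^ 2 * ((G.n : ℝ≥0∞)⁻¹ * ((G.n : ℝ≥0∞)⁻¹ * G.lightPairs Δ))) ^ 2 := by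
  rw [expect_batch]
  simp only [cast_double_sum]
  rw [← expect_expect_lightInd]
  refine expect_double_sum_sq_le G draw k (fun r s => (G.lightInd Δ r.v s.v : ℝ≥0∞)) ?_ ?_ _ ?_
  · exact fun r s => by rw [InputGraph.lightInd_comm]
  · exact fun r s => by exact_mod_cast G.lightInd_sq Δ r.v s.v
  · exact fun r => expect_lightInd_le G Δ r.v

/-- Birthday bound: the head of the list agrees with one of the at most `k` vertices of the tail
with probability at most `k/n`. -/
theorem expect_repeats_lights_le (k Δ : ℕ) :
    (((draw.replicate k).law G).expect fun l => ((repeats (lights Δ l)).length : ℝ≥0∞)) ≤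
      k ^ 2 * (G.n : ℝ≥0∞)⁻¹ := by
  classical
  induction k with
  | zero => simp [expect_replicate_zero, lights, repeats]
  | succ k ih =>
    rw [expect_replicate_succ, PMF.expect_comm]
    calc _ ≤ ((draw.replicate k).law G).expect fun l =>
          ((repeats (lights Δ l)).length : ℝ≥0∞) + (G.n : ℝ≥0∞)⁻¹ * k := by
          refine PMF.expect_mono_support fun l hl => ?_
          have hlen := (valid_of_mem_support_replicate_draw G k l hl).1
          calc _ ≤ (draw.law G).expect fun r => ((repeats (lights Δ l)).length : ℝ≥0∞) +
                (if r.v ∈ lights Δ l then 1 else 0) := by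
                refine PMF.expect_mono fun r => ?_
                by_cases h : r.dv ≤ Δ
                · have : lights Δ (r :: l) = r.v :: lights Δ l := by simp [lights, h]
                  rw [this, repeats]
                  split_ifs <;> simp
                · have : lights Δ (r :: l) = lights Δ l := by simp [lights, h]
                  rw [this]
                  exact le_self_add
            _ ≤ _ := by
                rw [PMF.expect_add, PMF.expect_const,
                  expect_draw_vertex G fun x => if x ∈ lights Δ l then 1 else 0]
                gcongr
                rw [Finset.sum_boole]
                have : (G.V.filter fun x => x ∈ lights Δ l).card ≤ k := by
                  calc _ ≤ (lights Δ l).toFinset.card :=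
                        Finset.card_le_card fun x hx => by
                          simpa using (Finset.mem_filter.1 hx).2
                    _ ≤ (lights Δ l).length := List.toFinset_card_le _
                    _ ≤ k := by
                        rw [lights, List.length_map, ← hlen]
                        exact List.length_filter_le _ _
                exact_mod_cast this
      _ ≤ k ^ 2 * (G.n : ℝ≥0∞)⁻¹ + (G.n : ℝ≥0∞)⁻¹ * k := by
          rw [PMF.expect_add, PMF.expect_const]
          gcongr
      _ ≤ k ^ 2 * (G.n : ℝ≥0∞)⁻¹ + (G.n : ℝ≥0∞)⁻¹ * k + (k + 1) * (G.n : ℝ≥0∞)⁻¹ := le_self_add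
      _ = _ := by push_cast; ring

/-- The two lists of draws cost `8k`. `crossLists` adds `4k`, and at most `2k` for every repetition
in either list. -/
theorem meanCost_batch_le (k Δ : ℕ) :
    (batch k Δ).meanCost G ≤ 12 * k + 4 * k * (k ^ 2 * (G.n : ℝ≥0∞)⁻¹) := by
  have h (l l' : List Sample) (hl : l ∈ ((draw.replicate k).law G).support)
      (hl' : l' ∈ ((draw.replicate k).law G).support) :
      (crossLists (lights Δ l) (lights Δ l')).meanCost G ≤
        4 * k + 2 * k * (repeats (lights Δ l)).length + 2 * k * (repeats (lights Δ l')).length := by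
    obtain ⟨e, hl⟩ := valid_of_mem_support_replicate_draw G k l hl
    obtain ⟨e', hl'⟩ := valid_of_mem_support_replicate_draw G k l' hl'
    obtain ⟨c, hc, hle⟩ := exists_returns_crossLists (mem_of_mem_lights G hl Δ)
      (mem_of_mem_lights G hl' Δ)
    have b : (lights Δ l).length ≤ k := by
      rw [lights, List.length_map, ← e]
      exact List.length_filter_le _ _
    have b' : (lights Δ l').length ≤ k := by
      rw [lights, List.length_map, ← e']
      exact List.length_filter_le _ _
    rw [hc.meanCost]
    have : c ≤ 4 * k + 2 * k * (repeats (lights Δ l)).length +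
        2 * k * (repeats (lights Δ l')).length := by
      refine hle.trans ?_
      nlinarith
    exact_mod_cast this
  have h2 (l : List Sample) (hl : l ∈ ((draw.replicate k).law G).support) :
      ((draw.replicate k).bind fun l' => crossLists (lights Δ l) (lights Δ l')).meanCost G ≤
        8 * k + 2 * k * (repeats (lights Δ l)).length + 2 * k * (k ^ 2 * (G.n : ℝ≥0∞)⁻¹) := by
    rw [meanCost_bind, meanCost_replicate, meanCost_draw]
    calc _ ≤ (k : ℝ≥0∞) * 4 + ((draw.replicate k).law G).expect fun l' =>
          4 * k + 2 * k * (repeats (lights Δ l)).length +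
            2 * k * ((repeats (lights Δ l')).length : ℝ≥0∞) := by
          gcongr
          exact PMF.expect_mono_support fun l' hl' => h l l' hl hl'
      _ ≤ (k : ℝ≥0∞) * 4 + (4 * k + 2 * k * (repeats (lights Δ l)).length +
            2 * k * (k ^ 2 * (G.n : ℝ≥0∞)⁻¹)) := by
          rw [PMF.expect_add, PMF.expect_const, PMF.expect_mul_left]
          gcongr
          exact expect_repeats_lights_le G k Δ
      _ = _ := by ring
  rw [batch, meanCost_bind, meanCost_replicate, meanCost_draw]
  calc _ ≤ (k : ℝ≥0∞) * 4 + ((draw.replicate k).law G).expect fun l =>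
        8 * k + 2 * k * ((repeats (lights Δ l)).length : ℝ≥0∞) +
          2 * k * (k ^ 2 * (G.n : ℝ≥0∞)⁻¹) := by
        gcongr
        exact PMF.expect_mono_support h2
    _ ≤ (k : ℝ≥0∞) * 4 + (8 * k + 2 * k * (k ^ 2 * (G.n : ℝ≥0∞)⁻¹) +
          2 * k * (k ^ 2 * (G.n : ℝ≥0∞)⁻¹)) := by
        rw [PMF.expect_add, PMF.expect_const, PMF.expect_add, PMF.expect_const,
          PMF.expect_mul_left]
        gcongr
        exact expect_repeats_lights_le G k Δ
    _ = _ := by ring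

end Prog

/-! ### Accuracy and acceptance of the three statistics -/

namespace Prog

open Sample

variable (G : InputGraph)

theorem ofReal_div_n (x : ℝ) :
    ENNReal.ofReal (x / G.n) = (G.n : ℝ≥0∞)⁻¹ * ENNReal.ofReal x := by
  have : (0 : ℝ) < G.n := by exact_mod_cast G.n_pos
  rw [div_eq_inv_mul, ENNReal.ofReal_mul (by positivity), ENNReal.ofReal_inv_of_pos this,
    ENNReal.ofReal_natCast]

theorem expect_sum_nat {α : Type} (p : Prog α) (M : ℕ) (f : α → ℕ) {x : ℝ}
    (h : ((p.law G).expect fun r => (f r : ℝ≥0∞)) = ENNReal.ofReal x) :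
    (((p.replicate M).law G).expect fun l => (((l.map f).sum : ℕ) : ℝ≥0∞)) =
      ENNReal.ofReal (M * x) := by
  simp only [Nat.cast_list_sum, List.map_map, Function.comp_def]
  rw [expect_sum_replicate G p M fun r => (f r : ℝ≥0∞), h, ENNReal.ofReal_mul (by positivity),
    ENNReal.ofReal_natCast]

theorem expect_sum_nat_sq_le {α : Type} (p : Prog α) (M : ℕ) (f : α → ℕ) {x y : ℝ} (hx : 0 ≤ x)
    (hy : 0 ≤ y) (h : ((p.law G).expect fun r => (f r : ℝ≥0∞)) = ENNReal.ofReal x)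
    (h2 : ((p.law G).expect fun r => (f r : ℝ≥0∞) ^ 2) ≤ ENNReal.ofReal y) :
    (((p.replicate M).law G).expect fun l => (((l.map f).sum : ℕ) : ℝ≥0∞) ^ 2) ≤
      ENNReal.ofReal ((M * x) ^ 2 + M * y) := by
  simp only [Nat.cast_list_sum, List.map_map, Function.comp_def]
  refine (expect_sum_sq_replicate_le G p M fun r => (f r : ℝ≥0∞)).trans ?_
  rw [h, add_comm, ENNReal.ofReal_add (by positivity) (by positivity),
    ENNReal.ofReal_pow (by positivity), ENNReal.ofReal_mul (by positivity),
    ENNReal.ofReal_mul (by positivity), ENNReal.ofReal_natCast]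
  gcongr

/-- The expected number of light adjacent pairs that start in a random vertex. -/
noncomputable def lightMean (Δ : ℕ) : ℝ := G.lightPairs Δ / G.n

theorem lightMean_nonneg (Δ : ℕ) : 0 ≤ lightMean G Δ := by
  unfold lightMean
  positivity

theorem ofReal_lightMean (Δ : ℕ) :
    ENNReal.ofReal (lightMean G Δ) = (G.n : ℝ≥0∞)⁻¹ * G.lightPairs Δ := by
  rw [lightMean, ofReal_div_n, ENNReal.ofReal_natCast]

theorem expect_adjInd_ofReal {w Δ : ℕ} (hΔ : Δ = G.deg w) :
    ((draw.law G).expect fun r => (G.adjInd w r.v : ℝ≥0∞)) = ENNReal.ofReal (Δ / G.n) := by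
  rw [expect_adjInd, ofReal_div_n, ENNReal.ofReal_natCast, hΔ]

theorem expect_adjInd_sq_ofReal {w Δ : ℕ} (hΔ : Δ = G.deg w) :
    ((draw.law G).expect fun r => (G.adjInd w r.v : ℝ≥0∞) ^ 2) = ENNReal.ofReal (Δ / G.n) := by
  rw [← expect_adjInd_ofReal G hΔ]
  congr 1
  funext r
  rw [InputGraph.adjInd]
  split_ifs <;> simp

theorem expect_weight_ofReal (Δ : ℕ) :
    ((draw.law G).expect fun r => (r.weight Δ : ℝ≥0∞)) = ENNReal.ofReal (lightMean G Δ) := by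
  rw [expect_weight, ofReal_lightMean]

theorem expect_weight_sq_ofReal (Δ : ℕ) :
    ((draw.law G).expect fun r => (r.weight Δ : ℝ≥0∞) ^ 2) ≤
      ENNReal.ofReal (Δ * lightMean G Δ) := by
  rw [ENNReal.ofReal_mul (by positivity), ofReal_lightMean, ENNReal.ofReal_natCast]
  exact expect_weight_sq_le G Δ

theorem expect_batch_ofReal (k Δ : ℕ) :
    (((batch k Δ).law G).expect fun b => (b : ℝ≥0∞)) =
      ENNReal.ofReal (k ^ 2 * (lightMean G Δ / G.n)) := by
  rw [expect_batch_cast, ENNReal.ofReal_mul (by positivity), ofReal_div_n, ofReal_lightMean,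
    ENNReal.ofReal_pow (by positivity), ENNReal.ofReal_natCast]

theorem expect_batch_sq_ofReal (k Δ : ℕ) :
    (((batch k Δ).law G).expect fun b => (b : ℝ≥0∞) ^ 2) ≤
      ENNReal.ofReal ((k ^ 2 + 2 * k ^ 3 * (Δ / G.n)) * (lightMean G Δ / G.n) +
        (k ^ 2 * (lightMean G Δ / G.n)) ^ 2) := by
  have h := lightMean_nonneg G Δ
  refine (expect_batch_sq_le G k Δ).trans_eq ?_
  rw [ENNReal.ofReal_add (by positivity) (by positivity), ENNReal.ofReal_mul (by positivity),
    ENNReal.ofReal_pow (by positivity), ENNReal.ofReal_mul (by positivity),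
    ENNReal.ofReal_add (by positivity) (by positivity), ENNReal.ofReal_mul (by positivity),
    ENNReal.ofReal_mul (by positivity), ENNReal.ofReal_pow (by positivity),
    ENNReal.ofReal_pow (by positivity), ofReal_div_n, ofReal_div_n, ofReal_lightMean,
    ENNReal.ofReal_natCast, ENNReal.ofReal_natCast]
  simp

/-- The statistics `Y`, `A`, `B` lie in their acceptance region and are close to their means, or
not. -/
def Misleading (η τ μ : ℝ) (X : ℕ) : Prop := τ ≤ X ∧ ¬ |(X : ℝ) - μ| ≤ η * X

theorem abs_scale_sub_le {N η ε Y μ : ℝ} (hN : 0 ≤ N) (hη : η ≤ ε) (hY : 0 < Y)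
    (h : |Y - μ| ≤ η * Y) : |N * μ / Y - N| ≤ ε * N := by
  have : N * μ / Y - N = -(N / Y) * (Y - μ) := by
    field_simp
    ring
  rw [this, abs_mul, abs_neg, abs_of_nonneg (by positivity)]
  calc N / Y * |Y - μ| ≤ N / Y * (η * Y) := by gcongr
    _ = η * N := by field_simp
    _ ≤ ε * N := by gcongr

/-- For `ε ≤ 1` one has `1 + ε/4 ≤ (1 + ε)(1 - ε/4)` and `(1 - ε)(1 + ε/4) ≤ 1 - ε/4`, so two
relative errors of `ε/4` combine to at most `ε`. -/
theorem abs_ratio_sub_le {N k ε A B α β : ℝ} (hN : 0 ≤ N) (hε : 0 < ε) (hε' : ε ≤ 1) (hk : 0 ≤ k)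
    (hA : |A - α| ≤ ε / 4 * A) (hB : 0 < B) (hB' : |B - β| ≤ ε / 4 * B) (h : k * α = N * β) :
    |k * A / B - N| ≤ ε * N := by
  rw [abs_le] at hA hB'
  have e : k * A / B - N = (k * A - N * B) / B := by field_simp
  rw [e, abs_div, abs_of_pos hB, div_le_iff₀ hB, abs_le]
  have h1 : k * ((1 - ε / 4) * A) ≤ N * ((1 + ε / 4) * B) := by
    calc k * ((1 - ε / 4) * A) ≤ k * α := by gcongr; linarith
      _ = N * β := h
      _ ≤ _ := by gcongr; linarith
  have h2 : N * ((1 - ε / 4) * B) ≤ k * ((1 + ε / 4) * A) := by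
    calc N * ((1 - ε / 4) * B) ≤ N * β := by gcongr; linarith
      _ = k * α := h.symm
      _ ≤ _ := by gcongr; linarith
  have hNB : 0 ≤ N * B := by positivity
  constructor
  · have : (1 - ε) * (1 + ε / 4) ≤ 1 - ε / 4 := by nlinarith
    have h3 : (1 - ε) * (1 + ε / 4) * (N * B) ≤ (1 + ε / 4) * (k * A) := by
      calc _ ≤ (1 - ε / 4) * (N * B) := by gcongr
        _ ≤ _ := by linarith
    have h4 : (1 - ε) * (N * B) ≤ k * A := by
      have : 0 < 1 + ε / 4 := by positivity
      nlinarith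
    linarith
  · have : 1 + ε / 4 ≤ (1 + ε) * (1 - ε / 4) := by nlinarith
    have h3 : (1 - ε / 4) * (k * A) ≤ (1 - ε / 4) * ((1 + ε) * (N * B)) := by
      calc _ ≤ (1 + ε / 4) * (N * B) := by linarith
        _ ≤ (1 + ε) * (1 - ε / 4) * (N * B) := by gcongr
        _ = _ := by ring
    have h4 := le_of_mul_le_mul_left h3 (by linarith)
    linarith

-- A wrong answer needs an accepted statistic that is inaccurate. An error of `B` is charged only if
-- the mean of `A` is at least half of its threshold. This holds whenever `A` is accepted and
-- accurate, and it is exactly what bounds the variance of `B` in `variance_batches_le`.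
open Classical in
theorem wrong_answer_le {N a ε : ℝ} {k q Δ : ℕ} (hN : 0 < N) (hε : 0 < ε) (hε' : ε < 1)
    (hq : 0 < q) (hΔ : 0 < Δ) (Y A B : ℕ) :
    searchAlgorithm.wrong (fun v => |v - N| ≤ ε * N) (answer k q Δ Y A B) ≤
      (if Misleading (ε / 4) q ((q * k : ℕ) * (Δ / N)) Y then 1 else 0) +
      (if Misleading (ε / 4) (q * Δ) ((q * k : ℕ) * a) A then 1 else 0) +
      (if (q * Δ : ℝ) ≤ 2 * ((q * k : ℕ) * a) ∧ Misleading (ε / 4) q (q * (k ^ 2 * (a / N))) B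
        then 1 else 0) := by
  have hq' : (0 : ℝ) < q := by exact_mod_cast hq
  have hΔ' : (0 : ℝ) < Δ := by exact_mod_cast hΔ
  by_cases h1 : Misleading (ε / 4) q ((q * k : ℕ) * (Δ / N)) Y
  · rw [if_pos h1, add_assoc]
    refine le_add_right ?_
    unfold searchAlgorithm.wrong
    split <;> (try split_ifs) <;> simp
  by_cases h2 : Misleading (ε / 4) (q * Δ) ((q * k : ℕ) * a) A
  · rw [if_pos h2]
    refine le_add_right (le_add_left ?_)
    unfold searchAlgorithm.wrong
    split <;> (try split_ifs) <;> simp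
  by_cases h3 : (q * Δ : ℝ) ≤ 2 * ((q * k : ℕ) * a) ∧ Misleading (ε / 4) q (q * (k ^ 2 * (a / N))) B
  · rw [if_pos h3]
    refine le_add_left ?_
    unfold searchAlgorithm.wrong
    split <;> (try split_ifs) <;> simp
  refine le_of_eq_of_le ?_ zero_le
  rw [answer]
  split_ifs with hY hAB
  · rw [searchAlgorithm.wrong, if_pos]
    have hY' : (q : ℝ) ≤ Y := by exact_mod_cast hY
    have := of_not_not fun h => h1 ⟨hY', h⟩
    have := abs_scale_sub_le (ε := ε) hN.le (by linarith) (by linarith) this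
    rwa [show N * (((q * k : ℕ) : ℝ) * (Δ / N)) = q * k * Δ by push_cast; field_simp] at this
  · rw [searchAlgorithm.wrong, if_pos]
    have hA' : (q * Δ : ℝ) ≤ A := by exact_mod_cast hAB.1
    have hB' : (q : ℝ) ≤ B := by exact_mod_cast hAB.2
    have hA := of_not_not fun h => h2 ⟨hA', h⟩
    have hA2 : (q * Δ : ℝ) ≤ 2 * ((q * k : ℕ) * a) := by
      rw [abs_le] at hA
      have : (0 : ℝ) < q * Δ := by positivity
      nlinarith
    have hB := of_not_not fun h => h3 ⟨hA2, hB', h⟩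
    refine abs_ratio_sub_le hN.le hε hε'.le (by positivity) hA (by linarith) hB ?_
    push_cast
    field_simp
  · rfl

variable {G}

/-- `Y` and `A` are computed from the same samples. This is harmless, since the error probabilities
are combined by a union bound. -/
theorem expect_stage {k q w Δ : ℕ} (hw : w ∈ G.V) (F : Option ℝ → ℝ≥0∞) :
    ((stage k q w Δ).law G).expect F = ((draw.replicate (q * k)).law G).expect fun l =>
      (((batch k Δ).replicate q).law G).expect fun b =>
        F (answer k q Δ (l.map fun r => G.adjInd w r.v).sum (l.map (weight Δ)).sum b.sum) := by
  rw [stage, law_bind, PMF.expect_bind]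
  refine PMF.expect_congr_support fun l hl => ?_
  have hl := (valid_of_mem_support_replicate_draw G _ l hl).2
  rw [law_bind, (returns_countAdj hw fun x hx => ?_).law, PMF.pure_bind, law_bind, PMF.expect_bind]
  · simp only [law_ret, PMF.expect_pure, List.map_map, Function.comp_def]
  · obtain ⟨r, hr, rfl⟩ := List.mem_map.1 hx
    exact (hl r hr).1

theorem mul_le_max_sq {x y : ℝ} (hx : 0 ≤ x) (hy : 0 ≤ y) : x * y ≤ max x y ^ 2 := by
  rw [sq]
  exact mul_le_mul (le_max_left _ _) (le_max_right _ _) hy (hx.trans (le_max_left _ _))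

/-- The constant is `6 = 1 + 4 + 1`. The diagonal term is covered by `h1`. The term from pairs
sharing a vertex is at most four times the squared mean, because `hA` gives `Δ ≤ 2ka`. The last
summand is the squared mean of a batch that the crude second-moment bound keeps. -/
theorem variance_batches_le {N a q k Δ M : ℝ} (hN : 0 < N) (ha : 0 ≤ a) (hq : 0 < q)
    (hk : 0 ≤ k) (hΔ : 0 < Δ) (hA : q * Δ ≤ 2 * (q * k * a))
    (h1 : q * (q * (k ^ 2 * (a / N))) ≤ M) (h2 : (q * (k ^ 2 * (a / N))) ^ 2 ≤ M) :
    q * ((k ^ 2 + 2 * k ^ 3 * (Δ / N)) * (a / N) + (k ^ 2 * (a / N)) ^ 2) ≤ 6 / q * M := by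
  have hΔ' : Δ ≤ 2 * k * a := le_of_mul_le_mul_left (by linarith) hq
  rw [div_mul_eq_mul_div, le_div_iff₀ hq]
  have e : q * ((k ^ 2 + 2 * k ^ 3 * (Δ / N)) * (a / N) + (k ^ 2 * (a / N)) ^ 2) * q =
      q * (q * (k ^ 2 * (a / N))) + 2 * (q ^ 2 * k ^ 3 * (a / N) * (1 / N)) * Δ +
        (q * (k ^ 2 * (a / N))) ^ 2 := by
    field_simp
  have e2 : 2 * (q ^ 2 * k ^ 3 * (a / N) * (1 / N)) * (2 * k * a) =
      4 * (q * (k ^ 2 * (a / N))) ^ 2 := by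
    field_simp
    ring
  have : 2 * (q ^ 2 * k ^ 3 * (a / N) * (1 / N)) * Δ ≤
      2 * (q ^ 2 * k ^ 3 * (a / N) * (1 / N)) * (2 * k * a) := by gcongr
  rw [e]
  linarith

/-- With few exceptions a stage does not return a bad approximation of the number of vertices. -/
theorem expect_wrong_stage_le {k q w Δ : ℕ} {ε : ℝ} (hε : 0 < ε) (hε' : ε < 1) (hq : 0 < q)
    (hw : w ∈ G.V) (hΔ : Δ = G.deg w) :
    ((stage k q w Δ).law G).expect (searchAlgorithm.wrong fun v => |v - G.n| ≤ ε * G.n) ≤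
      ENNReal.ofReal (512 / (ε ^ 2 * q)) := by
  classical
  have hq' : (0 : ℝ) < q := by exact_mod_cast hq
  have hΔ0 : 0 < Δ := hΔ ▸ G.deg_pos hw
  have hΔ' : (0 : ℝ) < Δ := by exact_mod_cast hΔ0
  have hN : (0 : ℝ) < G.n := by exact_mod_cast G.n_pos
  have ha := lightMean_nonneg G Δ
  set p := (draw.replicate (q * k)).law G with hp
  set p' := ((batch k Δ).replicate q).law G with hp'
  have hY : (p.prob fun l => Misleading (ε / 4) q ((q * k : ℕ) * (Δ / G.n))
      (l.map fun r => G.adjInd w r.v).sum) ≤ ENNReal.ofReal (4 * 1 / ((ε / 4) ^ 2 * q)) := by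
    refine p.prob_false_accept _ (σ := (q * k : ℕ) * (Δ / G.n)) (by positivity) (by positivity)
      (expect_sum_nat G draw _ _ (expect_adjInd_ofReal G hΔ))
      (expect_sum_nat_sq_le G draw _ _ (by positivity) (by positivity)
        (expect_adjInd_ofReal G hΔ) (expect_adjInd_sq_ofReal G hΔ).le) hq' (by positivity)
      (by linarith) hq' ?_
    rw [div_mul_eq_mul_div, le_div_iff₀ hq', one_mul, mul_comm]
    exact mul_le_max_sq hq'.le (by positivity)
  have hA : (p.prob fun l => Misleading (ε / 4) (q * Δ) ((q * k : ℕ) * lightMean G Δ)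
      (l.map (weight Δ)).sum) ≤ ENNReal.ofReal (4 * 1 / ((ε / 4) ^ 2 * q)) := by
    refine p.prob_false_accept _ (σ := (q * k : ℕ) * (Δ * lightMean G Δ)) (by positivity)
      (by positivity) (expect_sum_nat G draw _ _ (expect_weight_ofReal G Δ))
      (expect_sum_nat_sq_le G draw _ _ ha (by positivity)
        (expect_weight_ofReal G Δ) (expect_weight_sq_ofReal G Δ)) (by positivity) (by positivity)
      (by linarith) hq' ?_
    rw [div_mul_eq_mul_div, le_div_iff₀ hq', one_mul]
    refine le_of_eq_of_le ?_ (mul_le_max_sq (by positivity) (by positivity))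
    ring
  have hB : (p'.prob fun b => (q * Δ : ℝ) ≤ 2 * ((q * k : ℕ) * lightMean G Δ) ∧
      Misleading (ε / 4) q (q * (k ^ 2 * (lightMean G Δ / G.n))) b.sum) ≤
      ENNReal.ofReal (4 * 6 / ((ε / 4) ^ 2 * q)) := by
    by_cases hc : (q * Δ : ℝ) ≤ 2 * ((q * k : ℕ) * lightMean G Δ)
    · simp only [hc, true_and]
      have m1 := expect_sum_nat G (batch k Δ) q id (expect_batch_ofReal G k Δ)
      have m2 := expect_sum_nat_sq_le G (batch k Δ) q id (by positivity) (by positivity)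
        (expect_batch_ofReal G k Δ) (expect_batch_sq_ofReal G k Δ)
      simp only [List.map_id] at m1 m2
      refine p'.prob_false_accept List.sum (by positivity) (by positivity) m1 m2 hq'
        (by positivity) (by linarith) hq' ?_
      push_cast at hc
      refine variance_batches_le hN ha hq' (by positivity) hΔ' hc
        (mul_le_max_sq (by positivity) (by positivity)) ?_
      gcongr
      exact le_max_right _ _
    · simp only [hc, false_and]
      simp [PMF.prob, PMF.expect_const]
  rw [expect_stage hw]
  calc _ ≤ p.expect fun l => p'.expect fun b => _ :=
        PMF.expect_mono fun l => PMF.expect_mono fun b =>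
          wrong_answer_le (a := lightMean G Δ) hN hε hε' hq hΔ0 _ _ _
    _ = _ := by
        simp only [PMF.expect_add, PMF.expect_const, PMF.prob]
        congr!
    _ ≤ _ := add_le_add (add_le_add hY hA) hB
    -- The constant is `4 · 16 · (1 + 1 + 6) = 512`, where `16` comes from `(ε/4)²`.
    _ = _ := by
        rw [← ENNReal.ofReal_add (by positivity) (by positivity),
          ← ENNReal.ofReal_add (by positivity) (by positivity)]
        congr 1
        field_simp
        norm_num

/-- A stage is likely to return an answer if `k` is large enough. -/
theorem expect_missing_stage_le {k q w Δ : ℕ} (hq : 0 < q) (hw : w ∈ G.V) (hΔ : Δ = G.deg w)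
    (h : 2 * (G.n : ℝ) ≤ k * Δ ∨
      2 * (Δ : ℝ) ≤ k * lightMean G Δ ∧ 2 * (G.n : ℝ) ≤ k ^ 2 * lightMean G Δ) :
    ((stage k q w Δ).law G).expect searchAlgorithm.missing ≤ ENNReal.ofReal (28 / q) := by
  classical
  have hq' : (0 : ℝ) < q := by exact_mod_cast hq
  have hΔ0 : 0 < Δ := hΔ ▸ G.deg_pos hw
  have hΔ' : (0 : ℝ) < Δ := by exact_mod_cast hΔ0
  have hN : (0 : ℝ) < G.n := by exact_mod_cast G.n_pos
  have ha := lightMean_nonneg G Δ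
  set p := (draw.replicate (q * k)).law G with hp
  set p' := ((batch k Δ).replicate q).law G with hp'
  rw [expect_stage hw]
  -- In the first case the mean of `Y` is at least twice its threshold, which alone forces an
  -- answer. In the second case this holds for both `A` and `B`, with failure bounds `4/q` and
  -- `24/q`.
  rcases h with h | ⟨h1, h2⟩
  · have hm : 2 * (q : ℝ) ≤ (q * k : ℕ) * (Δ / G.n) := by
      have : 2 * (q : ℝ) * G.n ≤ q * (k * Δ) := by nlinarith
      rw [← mul_div_assoc, le_div_iff₀ hN]
      push_cast
      linarith
    have hY : (p.prob fun l => (((l.map fun r => G.adjInd w r.v).sum : ℕ) : ℝ) < q) ≤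
        ENNReal.ofReal (4 * 1 / q) := by
      refine p.prob_false_reject _ (σ := (q * k : ℕ) * (Δ / G.n)) (by positivity)
        (expect_sum_nat G draw _ _ (expect_adjInd_ofReal G hΔ))
        (expect_sum_nat_sq_le G draw _ _ (by positivity) (by positivity)
          (expect_adjInd_ofReal G hΔ) (expect_adjInd_sq_ofReal G hΔ).le) hm (by linarith) ?_
      rw [div_mul_eq_mul_div, le_div_iff₀ hq']
      nlinarith
    calc _ ≤ p.expect fun l =>
          if (((l.map fun r => G.adjInd w r.v).sum : ℕ) : ℝ) < q then 1 else 0 := by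
          refine PMF.expect_mono fun l => PMF.expect_le_of_le fun b => ?_
          rw [answer]
          by_cases hl : q ≤ (l.map fun r => G.adjInd w r.v).sum
          · rw [if_pos hl]
            exact zero_le
          · have hl' : (((l.map fun r => G.adjInd w r.v).sum : ℕ) : ℝ) < q :=
              Nat.cast_lt.2 (not_le.1 hl)
            rw [if_pos hl']
            unfold searchAlgorithm.missing
            split <;> simp
      _ ≤ _ := hY
      _ ≤ _ := by
          refine ENNReal.ofReal_le_ofReal ?_
          gcongr
          norm_num
  · have hA : (p.prob fun l => (((l.map (weight Δ)).sum : ℕ) : ℝ) < q * Δ) ≤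
        ENNReal.ofReal (4 * 1 / q) := by
      have hm : 2 * (q * Δ : ℝ) ≤ (q * k : ℕ) * lightMean G Δ := by
        push_cast
        nlinarith
      refine p.prob_false_reject _ (σ := (q * k : ℕ) * (Δ * lightMean G Δ))
        (by positivity) (expect_sum_nat G draw _ _ (expect_weight_ofReal G Δ))
        (expect_sum_nat_sq_le G draw _ _ ha (by positivity)
          (expect_weight_ofReal G Δ) (expect_weight_sq_ofReal G Δ)) hm
          (lt_of_lt_of_le (by positivity) hm) ?_
      rw [div_mul_eq_mul_div, le_div_iff₀ hq', one_mul]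
      set μ := ((q * k : ℕ) : ℝ) * lightMean G Δ with hμ
      have hμ0 : 0 ≤ μ := by positivity
      calc _ = (q * Δ) * μ := by rw [hμ]; ring
        _ ≤ μ * μ := by
            gcongr
            have : (0 : ℝ) < q * Δ := by positivity
            linarith
        _ = _ := (sq μ).symm
    have hB : (p'.prob fun b => ((b.sum : ℕ) : ℝ) < q) ≤ ENNReal.ofReal (4 * 6 / q) := by
      have m1 := expect_sum_nat G (batch k Δ) q id (expect_batch_ofReal G k Δ)
      have m2 := expect_sum_nat_sq_le G (batch k Δ) q id (by positivity) (by positivity)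
        (expect_batch_ofReal G k Δ) (expect_batch_sq_ofReal G k Δ)
      simp only [List.map_id] at m1 m2
      have hm : 2 * (q : ℝ) ≤ q * (k ^ 2 * (lightMean G Δ / G.n)) := by
        rw [← mul_div_assoc, ← mul_div_assoc, le_div_iff₀ hN]
        nlinarith
      refine p'.prob_false_reject List.sum (by positivity) m1 m2 hm
        (lt_of_lt_of_le (by positivity) hm) ?_
      refine variance_batches_le hN ha hq' (by positivity) hΔ' (by nlinarith) ?_ le_rfl
      rw [sq (_ * _)]
      exact mul_le_mul_of_nonneg_right (by linarith) (by positivity)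
    calc _ ≤ p.expect fun l => p'.expect fun b =>
          (if (((l.map (weight Δ)).sum : ℕ) : ℝ) < q * Δ then 1 else 0) +
          (if ((b.sum : ℕ) : ℝ) < q then 1 else 0) := by
          refine PMF.expect_mono fun l => PMF.expect_mono fun b => ?_
          by_cases hl : (((l.map (weight Δ)).sum : ℕ) : ℝ) < q * Δ
          · rw [if_pos hl]
            refine le_add_right ?_
            unfold searchAlgorithm.missing
            split <;> simp
          by_cases hb : ((b.sum : ℕ) : ℝ) < q
          · rw [if_pos hb]
            refine le_add_left ?_
            unfold searchAlgorithm.missing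
            split <;> simp
          refine le_of_eq_of_le ?_ zero_le
          have hl : q * Δ ≤ (l.map (weight Δ)).sum := by exact_mod_cast not_lt.1 hl
          have hb : q ≤ b.sum := by exact_mod_cast not_lt.1 hb
          rw [answer, if_pos (And.intro hl hb)]
          split_ifs <;> rfl
      _ = _ := by
          simp only [PMF.expect_add, PMF.expect_const]
          rfl
      _ ≤ _ := add_le_add hA hB
      _ = _ := by
          rw [← ENNReal.ofReal_add (by positivity) (by positivity)]
          congr 1
          field_simp
          norm_num

end Prog

/-! ### Vertices of large degree are seen early -/

namespace InputGraph

variable (G : InputGraph)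

theorem crossCount_comm (S T : Finset ℕ) : G.crossCount S T = G.crossCount T S := by
  simp only [crossCount]
  rw [Finset.sum_comm]
  simp only [G.adjInd_comm]

/-- The set of vertices of degree more than `t`. -/
noncomputable def heavy (t : ℕ) : Finset ℕ := G.V.filter fun x => t < G.deg x

/-- The set of vertices of degree at most `t`. -/
noncomputable def light (t : ℕ) : Finset ℕ := G.V.filter fun x => ¬ t < G.deg x

theorem sum_light_add_sum_heavy {M : Type*} [AddCommMonoid M] (t : ℕ) (f : ℕ → M) :
    ∑ x ∈ G.heavy t, f x + ∑ x ∈ G.light t, f x = ∑ x ∈ G.V, f x :=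
  Finset.sum_filter_add_sum_filter_not _ _ _

theorem lightPairs_eq (t : ℕ) : G.lightPairs t = G.crossCount (G.light t) (G.light t) := by
  simp only [lightPairs, crossCount, light, Finset.sum_filter, lightInd, not_lt]
  refine Finset.sum_congr rfl fun x _ => ?_
  by_cases h : G.deg x ≤ t <;> simp [h]

theorem two_mul_m_eq (t : ℕ) : 2 * G.m = G.lightPairs t +
    2 * G.crossCount (G.light t) (G.heavy t) + G.crossCount (G.heavy t) (G.heavy t) := by
  have h1 : G.crossCount G.V G.V = G.crossCount (G.heavy t) (G.heavy t) +
      G.crossCount (G.heavy t) (G.light t) + (G.crossCount (G.light t) (G.heavy t) +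
      G.crossCount (G.light t) (G.light t)) := by
    simp only [crossCount, ← G.sum_light_add_sum_heavy t, Finset.sum_add_distrib]
  rw [m, two_mul_card_edgesIn, h1, lightPairs_eq, G.crossCount_comm (G.heavy t) (G.light t)]
  ring

theorem two_mul_m_eq_sum_deg : 2 * G.m = ∑ x ∈ G.V, G.deg x := by
  rw [m, two_mul_card_edgesIn, crossCount]
  simp only [sum_adjInd]

theorem crossCount_le (S T : Finset ℕ) : G.crossCount S T ≤ S.card * T.card := by
  rw [crossCount, ← smul_eq_mul, ← Finset.sum_const]
  refine Finset.sum_le_sum fun x _ => ?_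
  rw [Finset.card_eq_sum_ones]
  refine Finset.sum_le_sum fun y _ => ?_
  rw [adjInd]
  split_ifs <;> simp

theorem n_le_two_mul_m : G.n ≤ 2 * G.m := by
  rw [two_mul_m_eq_sum_deg, n, Finset.card_eq_sum_ones]
  exact Finset.sum_le_sum fun x hx => G.deg_pos hx

theorem m_pos : 0 < G.m := by
  have := G.n_le_two_mul_m
  have := G.n_pos
  lia

theorem lightPairs_mono {s t : ℕ} (h : s ≤ t) : G.lightPairs s ≤ G.lightPairs t := by
  refine Finset.sum_le_sum fun x _ => Finset.sum_le_sum fun y _ => ?_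
  rw [lightInd, lightInd]
  split_ifs with h1 h2
  · exact le_rfl
  · exact absurd ⟨h1.1.trans h, h1.2.trans h⟩ h2
  · exact Nat.zero_le _
  · exact le_rfl

theorem lightPairs_zero : G.lightPairs 0 = 0 := by
  refine Finset.sum_eq_zero fun x hx => Finset.sum_eq_zero fun y _ => ?_
  have := G.deg_pos hx
  rw [lightInd, if_neg (by lia)]

/-- The sum over all vertices of the fraction of its neighbours that witness a degree above `t`. -/
noncomputable def witnessSum (t : ℕ) : ℝ :=
  ∑ v ∈ G.V, (G.deg v : ℝ)⁻¹ * ∑ w ∈ G.nbrs v, if t < G.deg v ∨ t < G.deg w then 1 else 0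

/-- A heavy vertex is its own witness, so all of its neighbours count and it contributes `1`. -/
theorem card_heavy_le_witnessSum (t : ℕ) : ((G.heavy t).card : ℝ) ≤ G.witnessSum t := by
  rw [witnessSum, ← G.sum_light_add_sum_heavy t, Finset.card_eq_sum_ones, Nat.cast_sum]
  refine le_add_of_le_of_nonneg (Finset.sum_le_sum fun v hv => ?_) (by positivity)
  have hv := Finset.mem_filter.1 hv
  have : (0 : ℝ) < G.deg v := by exact_mod_cast G.deg_pos hv.1
  simp only [hv.2, true_or, if_true, Finset.sum_const, nsmul_eq_mul, mul_one]
  rw [deg] at this ⊢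
  rw [inv_mul_cancel₀ this.ne', Nat.cast_one]

/-- A light `v` contributes its number of heavy neighbours divided by `deg v ≤ u`. This is the role
of the random neighbour in a sample: a few vertices of huge degree are rarely drawn directly, but
they are reached from the vertices around them. -/
theorem crossCount_le_witnessSum {t : ℕ} {u : ℝ} (ht : t ≤ u) :
    (G.crossCount (G.light t) (G.heavy t) : ℝ) ≤ u * G.witnessSum t := by
  rw [witnessSum, ← G.sum_light_add_sum_heavy t, mul_add, crossCount, Nat.cast_sum,
    Finset.mul_sum (G.light t)]
  have hu : 0 ≤ u := le_trans (by positivity) ht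
  refine le_add_of_nonneg_of_le (by positivity) (Finset.sum_le_sum fun v hv => ?_)
  have hv := Finset.mem_filter.1 hv
  have h0 : (0 : ℝ) < G.deg v := by exact_mod_cast G.deg_pos hv.1
  have h1 : (G.deg v : ℝ) ≤ u := le_trans (by exact_mod_cast not_lt.1 hv.2) ht
  have h2 : ((∑ y ∈ G.heavy t, G.adjInd v y : ℕ) : ℝ) =
      ∑ w ∈ G.nbrs v, if t < G.deg v ∨ t < G.deg w then 1 else 0 := by
    classical
    simp only [hv.2, false_or, heavy, nbrs, Finset.sum_filter, Nat.cast_sum, adjInd]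
    refine Finset.sum_congr rfl fun y _ => ?_
    split_ifs <;> simp
  rw [h2, ← mul_assoc]
  refine le_mul_of_one_le_left (by positivity) ?_
  rw [← div_eq_mul_inv, one_le_div h0]
  exact h1

/-- Let `S = √(2m)` and let `W` be the witness sum. If less than half of the ordered adjacent pairs
are light, the other pairs give `S²/2 < 2SW + W²`, which fails for `W < S/8`. -/
theorem sqrt_le_witnessSum {t : ℕ} (ht : (t : ℝ) ≤ √(2 * G.m))
    (h : (G.lightPairs t : ℝ) < 2 * G.m / 2) : √(2 * G.m) / 8 ≤ G.witnessSum t := by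
  have h1 := G.card_heavy_le_witnessSum t
  have h2 := G.crossCount_le_witnessSum ht
  have h3 : (2 * G.m : ℝ) = G.lightPairs t + 2 * G.crossCount (G.light t) (G.heavy t) +
      G.crossCount (G.heavy t) (G.heavy t) := by exact_mod_cast G.two_mul_m_eq t
  have h4 : (G.crossCount (G.heavy t) (G.heavy t) : ℝ) ≤ (G.heavy t).card * (G.heavy t).card := by
    exact_mod_cast G.crossCount_le _ _
  have h5 : ((G.heavy t).card : ℝ) * (G.heavy t).card ≤ G.witnessSum t * G.witnessSum t := by
    exact mul_self_le_mul_self (by positivity) h1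
  have h6 : √(2 * G.m) * √(2 * G.m) = 2 * G.m := Real.mul_self_sqrt (by positivity)
  have h7 : (0 : ℝ) < G.m := by
    exact_mod_cast G.m_pos
  have h8 : 0 < √(2 * G.m) := Real.sqrt_pos.2 (by positivity)
  have h9 : 0 ≤ G.witnessSum t := le_trans (by positivity) h1
  by_contra! hlt
  nlinarith

end InputGraph

namespace Prog

open Sample

variable (G : InputGraph)

theorem prob_draw_witness (t : ℕ) :
    ((draw.law G).prob fun r => t < r.dv ∨ t < r.dw) = ENNReal.ofReal (G.witnessSum t / G.n) := by
  classical
  rw [PMF.prob, expect_draw, ofReal_div_n, InputGraph.witnessSum,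
    ENNReal.ofReal_sum_of_nonneg fun _ _ => by positivity]
  congr 1
  refine Finset.sum_congr rfl fun v hv => ?_
  have h0 : (0 : ℝ) < G.deg v := by exact_mod_cast G.deg_pos hv
  rw [ENNReal.ofReal_mul (by positivity), ENNReal.ofReal_inv_of_pos h0, ENNReal.ofReal_natCast,
    ENNReal.ofReal_sum_of_nonneg fun _ _ => by positivity]
  congr 1
  refine Finset.sum_congr rfl fun w _ => ?_
  split_ifs <;> simp

theorem _root_.PMF.prob_not {α : Type*} (p : PMF α) (E : α → Prop) :
    p.prob (fun a => ¬ E a) = 1 - p.prob E := by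
  classical
  have h : p.prob (fun a => ¬ E a) + p.prob E = 1 := by
    rw [PMF.prob, PMF.prob, ← PMF.expect_add]
    refine Eq.trans ?_ (PMF.expect_const p 1)
    congr 1
    funext a
    by_cases h : E a <;> simp [h]
  rw [← h, ENNReal.add_sub_cancel_right]
  exact ((PMF.prob_le_one p E).trans_lt ENNReal.one_lt_top).ne

/-- The degree `Δ` is at least the square root of twice the number of edges, or at least half of the
edges join vertices of degree at most `Δ`. -/
def Adequate (Δ : ℕ) : Prop := √(2 * G.m) ≤ Δ ∨ 2 * G.m / 2 ≤ (G.lightPairs Δ : ℝ)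

/-- Take `t` just below the least adequate degree. Adequacy is monotone, so any degree above `t`
will do, and its failure at `t` makes such degrees easy to find. -/
theorem exists_witness_of_adequate :
    ∃ t : ℕ, (∀ Δ, t < Δ → Adequate G Δ) ∧ √(2 * G.m) / 8 ≤ G.witnessSum t := by
  classical
  have hm : (0 : ℝ) < G.m := by exact_mod_cast G.m_pos
  have hex : ∃ Δ : ℕ, Adequate G Δ := (exists_nat_ge (√(2 * G.m))).imp fun Δ h => .inl h
  have h0 : Nat.find hex ≠ 0 := by
    intro h
    have := Nat.find_spec hex
    rw [h, Adequate, G.lightPairs_zero, Nat.cast_zero] at this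
    rcases this with h | h
    · exact absurd h (not_le.2 (Real.sqrt_pos.2 (by positivity)))
    · linarith
  obtain ⟨t, ht⟩ := Nat.exists_eq_succ_of_ne_zero h0
  refine ⟨t, fun Δ hΔ => ?_, ?_⟩
  · have h1 : Nat.find hex ≤ Δ := by lia
    refine (Nat.find_spec hex).imp (fun h => h.trans (by exact_mod_cast h1)) fun h => h.trans ?_
    exact_mod_cast G.lightPairs_mono h1
  · have h1 : ¬ Adequate G t := Nat.find_min hex (by lia)
    rw [Adequate, not_or, not_le, not_le] at h1
    exact G.sqrt_le_witnessSum h1.1.le h1.2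

/-- A sample reveals a degree above `t` with probability `x ≥ √(2m)/(8n)`, so `kx ≥ 8000/8 = 1000`
and all `k` samples miss with probability at most `exp(-kx)`. -/
theorem prob_not_adequate_le {k : ℕ} (hk : 8000 * (G.n : ℝ) ≤ k * √(2 * G.m)) :
    (((draw.replicate k).law G).prob fun l => ¬ Adequate G (best l).2) ≤
      ENNReal.ofReal (1 / 1000) := by
  obtain ⟨t, ht, hw⟩ := exists_witness_of_adequate G
  have hN : (0 : ℝ) < G.n := by exact_mod_cast G.n_pos
  set x := G.witnessSum t / G.n with hx
  have hx0 : 0 ≤ x := div_nonneg (le_trans (by positivity) hw) hN.le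
  have hkx : 1000 ≤ k * x := by
    rw [hx, ← mul_div_assoc, le_div_iff₀ hN]
    nlinarith
  calc _ ≤ ((draw.replicate k).law G).prob fun l => ∀ r ∈ l, ¬ (t < r.dv ∨ t < r.dw) := by
        refine PMF.prob_mono fun l hl r hr h => hl (ht _ ?_)
        have := le_best r hr
        lia
    _ = (1 - ENNReal.ofReal x) ^ k := by
        rw [prob_forall_not_replicate, PMF.prob_not, prob_draw_witness]
    _ ≤ ENNReal.ofReal (Real.exp (-x)) ^ k := by
        gcongr
        rw [← ENNReal.ofReal_one, ← ENNReal.ofReal_sub _ hx0]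
        exact ENNReal.ofReal_le_ofReal (by linarith [Real.add_one_le_exp (-x)])
    _ = ENNReal.ofReal (Real.exp (-(k * x))) := by
        rw [← ENNReal.ofReal_pow (Real.exp_pos _).le, ← Real.exp_nat_mul]
        ring_nf
    _ ≤ _ := by
        refine ENNReal.ofReal_le_ofReal ?_
        rw [Real.exp_neg, one_div]
        refine inv_anti₀ (by norm_num) ?_
        linarith [Real.add_one_le_exp (k * x)]

end Prog

namespace InputGraph

variable (G : InputGraph)

theorem two_le_n : 2 ≤ G.n := by
  obtain ⟨x, hx⟩ := G.nonempty
  obtain ⟨y, hy⟩ := G.no_isolated x hx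
  exact Finset.one_lt_card.2 ⟨x, hx, y, G.mem_of_adj y x hy.symm, hy.ne⟩

theorem two_mul_m_le : 2 * G.m ≤ G.n ^ 2 := by
  rw [m, two_mul_card_edgesIn, sq]
  exact G.crossCount_le _ _

theorem sqrt_n_div_avgDeg : √(G.n / G.avgDeg) = G.n / √(2 * G.m) := by
  have : (G.n : ℝ) / G.avgDeg = (G.n : ℝ) ^ 2 / (2 * G.m) := by
    rw [avgDeg, div_div_eq_mul_div, sq]
  rw [this, Real.sqrt_div (by positivity), Real.sqrt_sq (by positivity)]

end InputGraph

/-! ### Correctness and cost of a single level -/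

namespace Prog

open Sample

variable (G : InputGraph)

/-- The vertex `w` depends only on the first `k` draws and the stage makes fresh ones, so bounds for
a fixed `w` apply conditionally. -/
theorem expect_level_le {k q : ℕ} (hk : 0 < k) (F : Option ℝ → ℝ≥0∞) (E : ℕ → Prop) (c : ℝ≥0∞)
    (hF : ∀ o, F o ≤ 1)
    (h : ∀ w ∈ G.V, E (G.deg w) → ((stage k q w (G.deg w)).law G).expect F ≤ c) :
    ((level k q).law G).expect F ≤
      (((draw.replicate k).law G).prob fun l => ¬ E (best l).2) + c := by
  rw [level, law_bind, PMF.expect_bind]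
  refine PMF.expect_le_prob_add (fun l _ => PMF.expect_le_of_le hF) fun l hl hE => ?_
  obtain ⟨hlen, hl⟩ := valid_of_mem_support_replicate_draw G k l hl
  obtain ⟨h1, h2⟩ := best_valid hl (List.ne_nil_of_length_pos (by lia))
  rw [not_not] at hE
  rw [h2] at hE ⊢
  exact h _ h1 hE

/-- With few exceptions a level does not return a bad approximation of the number of vertices. -/
theorem expect_wrong_level_le {k q : ℕ} {ε : ℝ} (hε : 0 < ε) (hε' : ε < 1) (hk : 0 < k)
    (hq : 0 < q) :
    ((level k q).law G).expect (searchAlgorithm.wrong fun v => |v - G.n| ≤ ε * G.n) ≤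
      ENNReal.ofReal (512 / (ε ^ 2 * q)) := by
  refine (expect_level_le G hk _ (fun _ => True) _ ?_
    fun w hw _ => expect_wrong_stage_le hε hε' hq hw rfl).trans_eq ?_
  · intro o
    unfold searchAlgorithm.wrong
    split <;> (try split_ifs) <;> simp
  · simp [PMF.prob, PMF.expect_const]

/-- A level is likely to return an answer if `k` is large enough. -/
theorem expect_missing_level_le {k q : ℕ} (hk : 8000 * (G.n : ℝ) ≤ k * √(2 * G.m)) (hq : 0 < q) :
    ((level k q).law G).expect searchAlgorithm.missing ≤
      ENNReal.ofReal (1 / 1000) + ENNReal.ofReal (28 / q) := by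
  have hN : (0 : ℝ) < G.n := by exact_mod_cast G.n_pos
  have hm : (0 : ℝ) < G.m := by exact_mod_cast G.m_pos
  have hs : 0 < √(2 * G.m) := Real.sqrt_pos.2 (by positivity)
  have hss : √(2 * G.m) * √(2 * G.m) = 2 * G.m := Real.mul_self_sqrt (by positivity)
  have hk0 : 0 < k := by
    rcases Nat.eq_zero_or_pos k with rfl | h
    · rw [Nat.cast_zero, zero_mul] at hk
      linarith
    · exact h
  have hk0' : (0 : ℝ) < k := by exact_mod_cast hk0
  refine (expect_level_le G hk0 _ (Adequate G) (ENNReal.ofReal (28 / q)) ?_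
    fun w hw hE => expect_missing_stage_le hq hw rfl ?_).trans
      (add_le_add_left (prob_not_adequate_le G hk) _)
  · intro o
    unfold searchAlgorithm.missing
    split <;> simp
  -- With `S = √(2m)`: if `Δ ≥ S`, then `kΔ ≥ kS ≥ 2n`. Otherwise adequacy gives `lightMean ≥
  -- S²/(2n)`, and `kS ≥ 8000n` yields both inequalities for the second estimator.
  · rcases le_or_gt √(2 * G.m) (G.deg w) with h | h
    · left
      calc 2 * (G.n : ℝ) ≤ k * √(2 * G.m) := by linarith
        _ ≤ _ := by gcongr
    · right
      have hl := hE.resolve_left (not_le.2 h)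
      have h1 : √(2 * G.m) * √(2 * G.m) / (2 * G.n) ≤ lightMean G (G.deg w) := by
        rw [hss, lightMean, div_le_div_iff₀ (by positivity) hN]
        nlinarith
      constructor
      · calc 2 * (G.deg w : ℝ) ≤ 2 * √(2 * G.m) := by linarith
          _ ≤ k * (√(2 * G.m) * √(2 * G.m) / (2 * G.n)) := by
            rw [← mul_div_assoc, le_div_iff₀ (by positivity)]
            nlinarith
          _ ≤ _ := by gcongr
      · calc 2 * (G.n : ℝ) ≤ k ^ 2 * (√(2 * G.m) * √(2 * G.m) / (2 * G.n)) := by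
              rw [← mul_div_assoc, le_div_iff₀ (by positivity)]
              have : (2 * (G.n : ℝ)) ^ 2 ≤ (k * √(2 * G.m)) ^ 2 :=
                pow_le_pow_left₀ (by positivity) (by linarith) 2
              nlinarith
          _ ≤ _ := by gcongr

/-- Here `21 = 4 + 4 + 1 + 12` accounts for the draws that find `w`, the draws of the stage, the
pair queries, and the batches without repetitions. -/
theorem meanCost_level_le {k q : ℕ} (hk : 0 < k) (hq : 0 < q) :
    (level k q).meanCost G ≤ q * k * (21 + 4 * (k ^ 2 * (G.n : ℝ≥0∞)⁻¹)) := by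
  have h (w Δ : ℕ) (hw : w ∈ G.V) :
      (stage k q w Δ).meanCost G ≤ q * k * (17 + 4 * (k ^ 2 * (G.n : ℝ≥0∞)⁻¹)) := by
    rw [stage, meanCost_bind, meanCost_replicate, meanCost_draw]
    calc _ ≤ ((q * k : ℕ) : ℝ≥0∞) * 4 + ((draw.replicate (q * k)).law G).expect fun l =>
          (q * k : ℕ) + q * (12 * k + 4 * k * (k ^ 2 * (G.n : ℝ≥0∞)⁻¹)) := by
          gcongr
          refine PMF.expect_mono_support fun l hl => ?_
          obtain ⟨hlen, hl⟩ := valid_of_mem_support_replicate_draw G _ l hl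
          have hc := returns_countAdj (l := l.map Sample.v) hw fun x hx => by
            obtain ⟨r, hr, rfl⟩ := List.mem_map.1 hx
            exact (hl r hr).1
          rw [meanCost_bind, hc.meanCost, hc.law, PMF.expect_pure, List.length_map, hlen,
            meanCost_bind, meanCost_replicate]
          simp only [meanCost_ret, PMF.expect_const, add_zero]
          gcongr
          exact meanCost_batch_le G k Δ
      _ = _ := by
          rw [PMF.expect_const]
          push_cast
          ring
  rw [level, meanCost_bind, meanCost_replicate, meanCost_draw]
  calc _ ≤ (k : ℝ≥0∞) * 4 + ((draw.replicate k).law G).expect fun l =>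
        q * k * (17 + 4 * (k ^ 2 * (G.n : ℝ≥0∞)⁻¹)) := by
        gcongr
        refine PMF.expect_mono_support fun l hl => ?_
        obtain ⟨hlen, hl⟩ := valid_of_mem_support_replicate_draw G _ l hl
        exact h _ _ (best_valid hl (List.ne_nil_of_length_pos (by lia))).1
    _ ≤ q * k * 4 + q * k * (17 + 4 * (k ^ 2 * (G.n : ℝ≥0∞)⁻¹)) := by
        rw [PMF.expect_const]
        gcongr
        exact le_mul_of_one_le_left (by simp) (by exact_mod_cast hq)
    _ = _ := by ring

end Prog

/-! ### The upper bound -/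

/-- The number of repetitions in the `i`-th level. -/
noncomputable def repetitions (ε : ℝ) (i : ℕ) : ℕ := 512000 * ⌈ε⁻¹ ^ 2⌉₊ * ((i + 1) * (i + 2))

theorem repetitions_pos {ε : ℝ} (hε : 0 < ε) (i : ℕ) : 0 < repetitions ε i := by
  have : 0 < ⌈ε⁻¹ ^ 2⌉₊ := Nat.ceil_pos.2 (by positivity)
  unfold repetitions
  positivity

theorem repetitions_mono (ε : ℝ) {i j : ℕ} (h : i ≤ j) : repetitions ε i ≤ repetitions ε j := by
  unfold repetitions
  gcongr

/-- This turns the error bound `512/(ε²q)` of a level into `1/(1000(i+1)(i+2))`, whose sum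
telescopes. -/
theorem le_repetitions {ε : ℝ} (hε : 0 < ε) (i : ℕ) :
    512000 * ((i + 1) * (i + 2)) ≤ ε ^ 2 * repetitions ε i := by
  have h : ε⁻¹ ^ 2 ≤ ⌈ε⁻¹ ^ 2⌉₊ := Nat.le_ceil _
  have h2 : ε ^ 2 * ε⁻¹ ^ 2 = 1 := by field_simp
  unfold repetitions
  push_cast
  calc _ = 512000 * (((i : ℝ) + 1) * (i + 2)) * (ε ^ 2 * ε⁻¹ ^ 2) := by rw [h2, mul_one]
    _ ≤ 512000 * (((i : ℝ) + 1) * (i + 2)) * (ε ^ 2 * ⌈ε⁻¹ ^ 2⌉₊) := by gcongr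
    _ = _ := by ring

theorem repetitions_le {ε : ℝ} (hε : 0 < ε) (hε' : ε < 1) (i : ℕ) :
    (repetitions ε i : ℝ) ≤ 1024000 * ε⁻¹ ^ 2 * ((i + 1) * (i + 2)) := by
  have h1 : 1 ≤ ε⁻¹ ^ 2 := one_le_pow₀ ((one_le_inv₀ hε).2 hε'.le)
  have h : (⌈ε⁻¹ ^ 2⌉₊ : ℝ) ≤ 2 * ε⁻¹ ^ 2 := by
    have := Nat.ceil_lt_add_one (a := ε⁻¹ ^ 2) (by positivity)
    linarith
  unfold repetitions
  push_cast
  calc _ ≤ 512000 * (2 * ε⁻¹ ^ 2) * (((i : ℝ) + 1) * (i + 2)) := by gcongr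
    _ = _ := by ring

theorem sum_inv_mul_le (N : ℕ) :
    ∑ i ∈ Finset.range N, 1 / (((i : ℝ) + 1) * (i + 2)) = 1 - 1 / (N + 1) := by
  induction N with
  | zero => simp
  | succ N ih =>
    rw [Finset.sum_range_succ, ih]
    push_cast
    field_simp
    ring

/-- The levels of the doubling search. -/
noncomputable def searchLevels (ε : ℝ) (i : ℕ) :
    {p : Prog (Option ℝ) // p.AllQueries Query.IsAdvanced} :=
  ⟨Prog.level (2 ^ i) (repetitions ε i), Prog.allQueries_level _ _⟩

/-- The least power of two above `8000n/√(2m)` overshoots by a factor of at most two; for `i = 0`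
the upper bound follows from `n/√(2m) ≥ 1`. -/
theorem exists_level (G : InputGraph) : ∃ i : ℕ, 8000 * (G.n : ℝ) ≤ (2 ^ i : ℕ) * √(2 * G.m) ∧
    (2 : ℝ) ^ i ≤ 16000 * (G.n / √(2 * G.m)) := by
  have hm : (0 : ℝ) < G.m := by exact_mod_cast G.m_pos
  have hN : (0 : ℝ) < G.n := by exact_mod_cast G.n_pos
  have hs : 0 < √(2 * G.m) := Real.sqrt_pos.2 (by positivity)
  have hle : √(2 * G.m) ≤ G.n := Real.sqrt_le_iff.2 ⟨hN.le, by exact_mod_cast G.two_mul_m_le⟩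
  have hR : 1 ≤ G.n / √(2 * G.m) := (one_le_div hs).2 hle
  have hex : ∃ i : ℕ, 8000 * (G.n / √(2 * G.m)) ≤ (2 : ℝ) ^ i :=
    (pow_unbounded_of_one_lt _ one_lt_two).imp fun i h => h.le
  obtain ⟨i, h, hmin⟩ : ∃ i : ℕ, 8000 * (G.n / √(2 * G.m)) ≤ (2 : ℝ) ^ i ∧
      ∀ j < i, ¬ 8000 * (G.n / √(2 * G.m)) ≤ (2 : ℝ) ^ j := by
    classical
    exact ⟨Nat.find hex, Nat.find_spec hex, fun j hj => Nat.find_min hex hj⟩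
  refine ⟨i, ?_, ?_⟩
  · rw [← mul_div_assoc, div_le_iff₀ hs] at h
    exact_mod_cast h
  · rcases i with _ | i
    · rw [pow_zero]
      linarith
    · have := hmin i (by lia)
      rw [not_le] at this
      rw [pow_succ]
      linarith

/-- As `16000 ≤ 2^14`, the index is at most `14 + log₂ n`; then `17 / log 2 < 25`. -/
theorem level_index_le {n i : ℕ} (hn : 2 ≤ n) (h : (2 : ℝ) ^ i ≤ 16000 * n) :
    (i : ℝ) + 2 ≤ 25 * Real.log n := by
  have hn' : (2 : ℝ) ≤ n := by exact_mod_cast hn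
  have hl2 := Real.log_two_gt_d9
  have h1 : Real.log 2 ≤ Real.log n := Real.log_le_log (by norm_num) hn'
  have h2 : i * Real.log 2 ≤ 14 * Real.log 2 + Real.log n := by
    rw [← Real.log_pow, show (14 : ℝ) = (14 : ℕ) by norm_num, ← Real.log_pow,
      ← Real.log_mul (by norm_num) (by positivity)]
    refine Real.log_le_log (by positivity) (h.trans ?_)
    gcongr
    norm_num
  nlinarith

/-- Without isolated vertices `n ≤ 2m`, so `k = 2^i` satisfies `k²/n ≤ 16000² = 256000000` and
repeated samples cost only a constant factor. The constant is `21 + 4·256000000 + 1`, the last `1`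
covering the dummy query. -/
theorem meanCost_searchLevels_le {G : InputGraph} {ε : ℝ} (hε : 0 < ε) {i : ℕ}
    (hi : (2 : ℝ) ^ i ≤ 16000 * (G.n / √(2 * G.m))) :
    (searchLevels ε i).1.meanCost G + 1 ≤
      ENNReal.ofReal (1024000022 * repetitions ε i * 2 ^ i) := by
  have hm : (0 : ℝ) < G.m := by exact_mod_cast G.m_pos
  have hN : (0 : ℝ) < G.n := by exact_mod_cast G.n_pos
  have hsq : ((2 ^ i : ℕ) : ℝ) ^ 2 * (G.n : ℝ)⁻¹ ≤ 256000000 := by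
    have h1 : ((2 : ℝ) ^ i) ^ 2 ≤ (16000 * (G.n / √(2 * G.m))) ^ 2 :=
      pow_le_pow_left₀ (by positivity) hi 2
    rw [mul_pow, div_pow, Real.sq_sqrt (by positivity)] at h1
    have h2 : (G.n : ℝ) ≤ 2 * G.m := by exact_mod_cast G.n_le_two_mul_m
    rw [← div_eq_mul_inv, div_le_iff₀ hN]
    push_cast
    refine h1.trans ?_
    rw [← mul_div_assoc, div_le_iff₀ (by positivity)]
    nlinarith
  have hq := repetitions_pos hε i
  have hsq' : ((2 ^ i : ℕ) : ℝ≥0∞) ^ 2 * (G.n : ℝ≥0∞)⁻¹ ≤ 256000000 := by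
    have := ENNReal.ofReal_le_ofReal hsq
    rw [ENNReal.ofReal_mul (by positivity), ENNReal.ofReal_pow (by positivity),
      ENNReal.ofReal_inv_of_pos hN, ENNReal.ofReal_natCast, ENNReal.ofReal_natCast] at this
    refine this.trans_eq ?_
    norm_num
  calc _ ≤ (repetitions ε i : ℝ≥0∞) * (2 ^ i : ℕ) * (21 + 4 * 256000000) +
        (repetitions ε i : ℝ≥0∞) * (2 ^ i : ℕ) := by
        refine add_le_add ((Prog.meanCost_level_le G (by positivity) hq).trans ?_) ?_
        · gcongr
        · exact_mod_cast Nat.mul_pos hq (by positivity)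
    _ = ((1024000022 * repetitions ε i * 2 ^ i : ℕ) : ℝ≥0∞) := by
        push_cast
        ring
    _ = _ := by
        rw [← ENNReal.ofReal_natCast]
        push_cast
        rfl

theorem sum_repetitions_le (ε : ℝ) (i : ℕ) :
    ∑ j ∈ Finset.range (i + 1), (repetitions ε j : ℝ) * 2 ^ j ≤ 2 * (repetitions ε i * 2 ^ i) := by
  have h : ∑ j ∈ Finset.range (i + 1), (2 : ℝ) ^ j ≤ 2 * 2 ^ i := by
    rw [geom_sum_eq (by norm_num), pow_succ]
    norm_num
    linarith
  calc _ ≤ ∑ j ∈ Finset.range (i + 1), (repetitions ε i : ℝ) * 2 ^ j := by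
        refine Finset.sum_le_sum fun j hj => ?_
        gcongr
        exact_mod_cast repetitions_mono ε (Nat.lt_succ_iff.1 (Finset.mem_range.1 hj))
    _ = repetitions ε i * ∑ j ∈ Finset.range (i + 1), (2 : ℝ) ^ j := by rw [Finset.mul_sum]
    _ ≤ repetitions ε i * (2 * 2 ^ i) := by gcongr
    _ = _ := by ring

/-- The number of vertices can be approximated in the advanced model. -/
theorem exists_approximation_algorithm : ∃ (C : ℝ) (j : ℕ), ∀ ε : ℝ, 0 < ε → ε < 1 →
    ∃ A : Algorithm, A.IsAdvanced ∧ ∀ G : InputGraph,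
      99 / 100 < A.probHalt G (fun nhat cost =>
        |nhat - G.n| ≤ ε * G.n ∧
        (cost : ℝ) ≤ C * (ε⁻¹ ^ 2 * √(G.n / G.avgDeg)) * Real.log G.n ^ j) := by
  -- In order, the factors come from Markov's inequality, the cost of a level, the geometric sum
  -- over levels, the repetitions, the last level, and `(i+1)(i+2) ≤ 625 log² n`.
  refine ⟨1000 * 1024000022 * 2 * 1024000 * 16000 * 625, 2, fun ε hε hε' =>
    ⟨searchAlgorithm (searchLevels ε), searchAlgorithm.isAdvanced _, fun G => ?_⟩⟩
  have hN : (0 : ℝ) < G.n := by exact_mod_cast G.n_pos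
  have hN2 : (2 : ℝ) ≤ G.n := by exact_mod_cast G.two_le_n
  have hm : (0 : ℝ) < G.m := by exact_mod_cast G.m_pos
  have hs : 1 ≤ √(2 * G.m) := by
    rw [Real.one_le_sqrt]
    have : (1 : ℝ) ≤ G.m := by exact_mod_cast G.m_pos
    linarith
  have hlog : 0 < Real.log G.n := Real.log_pos (by linarith)
  rw [G.sqrt_n_div_avgDeg]
  set R := G.n / √(2 * G.m) with hR
  have hR0 : 0 < R := by positivity
  set b := 1000 * 1024000022 * 2 * 1024000 * 16000 * 625 * (ε⁻¹ ^ 2 * R) * Real.log G.n ^ 2 with hb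
  have hb0 : 0 < b := by positivity
  obtain ⟨i, hi1, hi2⟩ := exists_level G
  rw [← hR] at hi2
  have hRN : R ≤ G.n := div_le_self hN.le hs
  have hlogi := level_index_le G.two_le_n (hi2.trans (by gcongr))
  have hq := repetitions_pos hε
  have main := searchAlgorithm.one_le_successProb (searchLevels ε) G (fun v => |v - G.n| ≤ ε * G.n)
    (ENNReal.ofReal b) (by simpa using hb0) ENNReal.ofReal_ne_top i 0 0
  rw [← searchAlgorithm.probHalt_eq] at main
  have e : (fun (v : ℝ) (c : ℕ) => |v - G.n| ≤ ε * G.n ∧ (c : ℝ≥0∞) ≤ ENNReal.ofReal b) =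
      fun (v : ℝ) (c : ℕ) => |v - G.n| ≤ ε * G.n ∧ (c : ℝ) ≤ b := by
    funext v c
    rw [← ENNReal.ofReal_natCast, ENNReal.ofReal_le_ofReal_iff hb0.le]
  rw [e] at main
  simp only [zero_add, Nat.cast_zero, ENNReal.zero_div, add_zero] at main
  rw [Finset.sum_add_distrib] at main
  have hwrong : ∑ j ∈ Finset.range (i + 1), ((searchLevels ε j).1.law G).expect
      (searchAlgorithm.wrong fun v => |v - G.n| ≤ ε * G.n) ≤ ENNReal.ofReal (1 / 1000) := by
    calc _ ≤ ∑ j ∈ Finset.range (i + 1),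
          ENNReal.ofReal (1 / 1000 * (1 / (((j : ℝ) + 1) * (j + 2)))) := by
          refine Finset.sum_le_sum fun j _ =>
            (Prog.expect_wrong_level_le G hε hε' (by positivity) (hq j)).trans
              (ENNReal.ofReal_le_ofReal ?_)
          have h1 := le_repetitions hε j
          have h2 : (0 : ℝ) < repetitions ε j := by exact_mod_cast hq j
          rw [← mul_div_assoc, mul_one, div_div, div_le_div_iff₀ (by positivity) (by positivity)]
          linarith
      _ ≤ _ := by
          rw [← ENNReal.ofReal_sum_of_nonneg fun _ _ => by positivity, ← Finset.mul_sum,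
            sum_inv_mul_le]
          refine ENNReal.ofReal_le_ofReal ?_
          have : (0 : ℝ) ≤ 1 / ((i + 1 : ℕ) + 1) := by positivity
          linarith
  have hcost : ∑ j ∈ Finset.range (i + 1), ((searchLevels ε j).1.meanCost G + 1) /
      ENNReal.ofReal b ≤ ENNReal.ofReal (1 / 1000) := by
    calc _ ≤ ∑ j ∈ Finset.range (i + 1),
          ENNReal.ofReal (1024000022 * repetitions ε j * 2 ^ j) / ENNReal.ofReal b := by
          refine Finset.sum_le_sum fun j hj => ?_
          gcongr
          refine meanCost_searchLevels_le hε (le_trans ?_ hi2)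
          exact pow_le_pow_right₀ one_le_two (Nat.lt_succ_iff.1 (Finset.mem_range.1 hj))
      _ ≤ _ := by
          simp only [← ENNReal.ofReal_div_of_pos hb0]
          rw [← ENNReal.ofReal_sum_of_nonneg fun _ _ => by positivity]
          refine ENNReal.ofReal_le_ofReal ?_
          rw [← Finset.sum_div, div_le_div_iff₀ hb0 (by norm_num), one_mul]
          simp only [mul_assoc (1024000022 : ℝ)]
          rw [← Finset.mul_sum]
          have h1 := sum_repetitions_le ε i
          have h2 : ((i : ℝ) + 1) * (i + 2) ≤ 625 * Real.log G.n ^ 2 := by nlinarith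
          have h3 : (repetitions ε i : ℝ) * 2 ^ i ≤
              1024000 * ε⁻¹ ^ 2 * (625 * Real.log G.n ^ 2) * (16000 * R) := by
            refine mul_le_mul ((repetitions_le hε hε' i).trans ?_) hi2 (by positivity)
              (by positivity)
            gcongr
          rw [hb]
          linarith
  have hmiss : ((searchLevels ε i).1.law G).expect searchAlgorithm.missing ≤
      ENNReal.ofReal (1 / 1000) + ENNReal.ofReal (1 / 1000) := by
    refine (Prog.expect_missing_level_le G hi1 (hq i)).trans ?_
    refine add_le_add le_rfl (ENNReal.ofReal_le_ofReal ?_)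
    have h1 : 512000 ≤ repetitions ε i := by
      have : 0 < ⌈ε⁻¹ ^ 2⌉₊ := Nat.ceil_pos.2 (by positivity)
      unfold repetitions
      have : 0 < ⌈ε⁻¹ ^ 2⌉₊ * ((i + 1) * (i + 2)) := by positivity
      lia
    have h2 : (512000 : ℝ) ≤ repetitions ε i := by exact_mod_cast h1
    rw [div_le_div_iff₀ (by positivity) (by norm_num)]
    linarith
  -- The failures are `1/1000` for wrong answers, `1/1000` for the cost and `2/1000` for no answer
  -- up to level `i`, less than `1/100` in total.
  by_contra! hcon
  have h99 : (99 / 100 : ℝ≥0∞) = ENNReal.ofReal (99 / 100) := by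
    rw [ENNReal.ofReal_div_of_pos (by norm_num)]
    norm_num
  rw [h99] at hcon
  have := main.trans (add_le_add (add_le_add hcon (add_le_add hwrong hcost)) hmiss)
  rw [← ENNReal.ofReal_add (by norm_num) (by norm_num),
    ← ENNReal.ofReal_add (by norm_num) (by norm_num),
    ← ENNReal.ofReal_add (by norm_num) (by norm_num), ← ENNReal.ofReal_one,
    ENNReal.ofReal_le_ofReal_iff (by norm_num)] at this
  norm_num at this

/-! ### Hard instances: a hidden core and a random matching -/

/-- The labels of the pairs of vertices with indices in `I`. -/
def pairLabels (I : Finset ℕ) : Finset ℕ := I.biUnion fun i => {3 * i, 3 * i + 1}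

theorem mem_pairLabels {I : Finset ℕ} {x : ℕ} : x ∈ pairLabels I ↔ x / 3 ∈ I ∧ x % 3 < 2 := by
  simp only [pairLabels, Finset.mem_biUnion, Finset.mem_insert, Finset.mem_singleton]
  constructor
  · rintro ⟨i, hi, hx⟩
    rw [show x / 3 = i by lia]
    exact ⟨hi, by lia⟩
  · rintro ⟨h, hx⟩
    exact ⟨_, h, by lia⟩

theorem sum_pairLabels {M : Type*} [AddCommMonoid M] (I : Finset ℕ) (g : ℕ → M) :
    ∑ x ∈ pairLabels I, g x = ∑ i ∈ I, (g (3 * i) + g (3 * i + 1)) := by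
  rw [pairLabels, Finset.sum_biUnion]
  · exact Finset.sum_congr rfl fun i _ => Finset.sum_pair (by lia)
  · intro i _ j _ hij
    rw [Function.onFun, Finset.disjoint_left]
    intro x hx hx'
    simp only [Finset.mem_insert, Finset.mem_singleton] at hx hx'
    lia

/-- The other vertex of the pair. -/
def partner (x : ℕ) : ℕ := if x % 3 = 0 then x + 1 else x - 1

namespace InputGraph

/-- The label of the vertex `j` of the core when the core is put at position `s`. -/
def coreLabel (H : InputGraph) (s j : ℕ) : ℕ := 3 * (H.n * s + j) + 2

theorem coreLabel_injective (H : InputGraph) (s : ℕ) : Function.Injective (H.coreLabel s) := by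
  intro i j h
  unfold coreLabel at h
  lia

/-- The disjoint union of a copy of the core `H` and of pairs of adjacent vertices. -/
def planted (H : InputGraph) (σ : Finset ℕ × ℕ) : InputGraph where
  V := pairLabels σ.1 ∪ H.V.image (H.coreLabel σ.2)
  graph :=
    { Adj := fun x y => (x ∈ pairLabels σ.1 ∧ y ∈ pairLabels σ.1 ∧ x / 3 = y / 3 ∧ x ≠ y) ∨
        ∃ i j, H.graph.Adj i j ∧ x = H.coreLabel σ.2 i ∧ y = H.coreLabel σ.2 j
      symm := ⟨by
        rintro x y (⟨hx, hy, h, hne⟩ | ⟨i, j, hij, rfl, rfl⟩)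
        · exact .inl ⟨hy, hx, h.symm, hne.symm⟩
        · exact .inr ⟨j, i, hij.symm, rfl, rfl⟩⟩
      loopless := ⟨by
        rintro x (⟨hx, hy, h, hne⟩ | ⟨i, j, hij, hx, hx'⟩)
        · exact hne rfl
        · exact hij.ne (H.coreLabel_injective _ (hx.symm.trans hx'))⟩ }
  nonempty := (H.nonempty.image _).inr
  mem_of_adj := by
    rintro x y (⟨hx, -⟩ | ⟨i, j, hij, rfl, rfl⟩)
    · exact Finset.mem_union_left _ hx
    · exact Finset.mem_union_right _ (Finset.mem_image_of_mem _ (H.mem_of_adj i j hij))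
  no_isolated := by
    intro x hx
    rcases Finset.mem_union.1 hx with hx | hx
    · refine ⟨partner x, .inl ⟨hx, ?_⟩⟩
      rw [mem_pairLabels] at hx ⊢
      unfold partner
      split_ifs with h
      · rw [show (x + 1) / 3 = x / 3 by lia]
        exact ⟨⟨hx.1, by lia⟩, rfl, by lia⟩
      · rw [show (x - 1) / 3 = x / 3 by lia]
        exact ⟨⟨hx.1, by lia⟩, rfl, by lia⟩
    · obtain ⟨i, hi, rfl⟩ := Finset.mem_image.1 hx
      obtain ⟨j, hij⟩ := H.no_isolated i hi
      exact ⟨_, .inr ⟨i, j, hij, rfl, rfl⟩⟩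

variable (H : InputGraph) (σ : Finset ℕ × ℕ)

theorem planted_V : (H.planted σ).V = pairLabels σ.1 ∪ H.V.image (H.coreLabel σ.2) := rfl

theorem planted_adj {x y : ℕ} : (H.planted σ).graph.Adj x y ↔
    (x ∈ pairLabels σ.1 ∧ y ∈ pairLabels σ.1 ∧ x / 3 = y / 3 ∧ x ≠ y) ∨
      ∃ i j, H.graph.Adj i j ∧ x = H.coreLabel σ.2 i ∧ y = H.coreLabel σ.2 j := Iff.rfl

/-- Pairs use the residues `0` and `1` modulo `3`, the core uses `2`. They never collide, so the
pairs and the position of the core can be chosen independently. -/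
theorem coreLabel_notMem_pairLabels (s j : ℕ) (I : Finset ℕ) : H.coreLabel s j ∉ pairLabels I := by
  rw [mem_pairLabels, coreLabel]
  lia

theorem sum_planted_V {M : Type*} [AddCommMonoid M] (g : ℕ → M) :
    ∑ x ∈ (H.planted σ).V, g x =
      ∑ i ∈ σ.1, (g (3 * i) + g (3 * i + 1)) + ∑ j ∈ H.V, g (H.coreLabel σ.2 j) := by
  rw [planted_V, Finset.sum_union, sum_pairLabels, Finset.sum_image]
  · exact fun i _ j _ h => H.coreLabel_injective _ h
  · rw [Finset.disjoint_left]
    intro x hx hx'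
    obtain ⟨j, -, rfl⟩ := Finset.mem_image.1 hx'
    exact H.coreLabel_notMem_pairLabels _ _ _ hx

theorem planted_n : (H.planted σ).n = 2 * σ.1.card + H.n := by
  rw [n, Finset.card_eq_sum_ones, sum_planted_V, n, Finset.card_eq_sum_ones H.V, Finset.sum_const,
    smul_eq_mul, mul_comm]

theorem planted_nbrs_of_mem_pairLabels {x : ℕ} (hx : x ∈ pairLabels σ.1) :
    (H.planted σ).nbrs x = {partner x} := by
  ext y
  rw [mem_nbrs, planted_adj, Finset.mem_singleton]
  constructor
  · rintro (⟨-, hy, h, hne⟩ | ⟨i, j, -, rfl, -⟩)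
    · rw [mem_pairLabels] at hx hy
      unfold partner
      split_ifs <;> lia
    · exact absurd hx (H.coreLabel_notMem_pairLabels _ _ _)
  · rintro rfl
    refine .inl ⟨hx, ?_⟩
    rw [mem_pairLabels] at hx ⊢
    unfold partner
    split_ifs with h
    · rw [show (x + 1) / 3 = x / 3 by lia]
      exact ⟨⟨hx.1, by lia⟩, rfl, by lia⟩
    · rw [show (x - 1) / 3 = x / 3 by lia]
      exact ⟨⟨hx.1, by lia⟩, rfl, by lia⟩

theorem planted_deg_coreLabel (j : ℕ) : (H.planted σ).deg (H.coreLabel σ.2 j) = H.deg j := by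
  rw [deg, deg, ← Finset.card_image_of_injective (H.nbrs j) (H.coreLabel_injective σ.2)]
  congr 1
  ext y
  rw [mem_nbrs, planted_adj, Finset.mem_image]
  constructor
  · rintro (⟨h, -⟩ | ⟨i, i', hij, h, rfl⟩)
    · exact absurd h (H.coreLabel_notMem_pairLabels _ _ _)
    · rw [H.coreLabel_injective _ h]
      exact ⟨i', H.mem_nbrs.2 hij, rfl⟩
  · rintro ⟨i, hi, rfl⟩
    exact .inr ⟨j, i, H.mem_nbrs.1 hi, rfl, rfl⟩

theorem planted_m : (H.planted σ).m = σ.1.card + H.m := by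
  have h1 : ∀ i ∈ σ.1, (H.planted σ).deg (3 * i) + (H.planted σ).deg (3 * i + 1) = 2 := by
    intro i hi
    rw [deg, deg, planted_nbrs_of_mem_pairLabels, planted_nbrs_of_mem_pairLabels]
    · rfl
    · rw [mem_pairLabels, show (3 * i + 1) / 3 = i by lia]
      exact ⟨hi, by lia⟩
    · rw [mem_pairLabels, show (3 * i) / 3 = i by lia]
      exact ⟨hi, by lia⟩
  have h2 := (H.planted σ).two_mul_m_eq_sum_deg
  have h3 := H.two_mul_m_eq_sum_deg
  rw [sum_planted_V, Finset.sum_congr rfl h1] at h2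
  simp only [planted_deg_coreLabel, ← h3, Finset.sum_const, smul_eq_mul] at h2
  lia

end InputGraph

/-- The vertices that a query mentions. -/
def Query.mentioned : Query → Finset ℕ
  | .randVert => ∅
  | .randNbr x => {x}
  | .degree x => {x}
  | .pair x y => {x, y}
  | .additive S => S
  | .fullNbrHood x => {x}

theorem Query.card_mentioned_le (q : Query) : q.mentioned.card ≤ 2 * q.cost := by
  cases q with
  | pair x y => exact Finset.card_le_two
  | additive S => exact Nat.le_mul_of_pos_left _ two_pos
  | _ => simp [mentioned, cost]

/-- Two graphs that agree on the vertices that a query mentions give the same reply. -/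
theorem InputGraph.reply_congr {G G' : InputGraph} {q : Query} (hq : q ≠ .randVert)
    (h : ∀ x ∈ q.mentioned, x ∈ G.V ↔ x ∈ G'.V)
    (h' : ∀ x ∈ q.mentioned, x ∈ G.V → G.nbrs x = G'.nbrs x) : G.reply q = G'.reply q := by
  cases q with
  | randVert => exact absurd rfl hq
  | randNbr x =>
    have hx := h x (by simp [Query.mentioned])
    by_cases hG : x ∈ G.V
    · have hn := h' x (by simp [Query.mentioned]) hG
      simp only [reply, hG, hx.1 hG, hn, dif_pos]
    · simp only [reply, hG, mt hx.2 hG, dif_neg, not_false_iff]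
  | degree x =>
    have hx := h x (by simp [Query.mentioned])
    by_cases hG : x ∈ G.V
    · have hn := h' x (by simp [Query.mentioned]) hG
      simp only [reply, hG, hx.1 hG, hn, if_pos]
    · simp only [reply, hG, mt hx.2 hG, if_neg, not_false_iff]
  | fullNbrHood x =>
    have hx := h x (by simp [Query.mentioned])
    by_cases hG : x ∈ G.V
    · have hn := h' x (by simp [Query.mentioned]) hG
      simp only [reply, hG, hx.1 hG, hn, if_pos]
    · simp only [reply, hG, mt hx.2 hG, if_neg, not_false_iff]
  | pair x y =>
    have hx := h x (by simp [Query.mentioned])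
    have hy := h y (by simp [Query.mentioned])
    by_cases hG : x ∈ G.V ∧ y ∈ G.V
    · have hn := h' x (by simp [Query.mentioned]) hG.1
      have ha : G.graph.Adj x y ↔ G'.graph.Adj x y := by rw [← G.mem_nbrs, hn, G'.mem_nbrs]
      have hG' : x ∈ G'.V ∧ y ∈ G'.V := ⟨hx.1 hG.1, hy.1 hG.2⟩
      simp only [reply, if_pos hG, if_pos hG']
      exact congrArg (fun b => PMF.pure (Reply.adjacent b)) (decide_eq_decide.2 ha)
    · have hG' : ¬ (x ∈ G'.V ∧ y ∈ G'.V) := fun hc => hG ⟨hx.2 hc.1, hy.2 hc.2⟩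
      simp only [reply, if_neg hG, if_neg hG']
  | additive S =>
    have hS : S ⊆ G.V ↔ S ⊆ G'.V :=
      ⟨fun hs x hx => (h x hx).1 (hs hx), fun hs x hx => (h x hx).2 (hs hx)⟩
    by_cases hG : S ⊆ G.V
    · have he : (G.edgesIn S).card = (G'.edgesIn S).card := by
        have e1 := G.two_mul_card_edgesIn S
        have e2 := G'.two_mul_card_edgesIn S
        have e3 : G.crossCount S S = G'.crossCount S S := by
          refine Finset.sum_congr rfl fun x hx => Finset.sum_congr rfl fun y _ => ?_
          have ha : G.graph.Adj x y ↔ G'.graph.Adj x y := by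
            rw [← G.mem_nbrs, h' x hx (hG hx), G'.mem_nbrs]
          rw [adjInd, adjInd]
          by_cases hxy : G'.graph.Adj x y
          · rw [if_pos hxy, if_pos (ha.2 hxy)]
          · rw [if_neg hxy, if_neg (mt ha.1 hxy)]
        lia
      simp only [reply, hG, hS.1 hG, he, if_pos]
    · simp only [reply, hG, mt hS.2 hG, if_neg, not_false_iff]

/-! ### Averages over the placements of a core and of pairs -/

/-- The average of a function over a finite set. -/
noncomputable def avgOn {ι : Type*} (S : Finset ι) (f : ι → ℝ≥0∞) : ℝ≥0∞ :=
  (S.card : ℝ≥0∞)⁻¹ * ∑ i ∈ S, f i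

namespace avgOn

variable {ι : Type*} {S : Finset ι} {f g : ι → ℝ≥0∞}

theorem mono (h : ∀ i ∈ S, f i ≤ g i) : avgOn S f ≤ avgOn S g :=
  mul_le_mul_right (Finset.sum_le_sum h) _

theorem add : (avgOn S fun i => f i + g i) = avgOn S f + avgOn S g := by
  rw [avgOn, Finset.sum_add_distrib, mul_add, avgOn, avgOn]

theorem mul_left (c : ℝ≥0∞) : (avgOn S fun i => c * f i) = c * avgOn S f := by
  rw [avgOn, ← Finset.mul_sum, mul_left_comm, avgOn]

theorem sum {κ : Type*} (T : Finset κ) (f : κ → ι → ℝ≥0∞) :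
    (avgOn S fun i => ∑ a ∈ T, f a i) = ∑ a ∈ T, avgOn S (f a) := by
  simp only [avgOn, Finset.mul_sum]
  exact Finset.sum_comm

theorem const_le (c : ℝ≥0∞) : (avgOn S fun _ => c) ≤ c := by
  rw [avgOn, Finset.sum_const, nsmul_eq_mul, ← mul_assoc]
  exact mul_le_of_le_one_left' (ENNReal.inv_mul_le_one _)

theorem le_of_le {c : ℝ≥0∞} (h : ∀ i ∈ S, f i ≤ c) : avgOn S f ≤ c := (mono h).trans (const_le c)

theorem le_of_ge {c : ℝ≥0∞} (hS : S.Nonempty) (h : ∀ i ∈ S, c ≤ f i) : c ≤ avgOn S f := by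
  refine le_trans ?_ (mono h)
  rw [avgOn, Finset.sum_const, nsmul_eq_mul, ← mul_assoc, ENNReal.inv_mul_cancel, one_mul]
  · exact Nat.cast_ne_zero.2 hS.card_pos.ne'
  · exact ENNReal.natCast_ne_top _

theorem expect {α : Type*} (p : PMF α) (f : ι → α → ℝ≥0∞) :
    (avgOn S fun i => p.expect (f i)) = p.expect fun a => avgOn S fun i => f i a := by
  simp only [avgOn, PMF.expect_mul_left, PMF.expect_sum]

end avgOn

/-- The positions of a core and of `p` pairs in a space of size `N`, where the pairs with indices
in `K` are known to be present. -/
def placements (N p : ℕ) (K : Finset ℕ) : Finset (Finset ℕ × ℕ) :=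
  {I ∈ (Finset.range N).powersetCard p | K ⊆ I} ×ˢ Finset.range N

theorem mem_placements {N p : ℕ} {K : Finset ℕ} {σ : Finset ℕ × ℕ} :
    σ ∈ placements N p K ↔ ((σ.1 ⊆ Finset.range N ∧ σ.1.card = p) ∧ K ⊆ σ.1) ∧ σ.2 < N := by
  rw [placements, Finset.mem_product, Finset.mem_filter, Finset.mem_powersetCard, Finset.mem_range]

theorem card_supersets {N p : ℕ} {K : Finset ℕ} (hK : K ⊆ Finset.range N) (hp : K.card ≤ p) :
    ({I ∈ (Finset.range N).powersetCard p | K ⊆ I} : Finset _).card =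
      (N - K.card).choose (p - K.card) := by
  have h : (Finset.range N \ K).card = N - K.card := by
    rw [Finset.card_sdiff_of_subset hK, Finset.card_range]
  rw [← h, ← Finset.card_powersetCard]
  refine Finset.card_bij' (fun I _ => I \ K) (fun J _ => J ∪ K) ?_ ?_ ?_ ?_
  · intro I hI
    rw [Finset.mem_filter, Finset.mem_powersetCard] at hI
    rw [Finset.mem_powersetCard, Finset.card_sdiff_of_subset hI.2, hI.1.2]
    exact ⟨Finset.sdiff_subset_sdiff hI.1.1 subset_rfl, rfl⟩
  · intro J hJ
    rw [Finset.mem_powersetCard] at hJ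
    have hd : Disjoint J K := (Finset.subset_sdiff.1 hJ.1).2
    rw [Finset.mem_filter, Finset.mem_powersetCard, Finset.card_union_of_disjoint hd, hJ.2]
    exact ⟨⟨Finset.union_subset (Finset.subset_sdiff.1 hJ.1).1 hK, by lia⟩,
      Finset.subset_union_right⟩
  · intro I hI
    rw [Finset.mem_filter] at hI
    exact Finset.sdiff_union_of_subset hI.2
  · intro J hJ
    rw [Finset.mem_powersetCard] at hJ
    exact Finset.union_sdiff_cancel_right (Finset.subset_sdiff.1 hJ.1).2

theorem card_placements {N p : ℕ} {K : Finset ℕ} (hK : K ⊆ Finset.range N) (hp : K.card ≤ p) :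
    (placements N p K).card = (N - K.card).choose (p - K.card) * N := by
  rw [placements, Finset.card_product, card_supersets hK hp, Finset.card_range]

theorem placements_nonempty {N p : ℕ} {K : Finset ℕ} (hK : K ⊆ Finset.range N) (hp : K.card ≤ p)
    (hN : p ≤ N) (hN' : 0 < N) : (placements N p K).Nonempty := by
  rw [← Finset.card_pos, card_placements hK hp]
  exact Nat.mul_pos (Nat.choose_pos (by lia)) hN'

theorem card_placements_insert {N p i : ℕ} {K : Finset ℕ} (hK : K ⊆ Finset.range N)
    (hp : K.card ≤ p) (hi : i ∉ K) (hiN : i < N) :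
    (placements N p (insert i K)).card * (N - K.card) =
      (placements N p K).card * (p - K.card) := by
  have hK' : insert i K ⊆ Finset.range N := Finset.insert_subset (Finset.mem_range.2 hiN) hK
  have hc : (insert i K).card = K.card + 1 := Finset.card_insert_of_notMem hi
  have hle : K.card + 1 ≤ N := by
    rw [← hc, ← Finset.card_range N]
    exact Finset.card_le_card hK'
  rcases hp.eq_or_lt with rfl | hlt
  · have : placements N K.card (insert i K) = ∅ := by
      refine Finset.eq_empty_of_forall_notMem fun σ hσ => ?_
      rw [mem_placements] at hσ
      have := Finset.card_le_card hσ.1.2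
      lia
    rw [this, Finset.card_empty, Nat.sub_self, zero_mul, mul_zero]
  · rw [card_placements hK hp, card_placements hK' (by lia), hc]
    obtain ⟨a, ha⟩ : ∃ a, N = K.card + 1 + a := ⟨_, (Nat.add_sub_cancel' hle).symm⟩
    obtain ⟨b, hb⟩ : ∃ b, p = K.card + 1 + b := ⟨_, (Nat.add_sub_cancel' hlt).symm⟩
    have h1 := Nat.add_one_mul_choose_eq a b
    have e1 : N - (K.card + 1) = a := by lia
    have e2 : p - (K.card + 1) = b := by lia
    have e3 : N - K.card = a + 1 := by lia
    have e4 : p - K.card = b + 1 := by lia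
    rw [e1, e2, e3, e4]
    linear_combination N * h1

open Classical in
/-- The probability that a further pair is present. -/
theorem avgOn_placements_insert {N p i : ℕ} {K : Finset ℕ} (hK : K ⊆ Finset.range N)
    (hp : K.card ≤ p) (hi : i ∉ K) (hiN : i < N) (hpN : p ≤ N) (f : Finset ℕ × ℕ → ℝ≥0∞) :
    (avgOn (placements N p K) fun σ => if i ∈ σ.1 then f σ else 0) =
      ((p - K.card : ℕ) : ℝ≥0∞) / ((N - K.card : ℕ) : ℝ≥0∞) *
        avgOn (placements N p (insert i K)) f := by
  have hS : placements N p (insert i K) = {σ ∈ placements N p K | i ∈ σ.1} := by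
    ext σ
    rw [Finset.mem_filter, mem_placements, mem_placements, Finset.insert_subset_iff]
    tauto
  have hsum : ∑ σ ∈ placements N p K, (if i ∈ σ.1 then f σ else 0) =
      ∑ σ ∈ placements N p (insert i K), f σ := by
    rw [hS, Finset.sum_filter]
  rw [avgOn, avgOn, hsum]
  have hc := card_placements_insert hK hp hi hiN
  have hlt : K.card + 1 ≤ N := by
    rw [← Finset.card_insert_of_notMem hi, ← Finset.card_range N]
    exact Finset.card_le_card (Finset.insert_subset (Finset.mem_range.2 hiN) hK)
  rcases Nat.eq_zero_or_pos (placements N p (insert i K)).card with h0 | hpos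
  · rw [Finset.card_eq_zero.1 h0]
    simp
  · have hpos' := (placements_nonempty hK hp hpN (by lia)).card_pos
    rw [← mul_assoc]
    congr 1
    set a := (placements N p (insert i K)).card
    set b := (placements N p K).card
    have hN0 : ((N - K.card : ℕ) : ℝ≥0∞) ≠ 0 := Nat.cast_ne_zero.2 (by lia)
    have ha0 : (a : ℝ≥0∞) ≠ 0 := Nat.cast_ne_zero.2 hpos.ne'
    have hb0 : (b : ℝ≥0∞) ≠ 0 := Nat.cast_ne_zero.2 hpos'.ne'
    have hc' : (a : ℝ≥0∞) * (N - K.card : ℕ) = b * (p - K.card : ℕ) := by exact_mod_cast hc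
    rw [← div_eq_mul_inv, ENNReal.eq_div_iff ha0 (ENNReal.natCast_ne_top _),
      ENNReal.eq_div_iff hN0 (ENNReal.natCast_ne_top _), ← mul_assoc,
      mul_comm ((N - K.card : ℕ) : ℝ≥0∞), hc', mul_right_comm,
      ENNReal.mul_inv_cancel hb0 (ENNReal.natCast_ne_top _), one_mul]

/-! ### The replies for a random placement do not depend on the core -/

theorem ENNReal.natCast_div_le_natCast_div {a b c d : ℕ} (hd : 0 < d)
    (h : a * d ≤ c * b) : (a : ℝ≥0∞) / b ≤ c / d := by
  refine ENNReal.div_le_of_le_mul ?_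
  rw [← ENNReal.mul_div_right_comm, ENNReal.le_div_iff_mul_le
    (.inl (Nat.cast_ne_zero.2 hd.ne')) (.inl (ENNReal.natCast_ne_top _))]
  exact_mod_cast h

-- A label of residue `0` or `1` needs an unrevealed pair, of probability at most `(p - |K|)/(N -
-- |K|) ≤ p/N`. A label of residue `2` fits only one position of the core, as different positions
-- use disjoint blocks, so its probability is at most `1/N`. The stated bound covers both.
open Classical in
theorem avgOn_placements_mem_planted_le {N p : ℕ} {K : Finset ℕ} (hK : K ⊆ Finset.range N)
    (hp : K.card ≤ p) (hpN : p < N) {H : InputGraph} (hH : H.V = Finset.range H.n) {x : ℕ}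
    (hx : x ∉ pairLabels K) :
    (avgOn (placements N p K) fun σ => if x ∈ (H.planted σ).V then 1 else 0) ≤
      ((p + 1 : ℕ) : ℝ≥0∞) / N := by
  by_cases h3 : x % 3 < 2
  · have hxK : x / 3 ∉ K := fun h => hx (mem_pairLabels.2 ⟨h, h3⟩)
    have hmem : ∀ σ, x ∈ (H.planted σ).V ↔ x / 3 ∈ σ.1 := by
      intro σ
      rw [H.planted_V, Finset.mem_union, mem_pairLabels]
      constructor
      · rintro (h | h)
        · exact h.1
        · obtain ⟨j, -, rfl⟩ := Finset.mem_image.1 h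
          unfold InputGraph.coreLabel at h3
          lia
      · exact fun h => .inl ⟨h, h3⟩
    simp only [hmem]
    by_cases hxN : x / 3 < N
    · rw [avgOn_placements_insert hK hp hxK hxN hpN.le]
      refine (mul_le_of_le_one_right' (avgOn.const_le 1)).trans
        (ENNReal.natCast_div_le_natCast_div (by lia) ?_)
      obtain ⟨a, rfl⟩ := Nat.exists_eq_add_of_le hp
      obtain ⟨b, rfl⟩ := Nat.exists_eq_add_of_lt hpN
      rw [show K.card + a - K.card = a by lia, show K.card + a + b + 1 - K.card = a + b + 1 by lia]
      nlinarith
    · refine avgOn.le_of_le fun σ hσ => ?_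
      rw [if_neg]
      · exact zero_le
      · intro h
        exact hxN (Finset.mem_range.1 ((mem_placements.1 hσ).1.1.1 h))
  · have hmem : ∀ σ, x ∈ (H.planted σ).V → σ.2 = x / 3 / H.n := by
      intro σ h
      rw [H.planted_V, Finset.mem_union, mem_pairLabels] at h
      rcases h with h | h
      · exact absurd h.2 h3
      · obtain ⟨j, hj, rfl⟩ := Finset.mem_image.1 h
        rw [hH, Finset.mem_range] at hj
        rw [InputGraph.coreLabel, show (3 * (H.n * σ.2 + j) + 2) / 3 = H.n * σ.2 + j by lia,
          Nat.mul_add_div H.n_pos, Nat.div_eq_of_lt hj, add_zero]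
    refine (avgOn.mono (g := fun σ => if σ.2 = x / 3 / H.n then 1 else 0) fun σ _ => ?_).trans ?_
    · split_ifs with h1 h2
      · exact le_rfl
      · exact absurd (hmem σ h1) h2
      · exact zero_le
      · exact le_rfl
    · have hc := card_supersets hK hp
      rw [avgOn, card_placements hK hp, placements, Finset.sum_product]
      simp only [Finset.sum_ite_eq', Finset.sum_const, hc, nsmul_eq_mul]
      rw [← ENNReal.div_eq_inv_mul]
      split_ifs
      · rw [mul_one]
        exact ENNReal.natCast_div_le_natCast_div (by lia) (Nat.le_mul_of_pos_left _ p.succ_pos)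
      · simp

namespace InputGraph

variable (H : InputGraph)

theorem planted_nbrs_congr {H H' : InputGraph} {K : Finset ℕ} {σ σ' : Finset ℕ × ℕ} (hσ : K ⊆ σ.1)
    (hσ' : K ⊆ σ'.1) {x : ℕ} (hx : x ∈ pairLabels K) :
    x ∈ (H.planted σ).V ∧ (H.planted σ).nbrs x = (H'.planted σ').nbrs x := by
  have h : ∀ {I}, K ⊆ I → x ∈ pairLabels I := fun hI => by
    rw [mem_pairLabels] at hx ⊢
    exact ⟨hI hx.1, hx.2⟩
  rw [planted_nbrs_of_mem_pairLabels _ _ (h hσ), planted_nbrs_of_mem_pairLabels _ _ (h hσ')]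
  exact ⟨Finset.mem_union_left _ (h hσ), rfl⟩

/-- The reply to a query when only the pairs with indices in `K` are known. -/
noncomputable def knownReply (K : Finset ℕ) (q : Query) : PMF Reply :=
  (H.planted (K, q.mentioned.sup id)).reply q

/-- Unless the query mentions a vertex outside of the known pairs, the reply is the one that is
determined by the known pairs. -/
theorem reply_planted_eq_knownReply {H' : InputGraph} {K : Finset ℕ} {σ : Finset ℕ × ℕ}
    (hσ : K ⊆ σ.1) {q : Query} (hq : q ≠ .randVert)
    (h : ∀ x ∈ q.mentioned, x ∉ pairLabels K → x ∉ (H'.planted σ).V) :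
    (H'.planted σ).reply q = H.knownReply K q := by
  -- The reference core sits at a position equal to the largest mentioned label, so all its labels
  -- lie beyond the mentioned ones.
  have key : ∀ x ∈ q.mentioned, x ∉ pairLabels K →
      x ∉ (H.planted (K, q.mentioned.sup id)).V := by
    intro x hx hxK hV
    rw [planted_V, Finset.mem_union] at hV
    rcases hV with hV | hV
    · exact hxK hV
    · obtain ⟨j, -, hj⟩ := Finset.mem_image.1 hV
      have h1 : x ≤ q.mentioned.sup id := Finset.le_sup (f := id) hx
      have h2 := Nat.le_mul_of_pos_left (q.mentioned.sup id) H.n_pos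
      unfold coreLabel at hj
      dsimp only at hj
      lia
  refine reply_congr hq (fun x hx => ?_) (fun x hx hV => ?_)
  · by_cases hxK : x ∈ pairLabels K
    · exact iff_of_true (planted_nbrs_congr (H' := H) hσ hσ hxK).1
        (planted_nbrs_congr (H' := H) subset_rfl hσ hxK).1
    · exact iff_of_false (h x hx hxK) (key x hx hxK)
  · by_cases hxK : x ∈ pairLabels K
    · exact (planted_nbrs_congr hσ subset_rfl hxK).2
    · exact absurd hV (h x hx hxK)

open Classical in
/-- For a random placement, the reply to a query other than `RandVert` is most likely the one that
is determined by the known pairs. -/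
theorem avgOn_reply_planted {H' : InputGraph} (hH' : H'.V = Finset.range H'.n) {N p : ℕ}
    {K : Finset ℕ} (hK : K ⊆ Finset.range N) (hp : K.card ≤ p) (hpN : p < N) {q : Query}
    (hq : q ≠ .randVert) {g : Finset ℕ × ℕ → Reply → ℝ≥0∞} (hg : ∀ σ r, g σ r ≤ 1) :
    (avgOn (placements N p K) fun σ => ((H'.planted σ).reply q).expect (g σ)) ≤
        ((H.knownReply K q).expect fun r => avgOn (placements N p K) fun σ => g σ r) +
          q.cost * (2 * (((p + 1 : ℕ) : ℝ≥0∞) / N)) ∧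
      ((H.knownReply K q).expect fun r => avgOn (placements N p K) fun σ => g σ r) ≤
        (avgOn (placements N p K) fun σ => ((H'.planted σ).reply q).expect (g σ)) +
          q.cost * (2 * (((p + 1 : ℕ) : ℝ≥0∞) / N)) := by
  -- The number of mentioned vertices outside the known pairs. Where it is zero the reply is the
  -- known one; elsewhere it is at least `1` and dominates any change of `g`.
  set bad : Finset ℕ × ℕ → ℝ≥0∞ := fun σ =>
    ∑ x ∈ q.mentioned with x ∉ pairLabels K, if x ∈ (H'.planted σ).V then 1 else 0 with hbad
  have hle : avgOn (placements N p K) bad ≤ q.cost * (2 * (((p + 1 : ℕ) : ℝ≥0∞) / N)) := by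
    rw [hbad, avgOn.sum]
    refine (Finset.sum_le_card_nsmul _ _ _ fun x hx =>
      avgOn_placements_mem_planted_le hK hp hpN hH' (Finset.mem_filter.1 hx).2).trans ?_
    rw [nsmul_eq_mul, ← mul_assoc]
    gcongr
    have h1 := (Finset.card_filter_le q.mentioned fun x => x ∉ pairLabels K).trans
      q.card_mentioned_le
    rw [mul_comm]
    exact_mod_cast h1
  have hcase : ∀ σ ∈ placements N p K,
      (H'.planted σ).reply q = H.knownReply K q ∨ 1 ≤ bad σ := by
    intro σ hσ
    by_cases h : ∀ x ∈ q.mentioned, x ∉ pairLabels K → x ∉ (H'.planted σ).V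
    · exact .inl (H.reply_planted_eq_knownReply (mem_placements.1 hσ).1.2 hq h)
    · push Not at h
      obtain ⟨x, hx, hxK, hV⟩ := h
      right
      refine le_trans (by rw [if_pos hV]) (Finset.single_le_sum
        (f := fun x => if x ∈ (H'.planted σ).V then (1 : ℝ≥0∞) else 0) (fun _ _ => zero_le)
        (Finset.mem_filter.2 ⟨hx, hxK⟩))
  rw [← avgOn.expect]
  refine ⟨?_, ?_⟩
  · refine le_trans ?_ (add_le_add_right hle _)
    rw [← avgOn.add]
    refine avgOn.mono fun σ hσ => ?_
    rcases hcase σ hσ with h | h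
    · rw [h]
      exact le_self_add
    · exact (PMF.expect_le_of_le (hg σ)).trans (h.trans le_add_self)
  · refine le_trans ?_ (add_le_add_right hle _)
    rw [← avgOn.add]
    refine avgOn.mono fun σ hσ => ?_
    rcases hcase σ hσ with h | h
    · rw [h]
      exact le_self_add
    · exact (PMF.expect_le_of_le (hg σ)).trans (h.trans le_add_self)

open Classical in
/-- For a random placement, the reply to `RandVert` is most likely a uniformly random vertex of a
uniformly random new pair. -/
theorem avgOn_randVert_planted {N p Q : ℕ}
    {K : Finset ℕ} (hK : K ⊆ Finset.range N) (hp : K.card ≤ p) (hpN : p < N) (hQ : K.card ≤ Q)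
    {g : Finset ℕ × ℕ → Reply → ℝ≥0∞} (hg : ∀ σ r, g σ r ≤ 1) :
    let W := (((N - K.card) * 2 : ℕ) : ℝ≥0∞)⁻¹ * ∑ i ∈ Finset.range N \ K,
      avgOn (placements N p (insert i K)) fun σ =>
        g σ (.vertex (3 * i)) + g σ (.vertex (3 * i + 1))
    (avgOn (placements N p K) fun σ => ((H.planted σ).reply .randVert).expect (g σ)) ≤
        W + ((H.n + 2 * Q : ℕ) : ℝ≥0∞) / (H.n + 2 * p : ℕ) ∧
      W ≤ (avgOn (placements N p K) fun σ => ((H.planted σ).reply .randVert).expect (g σ)) +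
        ((H.n + 2 * Q : ℕ) : ℝ≥0∞) / (H.n + 2 * p : ℕ) := by
  intro W
  set h : ℕ → Finset ℕ × ℕ → ℝ≥0∞ := fun i σ =>
    g σ (.vertex (3 * i)) + g σ (.vertex (3 * i + 1)) with hh
  have hh2 : ∀ i σ, h i σ ≤ 2 := fun i σ =>
    (add_le_add (hg _ _) (hg _ _)).trans_eq one_add_one_eq_two
  set Z := ∑ i ∈ Finset.range N \ K, avgOn (placements N p (insert i K)) (h i) with hZ
  set n := H.n + 2 * p with hn
  have hn0 : 0 < n := by have := H.n_pos; lia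
  have hn0' : (n : ℝ≥0∞) ≠ 0 := Nat.cast_ne_zero.2 hn0.ne'
  have hcR : (Finset.range N \ K).card = N - K.card := by
    rw [Finset.card_sdiff_of_subset hK, Finset.card_range]
  have hM0 : ((N - K.card : ℕ) : ℝ≥0∞) ≠ 0 := Nat.cast_ne_zero.2 (by lia)
  have hreply : ∀ σ ∈ placements N p K, ((H.planted σ).reply .randVert).expect (g σ) =
      (n : ℝ≥0∞)⁻¹ * (∑ i ∈ σ.1, h i σ + ∑ j ∈ H.V, g σ (.vertex (H.coreLabel σ.2 j))) := by
    intro σ hσ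
    rw [reply, PMF.expect_map, PMF.expect_uniformOfFinset,
      H.sum_planted_V σ (fun x => g σ (.vertex x))]
    congr 3
    have := H.planted_n σ
    rw [(mem_placements.1 hσ).1.1.2] at this
    rw [hn, ← add_comm, ← this]
    rfl
  -- After exchanging the sums, conditioning on the presence of the pair `i` replaces `K` by `insert
  -- i K`.
  have hnew : (avgOn (placements N p K) fun σ =>
      ∑ i ∈ Finset.range N \ K, if i ∈ σ.1 then h i σ else 0) =
        ((p - K.card : ℕ) : ℝ≥0∞) / ((N - K.card : ℕ) : ℝ≥0∞) * Z := by
    rw [avgOn.sum, hZ, Finset.mul_sum]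
    refine Finset.sum_congr rfl fun i hi => ?_
    rw [Finset.mem_sdiff, Finset.mem_range] at hi
    exact avgOn_placements_insert hK hp hi.2 hi.1 hpN.le _
  have hWZ : W = (((N - K.card) * 2 : ℕ) : ℝ≥0∞)⁻¹ * Z := rfl
  have hW1 : W ≤ 1 := by
    rw [hWZ, hZ]
    refine (mul_le_mul_right (Finset.sum_le_card_nsmul _ _ 2 fun i _ =>
      avgOn.le_of_le fun σ _ => hh2 i σ) _).trans ?_
    rw [hcR, nsmul_eq_mul]
    refine le_trans (le_of_eq ?_) (ENNReal.inv_mul_le_one (((N - K.card) * 2 : ℕ) : ℝ≥0∞))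
    push_cast
    rfl
  have hZW : ((p - K.card : ℕ) : ℝ≥0∞) / ((N - K.card : ℕ) : ℝ≥0∞) * Z =
      (2 * (p - K.card) : ℕ) * W := by
    rw [hWZ, Nat.cast_mul, Nat.cast_mul, ENNReal.mul_inv (.inr (by simp)) (.inr (by simp)),
      div_eq_mul_inv]
    have : (2 : ℝ≥0∞) * 2⁻¹ = 1 := ENNReal.mul_inv_cancel (by simp) (by simp)
    simp only [Nat.cast_ofNat]
    calc ((p - K.card : ℕ) : ℝ≥0∞) * ((N - K.card : ℕ) : ℝ≥0∞)⁻¹ * Z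
        = (2 * 2⁻¹) * (((p - K.card : ℕ) : ℝ≥0∞) * ((N - K.card : ℕ) : ℝ≥0∞)⁻¹ * Z) := by
          rw [this, one_mul]
      _ = _ := by ring
  have hsplit : ∀ σ ∈ placements N p K, ∑ i ∈ σ.1, h i σ =
      (∑ i ∈ Finset.range N \ K, if i ∈ σ.1 then h i σ else 0) + ∑ i ∈ K, h i σ := by
    intro σ hσ
    rw [← Finset.sum_filter, ← Finset.sum_sdiff (mem_placements.1 hσ).1.2]
    congr 2
    ext i
    have := @(mem_placements.1 hσ).1.1.1 i
    simp only [Finset.mem_sdiff, Finset.mem_filter]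
    tauto
  have hupper : (avgOn (placements N p K) fun σ =>
      ((H.planted σ).reply .randVert).expect (g σ)) ≤
        (n : ℝ≥0∞)⁻¹ * ((2 * (p - K.card) : ℕ) * W + (H.n + 2 * K.card : ℕ)) := by
    rw [← hZW, ← hnew]
    refine (avgOn.mono (g := fun σ => (n : ℝ≥0∞)⁻¹ * ((∑ i ∈ Finset.range N \ K,
      if i ∈ σ.1 then h i σ else 0) + (H.n + 2 * K.card : ℕ))) fun σ hσ => ?_).trans ?_
    · rw [hreply σ hσ, hsplit σ hσ, add_assoc]
      gcongr
      have h1 := Finset.sum_le_card_nsmul K (fun i => h i σ) 2 fun i _ => hh2 i σ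
      have h2 := Finset.sum_le_card_nsmul H.V (fun j => g σ (.vertex (H.coreLabel σ.2 j))) 1
        fun j _ => hg σ _
      refine (add_le_add h1 h2).trans_eq ?_
      rw [nsmul_eq_mul, nsmul_eq_mul, mul_one, InputGraph.n]
      push_cast
      ring
    · rw [avgOn.mul_left, avgOn.add]
      gcongr
      exact avgOn.const_le _
  have hlower : (n : ℝ≥0∞)⁻¹ * ((2 * (p - K.card) : ℕ) * W) ≤
      avgOn (placements N p K) fun σ => ((H.planted σ).reply .randVert).expect (g σ) := by
    rw [← hZW, ← hnew, ← avgOn.mul_left]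
    refine avgOn.mono fun σ hσ => ?_
    rw [hreply σ hσ, hsplit σ hσ, add_assoc]
    gcongr
    exact le_self_add
  -- The weight of the new pairs and that of the core with the known pairs add up to `1`, so
  -- replacing the latter by a copy of `W` changes the average by at most its weight.
  have hone : (n : ℝ≥0∞)⁻¹ * (2 * (p - K.card) : ℕ) +
      (n : ℝ≥0∞)⁻¹ * (H.n + 2 * K.card : ℕ) = 1 := by
    rw [← mul_add, ← Nat.cast_add, show 2 * (p - K.card) + (H.n + 2 * K.card) = n by lia,
      ENNReal.inv_mul_cancel hn0' (ENNReal.natCast_ne_top _)]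
  have hrest : (n : ℝ≥0∞)⁻¹ * (H.n + 2 * K.card : ℕ) ≤ ((H.n + 2 * Q : ℕ) : ℝ≥0∞) / n := by
    rw [ENNReal.div_eq_inv_mul]
    gcongr
  refine ⟨?_, ?_⟩
  · refine hupper.trans ?_
    rw [mul_add, ← mul_assoc]
    gcongr
    exact mul_le_of_le_one_left' (le_self_add.trans_eq hone)
  · calc W = (n : ℝ≥0∞)⁻¹ * ((2 * (p - K.card) : ℕ) * W) +
          (n : ℝ≥0∞)⁻¹ * (H.n + 2 * K.card : ℕ) * W := by
            rw [← mul_assoc, ← add_mul, hone, one_mul]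
      _ ≤ _ := add_le_add hlower ((mul_le_of_le_one_right' hW1).trans hrest)

end InputGraph

/-! ### Different cores are hard to distinguish -/

namespace Algorithm

variable (A : Algorithm)

theorem value_le_one (G : InputGraph) {φ : A.Config → ℝ≥0∞} (h : ∀ c, φ c ≤ 1) (t : ℕ)
    (c : A.Config) : A.value G φ t c ≤ 1 := by
  induction t generalizing c with
  | zero => exact h c
  | succ t ih => exact PMF.expect_le_of_le ih

theorem value_eq_zero (G : InputGraph) {φ : A.Config → ℝ≥0∞} {Q : ℕ}
    (h : ∀ c, Q ≤ c.2 → φ c = 0) (t : ℕ) (x : A.State ⊕ ℝ) {k : ℕ} (hk : Q ≤ k) :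
    A.value G φ t (x, k) = 0 := by
  induction t generalizing x k with
  | zero => exact h _ hk
  | succ t ih =>
    rcases x with s | v
    · rw [value_succ_inl, ← PMF.expect_const (A.step s) 0]
      congr 1
      funext a
      rcases a with v | ⟨q, f⟩
      · exact ih _ hk
      · simp only [ih _ (hk.trans (Nat.le_add_right k q.cost)), PMF.expect_const]
    · rw [value_inr]
      exact h _ hk

/-- What can be learned by one query about a core with `r` vertices that is hidden among `p` pairs
in a space of size `N`. -/
noncomputable def queryLoss (Q N r p : ℕ) : ℝ≥0∞ :=
  ((r + 2 * Q : ℕ) : ℝ≥0∞) / (r + 2 * p : ℕ) + 2 * (((p + 1 : ℕ) : ℝ≥0∞) / N)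

/-- The set `K` of revealed pairs grows only by `RandVert`, at unit cost, whence `|K| ≤ k`; below
the budget `Q` both families still have placements containing `K`. Each reply is replaced by one
whose law is the same for both families: a vertex of a fresh uniform pair, or the reply determined
by `K`. Every unit of cost loses at most the sum of the two values of `queryLoss`, and `Q - 1 - k`
units remain before `φ` vanishes. The induction is on time because the empty additive query is free.
-/
theorem avgOn_value_le {φ : A.Config → ℝ≥0∞} (hφ : ∀ c, φ c ≤ 1) {Q : ℕ}
    (hφQ : ∀ c, Q ≤ c.2 → φ c = 0) {H H' : InputGraph} (hH : H.V = Finset.range H.n)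
    (hH' : H'.V = Finset.range H'.n) {N p p' : ℕ} (hp : Q ≤ p + 1) (hp' : Q ≤ p' + 1)
    (hpN : p < N) (hpN' : p' < N) (t : ℕ) (x : A.State ⊕ ℝ) {K : Finset ℕ} {k : ℕ}
    (hK : K ⊆ Finset.range N) (hk : K.card ≤ k) :
    (avgOn (placements N p K) fun σ => A.value (H.planted σ) φ t (x, k)) ≤
      (avgOn (placements N p' K) fun σ => A.value (H'.planted σ) φ t (x, k)) +
        (Q - 1 - k : ℕ) * (queryLoss Q N H.n p + queryLoss Q N H'.n p') := by
  set L := queryLoss Q N H.n p with hL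
  set L' := queryLoss Q N H'.n p' with hL'
  induction t generalizing x K k with
  | zero =>
    by_cases hkQ : Q ≤ k
    · refine (avgOn.le_of_le fun σ _ => (hφQ (x, k) hkQ).le).trans zero_le
    · refine (avgOn.const_le (φ (x, k))).trans (le_trans ?_ le_self_add)
      exact avgOn.le_of_ge (placements_nonempty hK (by lia) hpN'.le (by lia)) fun _ _ => le_rfl
  | succ t ih =>
    by_cases hkQ : Q ≤ k
    · exact (avgOn.le_of_le fun σ _ => (A.value_eq_zero _ hφQ _ x hkQ).le).trans zero_le
    rcases x with s | v
    swap
    · simp only [value_inr]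
      refine (avgOn.const_le _).trans (le_trans ?_ le_self_add)
      exact avgOn.le_of_ge (placements_nonempty hK (by lia) hpN'.le (by lia)) fun _ _ => le_rfl
    simp only [value_succ_inl]
    rw [avgOn.expect, avgOn.expect]
    rw [← PMF.expect_const (A.step s) ((Q - 1 - k : ℕ) * (L + L')), ← PMF.expect_add]
    refine PMF.expect_mono fun a => ?_
    rcases a with v | ⟨q, f⟩
    · exact ih (.inr v) hK hk
    have hg : ∀ (H : InputGraph) (σ : Finset ℕ × ℕ) (r : Reply),
        A.value (H.planted σ) φ t (.inl (f r), k + q.cost) ≤ 1 :=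
      fun H σ r => A.value_le_one _ hφ _ _
    by_cases hkq : Q ≤ k + q.cost
    · refine (avgOn.le_of_le fun σ _ => PMF.expect_le_of_le fun r =>
        (A.value_eq_zero _ hφQ _ _ hkq).le).trans zero_le
    by_cases hq : q = .randVert
    · subst hq
      obtain ⟨h1, -⟩ := H.avgOn_randVert_planted hK (by lia : K.card ≤ p) hpN (by lia : K.card ≤ Q)
        (hg H)
      obtain ⟨-, h2⟩ := H'.avgOn_randVert_planted hK (by lia : K.card ≤ p') hpN'
        (by lia : K.card ≤ Q) (hg H')
      rw [show Query.randVert.cost = 1 from rfl] at hkq h1 h2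
      change (avgOn (placements N p K) fun σ => ((H.planted σ).reply .randVert).expect fun r =>
          A.value (H.planted σ) φ t (.inl (f r), k + 1)) ≤
        (avgOn (placements N p' K) fun σ => ((H'.planted σ).reply .randVert).expect fun r =>
          A.value (H'.planted σ) φ t (.inl (f r), k + 1)) + _
      set δ : ℝ≥0∞ := (Q - 1 - (k + 1) : ℕ) * (L + L') with hδ
      have hδ' : ((Q - 1 - k : ℕ) : ℝ≥0∞) * (L + L') = δ + (L + L') := by
        rw [hδ, show Q - 1 - k = Q - 1 - (k + 1) + 1 by lia]
        push_cast
        ring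
      have h3 : ∀ i ∈ Finset.range N \ K,
          (avgOn (placements N p (insert i K)) fun σ =>
            A.value (H.planted σ) φ t (.inl (f (.vertex (3 * i))), k + 1) +
              A.value (H.planted σ) φ t (.inl (f (.vertex (3 * i + 1))), k + 1)) ≤
          (avgOn (placements N p' (insert i K)) fun σ =>
            A.value (H'.planted σ) φ t (.inl (f (.vertex (3 * i))), k + 1) +
              A.value (H'.planted σ) φ t (.inl (f (.vertex (3 * i + 1))), k + 1)) + 2 * δ := by
        intro i hi
        rw [Finset.mem_sdiff] at hi
        have hK' : insert i K ⊆ Finset.range N := Finset.insert_subset hi.1 hK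
        have hk' : (insert i K).card ≤ k + 1 :=
          (Finset.card_insert_le _ _).trans (Nat.add_le_add_right hk 1)
        rw [avgOn.add, avgOn.add]
        refine (add_le_add (ih _ hK' hk') (ih _ hK' hk')).trans_eq ?_
        rw [← hδ]
        ring
      have h4 := Finset.sum_le_sum h3
      rw [Finset.sum_add_distrib, Finset.sum_const, Finset.card_sdiff_of_subset hK,
        Finset.card_range, nsmul_eq_mul] at h4
      have h5 : (((N - K.card) * 2 : ℕ) : ℝ≥0∞)⁻¹ * ((N - K.card : ℕ) * (2 * δ)) ≤ δ := by
        rw [← mul_assoc, ← mul_assoc, mul_assoc _ _ (2 : ℝ≥0∞)]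
        refine mul_le_of_le_one_left' (le_trans (le_of_eq ?_)
          (ENNReal.inv_mul_le_one (((N - K.card) * 2 : ℕ) : ℝ≥0∞)))
        rw [Nat.cast_mul (N - K.card) 2, Nat.cast_two]
      refine h1.trans ((add_le_add_left (mul_le_mul_right h4 _) _).trans ?_)
      rw [mul_add, hδ']
      refine (add_le_add_left (add_le_add h2 h5) _).trans ?_
      have h6 : ((H.n + 2 * Q : ℕ) : ℝ≥0∞) / (H.n + 2 * p : ℕ) ≤ L := le_self_add
      have h7 : ((H'.n + 2 * Q : ℕ) : ℝ≥0∞) / (H'.n + 2 * p' : ℕ) ≤ L' := le_self_add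
      refine (add_le_add (add_le_add_left (add_le_add_right h7 _) _) h6).trans_eq ?_
      ring
    · obtain ⟨h1, -⟩ := H.avgOn_reply_planted hH hK (by lia : K.card ≤ p) hpN hq (hg H)
      -- The reference reply is taken from `H` for the second family as well, so the two estimates
      -- can be chained.
      obtain ⟨-, h2⟩ := H.avgOn_reply_planted hH' hK (by lia : K.card ≤ p') hpN' hq (hg H')
      have h3 := PMF.expect_mono (p := H.knownReply K q) fun r =>
        ih (.inl (f r)) hK (hk.trans (Nat.le_add_right k q.cost))
      rw [PMF.expect_add, PMF.expect_const] at h3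
      have h6 : 2 * (((p + 1 : ℕ) : ℝ≥0∞) / N) ≤ L := le_add_self
      have h7 : 2 * (((p' + 1 : ℕ) : ℝ≥0∞) / N) ≤ L' := le_add_self
      refine h1.trans ((add_le_add (h3.trans (add_le_add_left (h2.trans
        (add_le_add_right (mul_le_mul_right h7 _) _)) _)) (mul_le_mul_right h6 _)).trans_eq ?_)
      rw [show Q - 1 - k = Q - 1 - (k + q.cost) + q.cost by lia]
      push_cast
      ring

end Algorithm

/-! ### The lower bound -/

theorem InputGraph.mem_edgesIn {G : InputGraph} {S : Finset ℕ} {z : Sym2 ℕ} :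
    z ∈ G.edgesIn S ↔ z ∈ S.sym2 ∧ z ∈ G.graph.edgeSet := by
  simp only [edgesIn, Finset.mem_filter]

/-- The edges `{2i, 2i+1}`, with the last vertex joined to `0` if `r` is odd, cover all vertices and
number at most `e`. Any `e` pairs that include them form a core. -/
theorem InputGraph.exists_core {r e : ℕ} (hr : 2 ≤ r) (he : r ≤ 2 * e) (he' : e ≤ r.choose 2) :
    ∃ H : InputGraph, H.V = Finset.range H.n ∧ H.n = r ∧ H.m = e := by
  classical
  set w : ℕ → ℕ := fun i => if 2 * i + 1 < r then 2 * i + 1 else 0 with hw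
  set F : Finset (Sym2 ℕ) := (Finset.range ((r + 1) / 2)).image fun i => s(2 * i, w i) with hF
  set E : Finset (Sym2 ℕ) := (Finset.range r).offDiag.image Sym2.mk.uncurry with hE
  have hwr : ∀ i, w i < r := by
    intro i
    rw [hw]
    dsimp only
    split_ifs <;> lia
  have hwne : ∀ i < (r + 1) / 2, 2 * i ≠ w i := by
    intro i hi
    rw [hw]
    dsimp only
    split_ifs <;> lia
  have hFE : F ⊆ E := by
    intro z hz
    obtain ⟨i, hi, rfl⟩ := Finset.mem_image.1 hz
    rw [Finset.mem_range] at hi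
    refine Finset.mem_image.2 ⟨(2 * i, w i), ?_, rfl⟩
    rw [Finset.mem_offDiag, Finset.mem_range, Finset.mem_range]
    exact ⟨by lia, hwr i, hwne i hi⟩
  have hFc : F.card ≤ e := Finset.card_image_le.trans (by rw [Finset.card_range]; lia)
  have hEc : e ≤ E.card := by
    rw [hE, Sym2.card_image_offDiag, Finset.card_range]
    exact he'
  obtain ⟨D, hFD, hDE, hDc⟩ := Finset.exists_subsuperset_card_eq hFE hFc hEc
  have hDr : ∀ x y, s(x, y) ∈ D → x < r ∧ x ≠ y := by
    intro x y hxy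
    obtain ⟨⟨a, b⟩, hab, h⟩ := Finset.mem_image.1 (hDE hxy)
    rw [Finset.mem_offDiag, Finset.mem_range, Finset.mem_range] at hab
    rcases Sym2.eq_iff.1 h with ⟨rfl, rfl⟩ | ⟨rfl, rfl⟩
    · exact ⟨hab.1, hab.2.2⟩
    · exact ⟨hab.2.1, hab.2.2.symm⟩
  let H : InputGraph :=
    { V := Finset.range r
      graph := SimpleGraph.fromEdgeSet (D : Set (Sym2 ℕ))
      nonempty := ⟨0, Finset.mem_range.2 (by lia)⟩
      mem_of_adj := fun x y h => Finset.mem_range.2 (hDr x y (SimpleGraph.fromEdgeSet_adj _ |>.1 h).1).1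
      no_isolated := by
        intro x hx
        rw [Finset.mem_range] at hx
        have hmem : s(2 * (x / 2), w (x / 2)) ∈ D :=
          hFD (Finset.mem_image.2 ⟨x / 2, Finset.mem_range.2 (by lia), rfl⟩)
        have hne := hwne (x / 2) (by lia)
        by_cases hx2 : x % 2 = 0
        · rw [show 2 * (x / 2) = x by lia] at hmem hne
          exact ⟨_, (SimpleGraph.fromEdgeSet_adj _).2 ⟨hmem, hne⟩⟩
        · have : w (x / 2) = x := by
            rw [hw]
            dsimp only
            rw [if_pos] <;> lia
          rw [this] at hmem hne
          exact ⟨_, ((SimpleGraph.fromEdgeSet_adj _).2 ⟨hmem, hne⟩ :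
            (SimpleGraph.fromEdgeSet (D : Set (Sym2 ℕ))).Adj _ _).symm⟩ }
  have hn : H.n = r := Finset.card_range r
  refine ⟨H, by rw [hn], hn, ?_⟩
  rw [InputGraph.m, ← hDc]
  congr 1
  ext z
  induction z using Sym2.ind with
  | _ x y =>
  rw [InputGraph.mem_edgesIn, SimpleGraph.mem_edgeSet, Finset.mk_mem_sym2_iff]
  constructor
  · exact fun h => ((SimpleGraph.fromEdgeSet_adj _).1 h.2).1
  · intro h
    refine ⟨⟨Finset.mem_range.2 (hDr x y h).1, Finset.mem_range.2 (hDr y x ?_).1⟩,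
      (SimpleGraph.fromEdgeSet_adj _).2 ⟨h, (hDr x y h).2⟩⟩
    rwa [Sym2.eq_swap]

/-! ### From indistinguishable families to the query bound -/

namespace Algorithm

variable (A : Algorithm)

theorem value_add (G : InputGraph) (φ ψ : A.Config → ℝ≥0∞) (t : ℕ) :
    A.value G (fun c => φ c + ψ c) t (.inl A.start, 0) =
      A.value G φ t (.inl A.start, 0) + A.value G ψ t (.inl A.start, 0) := by
  rw [← expect_config, PMF.expect_add, expect_config, expect_config]

/-- The probability to halt with `P` is at most the probability to halt with `P` at small cost plus
the probability of a large cost. -/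
theorem value_haltedInd_le (G : InputGraph) (P : ℝ → ℕ → Prop) (q : ℝ) (t : ℕ) :
    A.value G (A.haltedInd P) t (.inl A.start, 0) ≤
      A.value G (A.haltedInd fun v k => P v k ∧ k < ⌈q⌉₊) t (.inl A.start, 0) +
        A.probCostGe G q := by
  classical
  have h : (A.config G t).toOuterMeasure {c | q ≤ (c.2 : ℝ)} ≤ A.probCostGe G q :=
    le_iSup (fun t => (A.config G t).toOuterMeasure {c | q ≤ (c.2 : ℝ)}) t
  refine le_trans ?_ (add_le_add_right h _)
  rw [PMF.toOuterMeasure_eq_expect, expect_config, ← value_add]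
  refine A.value_mono G (fun c => ?_) t _
  rcases c with ⟨s | v, k⟩
  · exact zero_le
  · by_cases hk : k < ⌈q⌉₊
    · refine le_trans (le_of_eq ?_) le_self_add
      simp [haltedInd, hk]
    · have : q ≤ (k : ℝ) := Nat.ceil_le.1 (not_lt.1 hk)
      refine le_trans ?_ le_add_self
      rw [if_pos (show (Sum.inr v, k) ∈ {c : A.Config | q ≤ (c.2 : ℝ)} from this), haltedInd]
      split_ifs
      · exact le_rfl
      · exact zero_le

/-- Disjoint outputs. -/
theorem value_haltedInd_le_of_disjoint (G : InputGraph) {P P' : ℝ → ℕ → Prop}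
    (hPP' : ∀ v k, P v k → ¬ P' v k) (h : 2 / 3 < A.probHalt G P') (t : ℕ) :
    A.value G (A.haltedInd P) t (.inl A.start, 0) ≤ 1 / 3 := by
  rw [probHalt_eq] at h
  obtain ⟨s, hs⟩ := lt_iSup_iff.1 h
  have h1 := A.value_monotone G (A.haltedInd_le_expect G P) (le_max_left t s) (.inl A.start, 0)
  have h2 := A.value_monotone G (A.haltedInd_le_expect G P') (le_max_right t s) (.inl A.start, 0)
  have h3 := A.value_le_one G (φ := fun c => A.haltedInd P c + A.haltedInd P' c) (fun c => by
    rcases c with ⟨s | v, k⟩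
    · simp [haltedInd]
    · by_cases hP : P v k
      · simp [haltedInd, hP, hPP' v k hP]
      · simp only [haltedInd, if_neg hP, zero_add]
        split_ifs
        · exact le_rfl
        · exact zero_le) (max t s) (.inl A.start, 0)
  rw [value_add] at h3
  have h4 : A.value G (A.haltedInd P) t (.inl A.start, 0) + 2 / 3 ≤ 1 / 3 + 2 / 3 := by
    refine (add_le_add h1 (hs.le.trans h2)).trans (h3.trans_eq ?_)
    rw [ENNReal.div_add_div_same, show (1 : ℝ≥0∞) + 2 = 3 by norm_num, ENNReal.div_self (by simp) (by simp)]
  exact (ENNReal.add_le_add_iff_right (by finiteness)).1 h4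

/-- If a good approximation for one family of graphs is a bad one for another and few queries do not
distinguish the families, then many queries are needed. -/
theorem exists_quarter_le_probCostGe {c : ℝ} (hc : 1 ≤ c)
    (hA : ∀ G : InputGraph,
      2 / 3 < A.probHalt G (fun nhat _ => (G.n : ℝ) / c ≤ nhat ∧ nhat ≤ c * G.n))
    {H H' : InputGraph} (hH : H.V = Finset.range H.n) (hH' : H'.V = Finset.range H'.n)
    {N p p' : ℕ} {q : ℝ} (hp : ⌈q⌉₊ ≤ p + 1) (hp' : ⌈q⌉₊ ≤ p' + 1) (hpN : p < N) (hpN' : p' < N)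
    (hcn : c ^ 2 * (H.n + 2 * p : ℕ) < (H'.n + 2 * p' : ℕ))
    (hloss : (⌈q⌉₊ - 1 : ℕ) * (queryLoss ⌈q⌉₊ N H.n p + queryLoss ⌈q⌉₊ N H'.n p') < 1 / 12) :
    ∃ σ : Finset ℕ × ℕ, σ.1.card = p ∧ 1 / 4 ≤ A.probCostGe (H.planted σ) q := by
  by_contra! hcon
  set Q := ⌈q⌉₊
  set P : ℝ → ℕ → Prop := fun v _ =>
    ((H.n + 2 * p : ℕ) : ℝ) / c ≤ v ∧ v ≤ c * (H.n + 2 * p : ℕ) with hP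
  set φ := A.haltedInd fun v k => P v k ∧ k < Q with hφ
  have hn : ∀ (H : InputGraph) (p : ℕ), ∀ σ ∈ placements N p ∅, (H.planted σ).n = H.n + 2 * p := by
    intro H p σ hσ
    rw [H.planted_n, (mem_placements.1 hσ).1.1.2, add_comm]
  -- A good answer within the budget has probability at least `2/3 - 1/4 = 5/12`.
  have hex : ∀ σ ∈ placements N p ∅, ∃ t,
      5 / 12 ≤ A.value (H.planted σ) φ t (.inl A.start, 0) := by
    intro σ hσ
    have h := hA (H.planted σ)
    rw [hn H p σ hσ, probHalt_eq] at h
    obtain ⟨t, ht⟩ := lt_iSup_iff.1 h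
    refine ⟨t, ?_⟩
    have h1 := A.value_haltedInd_le (H.planted σ) P q t
    have h2 := hcon σ (mem_placements.1 hσ).1.1.2
    have h3 : (5 / 12 : ℝ≥0∞) + 1 / 4 ≤ A.value (H.planted σ) φ t (.inl A.start, 0) + 1 / 4 := by
      refine le_trans (le_of_eq ?_) (ht.le.trans (h1.trans (add_le_add_right h2.le _)))
      rw [← ENNReal.toReal_eq_toReal_iff' (by finiteness) (by finiteness),
        ENNReal.toReal_add (by finiteness) (by finiteness)]
      simp only [ENNReal.toReal_div, ENNReal.toReal_ofNat, ENNReal.toReal_one]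
      norm_num
    exact (ENNReal.add_le_add_iff_right (by finiteness)).1 h3
  choose! τ hτ using hex
  -- There are finitely many placements, so one time serves them all.
  set T := (placements N p ∅).sup τ
  have hlow : 5 / 12 ≤ avgOn (placements N p ∅) fun σ =>
      A.value (H.planted σ) φ T (.inl A.start, 0) := by
    refine avgOn.le_of_ge (placements_nonempty (Finset.empty_subset _) (Nat.zero_le _) hpN.le
      (by lia)) fun σ hσ => (hτ σ hσ).trans ?_
    exact A.value_monotone _ (A.haltedInd_le_expect _ _) (Finset.le_sup hσ) _
  have hhigh : (avgOn (placements N p' ∅) fun σ =>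
      A.value (H'.planted σ) φ T (.inl A.start, 0)) ≤ 1 / 3 := by
    refine avgOn.le_of_le fun σ hσ => ?_
    refine A.value_haltedInd_le_of_disjoint _ (fun v k h h' => ?_) (hA (H'.planted σ)) T
    rw [hn H' p' σ hσ] at h'
    have hc0 : 0 < c := by linarith
    have h1 := (div_le_iff₀ hc0).1 h'.1
    have h2 := mul_le_mul_of_nonneg_right h.1.2 hc0.le
    nlinarith
  have hφ1 : ∀ x, φ x ≤ 1 := by
    rintro ⟨s | v, k⟩
    · exact zero_le
    · rw [hφ, haltedInd]
      split_ifs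
      · exact le_rfl
      · exact zero_le
  have hφQ : ∀ x : A.Config, Q ≤ x.2 → φ x = 0 := by
    rintro ⟨s | v, k⟩ hk
    · rfl
    · rw [hφ, haltedInd, if_neg]
      exact fun h => absurd h.2 (not_lt.2 hk)
  have h := A.avgOn_value_le hφ1 hφQ hH hH' hp hp' hpN hpN' T (.inl A.start)
    (Finset.empty_subset (Finset.range N)) Finset.card_empty.le
  -- On the second family the same answers are bad and have probability at most `1/3`, so an
  -- advantage of `1/12` would be needed, more than the total loss.
  have h1 : (5 / 12 : ℝ≥0∞) < 1 / 3 + 1 / 12 :=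
    (hlow.trans (h.trans (add_le_add_left hhigh _))).trans_lt
      (ENNReal.add_lt_add_left (by finiteness) hloss)
  refine h1.ne ?_
  rw [← ENNReal.toReal_eq_toReal_iff' (by finiteness) (by finiteness),
    ENNReal.toReal_add (by finiteness) (by finiteness)]
  simp only [ENNReal.toReal_div, ENNReal.toReal_ofNat, ENNReal.toReal_one]
  norm_num

end Algorithm

namespace Algorithm

theorem mul_queryLoss_le {Q N r p : ℕ}
    (h : 60 * ((Q - 1) * (r + 2 * Q)) ≤ r + 2 * p) (h' : 60 * ((Q - 1) * (2 * (p + 1))) ≤ N) :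
    ((Q - 1 : ℕ) : ℝ≥0∞) * queryLoss Q N r p ≤ 1 / 30 := by
  have h1 : (((Q - 1) * (r + 2 * Q) : ℕ) : ℝ≥0∞) / (r + 2 * p : ℕ) ≤ (1 : ℕ) / (60 : ℕ) :=
    ENNReal.natCast_div_le_natCast_div (by lia) (by lia)
  have h2 : (((Q - 1) * (2 * (p + 1)) : ℕ) : ℝ≥0∞) / N ≤ (1 : ℕ) / (60 : ℕ) :=
    ENNReal.natCast_div_le_natCast_div (by lia) (by lia)
  refine le_trans (le_of_eq ?_) ((add_le_add h1 h2).trans (le_of_eq ?_))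
  · rw [queryLoss, Nat.cast_mul, Nat.cast_mul (Q - 1), Nat.cast_mul 2 (p + 1), Nat.cast_two,
      mul_add, mul_div_assoc, mul_div_assoc, mul_div_assoc]
  · rw [← ENNReal.toReal_eq_toReal_iff' (by finiteness) (by finiteness),
      ENNReal.toReal_add (by finiteness) (by finiteness)]
    simp only [ENNReal.toReal_div, ENNReal.toReal_ofNat, ENNReal.toReal_one,
      ENNReal.toReal_natCast]
    norm_num

end Algorithm

/-- The sizes of the core and of the matching. -/
theorem exists_core_size {n m Q : ℕ} (hn : 2 ≤ n) (hnm : n ≤ 2 * m) (hm : m ≤ n.choose 2)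
    (hQ : Q = ⌈1 / 100 * (n / √(2 * m))⌉₊) :
    ∃ r p e, 2 ≤ r ∧ r ≤ 2 * e ∧ e ≤ r.choose 2 ∧ r + 2 * p = n ∧ p + e = m ∧ Q ≤ p + 1 ∧
      60 * ((Q - 1) * (r + 2 * Q)) ≤ n := by
  have hnm' : (n : ℝ) ≤ 2 * m := by exact_mod_cast hnm
  have hn' : (2 : ℝ) ≤ n := by exact_mod_cast hn
  have hS2 : √(2 * m) ^ 2 = 2 * m := Real.sq_sqrt (by positivity)
  have hS0 : 0 < √(2 * m) := Real.sqrt_pos.2 (by linarith)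
  set S := √(2 * m)
  -- If `Q ≤ 1`, the factor `Q - 1` of the loss vanishes and the whole graph may serve as the core.
  by_cases hR : 1 / 100 * (n / S) ≤ 1
  · have hQ1 : Q ≤ 1 := by
      rw [hQ, Nat.ceil_le]
      exact_mod_cast hR
    refine ⟨n, 0, m, hn, hnm, hm, by lia, by lia, by lia, ?_⟩
    rw [Nat.sub_eq_zero_of_le hQ1, zero_mul, mul_zero]
    exact Nat.zero_le _
  · push Not at hR
    have hnS : 100 * S < n := by
      rw [mul_div_assoc', lt_div_iff₀ hS0] at hR
      linarith
    have hS10 : 10 < S := by nlinarith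
    have hn1000 : (1000 : ℝ) < n := by linarith
    obtain ⟨u, hu⟩ : ∃ u, u = ⌈S⌉₊ := ⟨_, rfl⟩
    have hu1 : S ≤ u := hu ▸ Nat.le_ceil S
    have hu2 : (u : ℝ) < S + 1 := hu ▸ Nat.ceil_lt_add_one hS0.le
    -- The parity leaves an even number of vertices for the pairs, and `r ≥ S + 1` gives `r(r-1) ≥
    -- S² = 2m`, so the remaining edges fit into the core.
    obtain ⟨r, hr1, hr2, hr3⟩ : ∃ r, u + 1 ≤ r ∧ r ≤ u + 2 ∧ r % 2 = n % 2 := by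
      by_cases h : (u + 1) % 2 = n % 2
      · exact ⟨u + 1, le_rfl, by lia, h⟩
      · exact ⟨u + 2, by lia, le_rfl, by lia⟩
    have hr1' : (u : ℝ) + 1 ≤ r := by exact_mod_cast hr1
    have hr2' : (r : ℝ) ≤ u + 2 := by exact_mod_cast hr2
    have hrn : r ≤ n := by
      have : (r : ℝ) ≤ n := by linarith
      exact_mod_cast this
    obtain ⟨p, hp⟩ : ∃ p, r + 2 * p = n := ⟨(n - r) / 2, by lia⟩
    have hp' : (r : ℝ) + 2 * p = n := by exact_mod_cast hp
    obtain ⟨e, he⟩ : ∃ e, p + e = m := ⟨m - p, by lia⟩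
    have hr2 : 2 ≤ r := by
      have : (2 : ℝ) ≤ r := by linarith
      exact_mod_cast this
    have hQu : (Q : ℝ) < 1 / 100 * (n / S) + 1 := hQ ▸ Nat.ceil_lt_add_one (by positivity)
    have hQ1 : 1 ≤ Q := by
      rw [hQ, Nat.one_le_ceil_iff]
      linarith
    have hRn : n / S ≤ n / 10 := div_le_div_of_nonneg_left (by linarith) (by norm_num) hS10.le
    have hRS : n / S ≤ S := by
      rw [div_le_iff₀ hS0]
      nlinarith
    have hRS' : n / S * S = n := div_mul_cancel₀ _ hS0.ne'
    refine ⟨r, p, e, hr2, by lia, ?_, hp, he, ?_, ?_⟩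
    · rw [Nat.choose_two_right, Nat.le_div_iff_mul_le two_pos]
      have h1 : ((m * 2 : ℕ) : ℝ) ≤ ((r * (r - 1) : ℕ) : ℝ) := by
        rw [Nat.cast_mul, Nat.cast_mul, Nat.cast_sub (by lia)]
        push_cast
        nlinarith
      have h2 : m * 2 ≤ r * (r - 1) := by exact_mod_cast h1
      lia
    · have : (Q : ℝ) ≤ p + 1 := by linarith
      exact_mod_cast this
    · have h1 : ((60 * ((Q - 1) * (r + 2 * Q)) : ℕ) : ℝ) ≤ n := by
        push_cast [Nat.cast_sub hQ1]
        have h2 : (Q : ℝ) - 1 ≤ 1 / 100 * (n / S) := by linarith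
        -- Chosen so that `60 · (1/100) · (8/5) < 1`.
        have h3 : (r : ℝ) + 2 * Q ≤ 8 / 5 * S := by linarith
        have h4 : (0 : ℝ) ≤ (Q : ℝ) - 1 := by
          rw [sub_nonneg]
          exact_mod_cast hQ1
        have h5 := mul_le_mul h2 h3 (by positivity) (by positivity)
        linarith
      exact_mod_cast h1

/-- Any constant-factor approximation of the number of vertices requires many queries. -/
theorem exists_quarter_le_probCostGe {c : ℝ} (hc : 1 ≤ c) {A : Algorithm}
    (hA : ∀ G : InputGraph,
      2 / 3 < A.probHalt G (fun nhat _ => (G.n : ℝ) / c ≤ nhat ∧ nhat ≤ c * G.n))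
    {n m : ℕ} (hn : 2 ≤ n) (hnm : n ≤ 2 * m) (hm : m ≤ n.choose 2) :
    ∃ G : InputGraph, G.n = n ∧ G.m = m ∧ 1 / 4 ≤ A.probCostGe G (1 / 100 * √(G.n / G.avgDeg)) := by
  obtain ⟨Q, hQ⟩ : ∃ Q, Q = ⌈1 / 100 * (n / √(2 * m))⌉₊ := ⟨_, rfl⟩
  obtain ⟨r, p, e, hr, hre, he, hrp, hpe, hQp, hQr⟩ := exists_core_size hn hnm hm hQ
  obtain ⟨H, hH, hHn, hHm⟩ := InputGraph.exists_core hr hre he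
  obtain ⟨H', hH', hHn', -⟩ := InputGraph.exists_core (r := 2) (e := 1) le_rfl le_rfl (by decide)
  -- The second family may be as large as needed: `p'` makes it exceed `c² n` vertices and hides its
  -- single edge, and then `N` makes guessing labels useless for both families. The budget is not
  -- affected, so `κ = 1/100` works for every `c`.
  obtain ⟨p', hp'⟩ : ∃ p', p' = ⌈c ^ 2 * n⌉₊ + Q + 60 * ((Q - 1) * (2 + 2 * Q)) := ⟨_, rfl⟩
  obtain ⟨N, hN⟩ : ∃ N, N = p + p' + 1 + 60 * ((Q - 1) * (2 * (p + 1))) +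
    60 * ((Q - 1) * (2 * (p' + 1))) := ⟨_, rfl⟩
  obtain ⟨σ, hσ, h⟩ := A.exists_quarter_le_probCostGe hc hA hH hH' (N := N) (p := p) (p' := p')
    (q := 1 / 100 * (n / √(2 * m))) (by rwa [← hQ]) (by rw [← hQ]; lia) (by lia) (by lia)
    (by
      rw [hHn, hrp]
      refine (Nat.le_ceil _).trans_lt ?_
      exact_mod_cast (by lia : ⌈c ^ 2 * n⌉₊ < H'.n + 2 * p'))
    (by
      rw [← hQ, hHn, hHn', mul_add]
      refine (add_le_add (Algorithm.mul_queryLoss_le (by lia) (by lia))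
        (Algorithm.mul_queryLoss_le (by lia) (by lia))).trans_lt ?_
      rw [← ENNReal.toReal_lt_toReal (by finiteness) (by finiteness),
        ENNReal.toReal_add (by finiteness) (by finiteness)]
      simp only [ENNReal.toReal_div, ENNReal.toReal_ofNat, ENNReal.toReal_one]
      norm_num)
  have hGn : (H.planted σ).n = n := by
    rw [H.planted_n, hσ, hHn, ← hrp, add_comm]
  have hGm : (H.planted σ).m = m := by
    rw [H.planted_m, hσ, hHm, hpe]
  refine ⟨H.planted σ, hGn, hGm, ?_⟩
  rwa [InputGraph.sqrt_n_div_avgDeg, hGn, hGm]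

theorem theorem1p5 :
    -- (a) upper bound in the advanced model
    (∃ (C : ℝ) (j : ℕ), ∀ ε : ℝ, 0 < ε → ε < 1 →
      ∃ A : Algorithm, A.IsAdvanced ∧ ∀ G : InputGraph,
        99 / 100 < A.probHalt G (fun nhat cost =>
          |nhat - G.n| ≤ ε * G.n ∧
          (cost : ℝ) ≤ C * (ε⁻¹ ^ 2 * √(G.n / G.avgDeg)) * Real.log G.n ^ j)) ∧
    -- (b) lower bound in the full adjacency model
    (∀ c : ℝ, 1 ≤ c → ∃ κ : ℝ, 0 < κ ∧ ∀ A : Algorithm,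
      (∀ G : InputGraph,
        2 / 3 < A.probHalt G (fun nhat _ => (G.n : ℝ) / c ≤ nhat ∧ nhat ≤ c * G.n)) →
      ∀ n m : ℕ, 2 ≤ n → n ≤ 2 * m → m ≤ n.choose 2 →
        ∃ G : InputGraph, G.n = n ∧ G.m = m ∧
          1 / 4 ≤ A.probCostGe G (κ * √(G.n / G.avgDeg))) :=
  ⟨exists_approximation_algorithm, fun _ hc => ⟨1 / 100, by norm_num, fun _ hA _ _ hn hnm hm =>
    exists_quarter_le_probCostGe hc hA hn hnm hm⟩⟩
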